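/- Let $\Bbbk$ be an algebraically closed field of characteristic $2$, and let $C$ be a smooth projective curve of genus $2$ over $\Bbbk$ that is ordinary (i.e. its Hasse--Witt matrix is invertible; equivalently, its Jacobian $J(C)$ has four $2$-torsion points). Let $X\subset\mathbb{P}^3$ be the Kummer quartic surface of $C$, the image of $J(C)$ under the map given by $|2\Theta|$, which identifies $X$ with the quotient of $J(C)$ by $\pm1$. In suitable homogeneous coordinates $x,y,z,w$ of $\mathbb{P}^3$ it is the surface $$X=V\bigl(a(x^2y^2+z^2w^2)+b(x^2z^2+y^2w^2)+c(x^2w^2+y^2z^2)+xyzw\bigr)$$ with non-zero constants $a,b,c\in\Bbbk$. Fix such coordinates. Let $\mathrm{Bit}(X)\subset G_1(\mathbb{P}^3)$ be the set of bitangent lines of $X$, i.e. of lines $\ell$ that either lie on $X$ or on which $X$ cuts out a divisor $2p+2q$ (with $p=q$ allowed). A congruence of lines is a closed subset of $G_1(\mathbb{P}^3)$ all of whose irreducible components are surfaces; its bidegree is $(m,n)$, where $m$ is the number of its lines through a general point and $n$ the number of its lines in a general plane. A bitangent involution of $X$ is a birational involution $\sigma\neq\mathrm{id}$ of $X$ such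 that, for general $p\in X$, the line $\langle p,\sigma(p)\rangle$ is a bitangent line of $X$ and determines the orbit $\{p,\sigma(p)\}$; let $S(\sigma)\subset G_1(\mathbb{P}^3)$ be the closure of the set of lines $\langle p,\sigma(p)\rangle$. A trope plane of $X$ is a plane on which $X$ cuts out an irreducible conic with multiplicity two. The $\beta$-plane of a plane $\Pi$ is the set of lines contained in $\Pi$. Then $\mathrm{Bit}(X)$ is a congruence of lines of bidegree $(3,7)$ with exactly seven irreducible components, namely: (1) three components of bidegree $(1,1)$: for each of the three pairs of skew coordinate lines $\{V(x,y),V(z,w)\}$, $\{V(x,z),V(y,w)\}$, $\{V(x,w),V(y,z)\}$, the congruence of lines meeting both lines of the pair. The surface $X$ has exactly three bitangent involutions $\sigma_1,\sigma_2,\sigma_3$, and these three components are $S(\sigma_1),S(\sigma_2),S(\sigma_3)$; (2) four components of bidegree $(0,1)$: the $\beta$-planes of the four trope planes of $X$. The trope planes of $X$ are exactly the coordinate planes $V(x),V(y),V(z),V(w)$. -/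

import Mathlib

noncomputable section

open MvPolynomial LinearAlgebra.Projectivization

namespace KummerBit

/-! ### Projective three-space and its lines -/

/-- The projective space `ℙ³` over `k`. -/
abbrev P3 (k : Type*) [Field k] := ℙ k (Fin 4 → k)

/-- The zero set in `ℙ³` of a homogeneous polynomial. -/
def zeros {k : Type*} [Field k] (G : MvPolynomial (Fin 4) k) : Set (P3 k) :=
  {P | eval P.rep G = 0}

/-- The Zariski topology of `ℙ³`. -/
instance zariskiP3 (k : Type*) [Field k] : TopologicalSpace (P3 k) :=
  TopologicalSpace.generateFrom
    {U | ∃ (d : ℕ) (G : MvPolynomial (Fin 4) k), G.IsHomogeneous d ∧ U = (zeros G)ᶜ}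

/-- A line of `ℙ³`, i.e. a point of the Grassmannian `G₁(ℙ³)`: a plane in `k⁴`. -/
@[ext]
structure Line (k : Type*) [Field k] where
  space : Submodule k (Fin 4 → k)
  finrank_space : Module.finrank k space = 2

/-- The Plücker coordinates `u_i v_j - u_j v_i` of the line spanned by `u` and `v`. -/
def plucker {k : Type*} [Field k] (u v : Fin 4 → k) : Fin 4 × Fin 4 → k :=
  fun p => u p.1 * v p.2 - u p.2 * v p.1

/-- The Zariski topology of `G₁(ℙ³)`: closed sets are cut out by homogeneous polynomials in the
Plücker coordinates. -/
instance zariskiLine (k : Type*) [Field k] : TopologicalSpace (Line k) :=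
  TopologicalSpace.generateFrom
    {U | ∃ (d : ℕ) (G : MvPolynomial (Fin 4 × Fin 4) k), G.IsHomogeneous d ∧
      U = {l : Line k | ∃ u v : Fin 4 → k,
        l.space = Submodule.span k {u, v} ∧ eval (plucker u v) G ≠ 0}}

/-- `p` holds at a general point of `X`, i.e. on a dense open subset of `X`. -/
def Generically {k : Type*} [Field k] (X : Set (P3 k)) (p : P3 k → Prop) : Prop :=
  ∃ U : Set (P3 k), IsOpen U ∧ X ⊆ closure (X ∩ U) ∧ ∀ P ∈ X ∩ U, p P

/-- The irreducible components of a subset of a topological space. -/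
def componentsOf {T : Type*} [TopologicalSpace T] (S : Set T) : Set (Set T) :=
  {Z | Maximal (fun Z' : Set T => IsIrreducible Z' ∧ Z' ⊆ S) Z}

/-! ### Congruences of lines -/

/-- A congruence of lines: a closed subset of `G₁(ℙ³)` all of whose irreducible components are
surfaces. -/
def IsCongruence {k : Type*} [Field k] (S : Set (Line k)) : Prop :=
  IsClosed S ∧ ∀ Z ∈ componentsOf S, topologicalKrullDim Z = 2

/-- The lines of `S` through the point `P`. -/
def raysThrough {k : Type*} [Field k] (S : Set (Line k)) (P : P3 k) : Set (Line k) :=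
  {l | l ∈ S ∧ P.submodule ≤ l.space}

/-- The lines of `S` in the plane `∑ uᵢ xᵢ = 0`, where `H = [u]` is a point of the dual space. -/
def raysIn {k : Type*} [Field k] (S : Set (Line k)) (H : P3 k) : Set (Line k) :=
  {l | l ∈ S ∧ ∀ v ∈ l.space, ∑ i, H.rep i * v i = 0}

/-- `S` is a congruence of bidegree `(m, n)`: there are exactly `m` rays of `S` through a general
point and exactly `n` rays of `S` in a general plane. -/
def HasBidegree {k : Type*} [Field k] (S : Set (Line k)) (m n : ℕ) : Prop :=
  IsCongruence S ∧
  Generically (Set.univ : Set (P3 k)) (fun P => (raysThrough S P).encard = m) ∧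
  Generically (Set.univ : Set (P3 k)) (fun H => (raysIn S H).encard = n)

/-- The lines meeting two given linear subspaces of `ℙ³`. -/
def linesMeeting {k : Type*} [Field k] (A B : Submodule k (Fin 4 → k)) : Set (Line k) :=
  {l | l.space ⊓ A ≠ ⊥ ∧ l.space ⊓ B ≠ ⊥}

/-- The `β`-plane of a plane `E`: the lines contained in `E`. -/
def betaPlane {k : Type*} [Field k] (E : Submodule k (Fin 4 → k)) : Set (Line k) :=
  {l | l.space ≤ E}

/-- The coordinate plane `xᵢ = 0`. -/
def coordPlane (k : Type*) [Field k] (i : Fin 4) : Submodule k (Fin 4 → k) :=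
  LinearMap.ker (LinearMap.proj i : (Fin 4 → k) →ₗ[k] k)

/-- The coordinate line `xᵢ = xⱼ = 0` (for `i ≠ j`). -/
def coordLine (k : Type*) [Field k] (i j : Fin 4) : Submodule k (Fin 4 → k) :=
  coordPlane k i ⊓ coordPlane k j

/-- The three congruences of lines meeting a pair of skew coordinate lines
`{V(x,y), V(z,w)}`, `{V(x,z), V(y,w)}`, `{V(x,w), V(y,z)}`. -/
def skewCongruence (k : Type*) [Field k] : Fin 3 → Set (Line k) :=
  ![linesMeeting (coordLine k 0 1) (coordLine k 2 3),
    linesMeeting (coordLine k 0 2) (coordLine k 1 3),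
    linesMeeting (coordLine k 0 3) (coordLine k 1 2)]

/-! ### Bitangent lines and tropes -/

/-- The binary form `F(s u + t v)`. -/
def restrictToLine {k : Type*} [Field k] (F : MvPolynomial (Fin 4) k) (u v : Fin 4 → k) :
    MvPolynomial (Fin 2) k :=
  aeval (fun i => C (u i) * X 0 + C (v i) * X 1) F

/-- The bitangent lines of the surface `V(F)`: the lines that are contained in `V(F)`, or on which
`V(F)` cuts out a divisor `2a + 2b + D'` with `D'` effective (`a = b` is allowed). The points `a`
and `b` are the zeros of the linear forms `A` and `B`. -/
def Bit {k : Type*} [Field k] (F : MvPolynomial (Fin 4) k) : Set (Line k) :=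
  {l | ∃ u v : Fin 4 → k, l.space = Submodule.span k {u, v} ∧
    (restrictToLine F u v = 0 ∨
      ∃ A B : MvPolynomial (Fin 2) k, A.IsHomogeneous 1 ∧ B.IsHomogeneous 1 ∧ A ≠ 0 ∧ B ≠ 0 ∧
        A ^ 2 * B ^ 2 ∣ restrictToLine F u v)}

/-- `E` is a trope plane of the quartic surface `V(F)`: `V(F)` cuts out on the plane `E` the double
of an irreducible conic `Q = 0` (a plane conic is irreducible if and only if it contains no
line). -/
def IsTropePlane {k : Type*} [Field k] (F : MvPolynomial (Fin 4) k)
    (E : Submodule k (Fin 4 → k)) : Prop :=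
  Module.finrank k E = 3 ∧ ∃ Q : MvPolynomial (Fin 4) k, Q.IsHomogeneous 2 ∧
    (∀ v ∈ E, eval v F = eval v Q ^ 2) ∧
    ¬ ∃ l : Line k, l.space ≤ E ∧ ∀ v ∈ l.space, eval v Q = 0

/-! ### Bitangent involutions

A rational map from a surface in `ℙ³` to `ℙ³` is given by four forms of the same degree. -/

/-- The rational map given by the forms `Φ` is defined (by these forms) at `P` and sends `P`
to `Q`. -/
def Sends {k : Type*} [Field k] (Φ : Fin 4 → MvPolynomial (Fin 4) k) (P Q : P3 k) : Prop :=
  (fun i => eval P.rep (Φ i)) ≠ 0 ∧ (fun i => eval P.rep (Φ i)) ∈ Q.submodule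

/-- `Φ` gives a birational involution of `X` (different from the identity). -/
def IsBirationalInvolution {k : Type*} [Field k] (X : Set (P3 k))
    (Φ : Fin 4 → MvPolynomial (Fin 4) k) : Prop :=
  (∃ d : ℕ, ∀ i, (Φ i).IsHomogeneous d) ∧
  Generically X (fun P => ∃ Q ∈ X, Sends Φ P Q ∧ Sends Φ Q P ∧ Q ≠ P)

/-- `Φ` and `Ψ` give the same rational map on `X`. -/
def SameRationalMap {k : Type*} [Field k] (X : Set (P3 k))
    (Φ Ψ : Fin 4 → MvPolynomial (Fin 4) k) : Prop :=
  Generically X (fun P => ∃ Q, Sends Φ P Q ∧ Sends Ψ P Q)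

/-- The congruence `S(σ)`: the closure of the set of lines `⟨P, σ(P)⟩` spanned by the orbits
of `σ`. -/
def orbitCongruence {k : Type*} [Field k] (X : Set (P3 k))
    (Φ : Fin 4 → MvPolynomial (Fin 4) k) : Set (Line k) :=
  closure {l | ∃ P ∈ X, ∃ Q ∈ X, Sends Φ P Q ∧ Q ≠ P ∧ l.space = P.submodule ⊔ Q.submodule}

/-- `Φ` gives a bitangent involution `σ` of `V(F)`: a birational involution such that, for general
`P`, the line `⟨P, σ(P)⟩` is a bitangent line and determines the orbit `{P, σ(P)}`. -/
def IsBitangentInvolution {k : Type*} [Field k] (F : MvPolynomial (Fin 4) k)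
    (Φ : Fin 4 → MvPolynomial (Fin 4) k) : Prop :=
  IsBirationalInvolution (zeros F) Φ ∧
  Generically (zeros F) (fun P => ∀ Q, Sends Φ P Q →
    ∀ l : Line k, l.space = P.submodule ⊔ Q.submodule → l ∈ Bit F) ∧
  ∃ U : Set (P3 k), IsOpen U ∧ zeros F ⊆ closure (zeros F ∩ U) ∧
    ∀ P ∈ zeros F ∩ U, ∀ P' ∈ zeros F ∩ U, ∀ Q Q' : P3 k, Sends Φ P Q → Sends Φ P' Q' →
      P.submodule ⊔ Q.submodule = P'.submodule ⊔ Q'.submodule → P' = P ∨ P' = Q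

/-! ### Curves of genus two in characteristic two and their Kummer quartic surfaces -/

/-- The binary form `∑ cᵢ Xⁱ Z^(n-i)`, with `X = X 0` and `Z = X 1`. -/
def binaryForm {k : Type*} [Field k] (n : ℕ) (c : Fin (n + 1) → k) : MvPolynomial (Fin 2) k :=
  ∑ i : Fin (n + 1), C (c i) * X 0 ^ (i : ℕ) * X 1 ^ (n - (i : ℕ))

/-- A smooth projective curve of genus two, in the form `Y² + h(X, Z) Y = f(X, Z)` in the weighted
projective plane `ℙ(1, 3, 1)`, where `h` and `f` are binary forms of degrees `3` and `6`. The
curve has no point at which all partial derivatives of the equation vanish. -/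
structure GenusTwoCurve (k : Type*) [Field k] where
  h : Fin 4 → k
  f : Fin 7 → k
  smooth : ∀ (p : Fin 2 → k) (y : k), p ≠ 0 →
    y ^ 2 + eval p (binaryForm 3 h) * y = eval p (binaryForm 6 f) →
    ¬ (2 * y + eval p (binaryForm 3 h) = 0 ∧
      ∀ i, eval p (pderiv i (binaryForm 3 h)) * y = eval p (pderiv i (binaryForm 6 f)))

/-- The matrix of the Frobenius map on `H¹(C, 𝒪)` with respect to the basis `y/x, y/x²` (the
Hasse-Witt matrix) of the curve `y² + h y = f` in characteristic two; its `(i, j)` entry is the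
coefficient `h_{2i-j}`, for `i, j = 1, 2`. -/
def GenusTwoCurve.hasseWitt {k : Type*} [Field k] (C : GenusTwoCurve k) :
    Matrix (Fin 2) (Fin 2) k :=
  !![C.h 1, C.h 0; C.h 3, C.h 2]

/-- A curve of genus two in characteristic two is ordinary (of `2`-rank two) if its Hasse-Witt
matrix is invertible. -/
def GenusTwoCurve.IsOrdinary {k : Type*} [Field k] (C : GenusTwoCurve k) : Prop :=
  C.hasseWitt.det ≠ 0

/-- `(p, y) = (X, Z, Y)` is a point of the curve. -/
def GenusTwoCurve.IsPoint {k : Type*} [Field k] (C : GenusTwoCurve k) (p : Fin 2 → k) (y : k) :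
    Prop :=
  p ≠ 0 ∧ y ^ 2 + eval p (binaryForm 3 C.h) * y = eval p (binaryForm 6 C.f)

/-- The map from the symmetric square of the curve, hence from its Jacobian, to `ℙ³` given by the
linear system `|2Θ|`, in characteristic two. In affine coordinates, the class of
`(x₁, y₁) + (x₂, y₂)` minus the canonical divisor is sent to `[1, x₁ + x₂, x₁ x₂, κ]` with
`κ = ((x₁ + x₂)(f₁ + f₃ x₁ x₂ + f₅ x₁² x₂²) + h(x₁) y₂ + h(x₂) y₁) / (x₁ + x₂)²`. -/
def GenusTwoCurve.kummerCoord {k : Type*} [Field k] (C : GenusTwoCurve k)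
    (p₁ : Fin 2 → k) (y₁ : k) (p₂ : Fin 2 → k) (y₂ : k) : Fin 4 → k :=
  ![p₁ 1 * p₂ 1,
    p₁ 0 * p₂ 1 + p₂ 0 * p₁ 1,
    p₁ 0 * p₂ 0,
    ((p₁ 0 * p₂ 1 + p₂ 0 * p₁ 1) *
        (C.f 1 * (p₁ 1 * p₂ 1) ^ 2 + C.f 3 * (p₁ 0 * p₂ 0) * (p₁ 1 * p₂ 1)
          + C.f 5 * (p₁ 0 * p₂ 0) ^ 2)
      + eval p₁ (binaryForm 3 C.h) * y₂ + eval p₂ (binaryForm 3 C.h) * y₁)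
      / (p₁ 0 * p₂ 1 + p₂ 0 * p₁ 1) ^ 2]

/-- The Kummer surface in `ℙ³` of a curve of genus two in characteristic two: the closure of the
image of the pairs of points of the curve with distinct images under the hyperelliptic double
cover. It is the image of the Jacobian under `|2Θ|`, i.e. the quotient of the Jacobian by the
negation involution. -/
def GenusTwoCurve.kummer {k : Type*} [Field k] (C : GenusTwoCurve k) : Set (P3 k) :=
  closure {P | ∃ (p₁ : Fin 2 → k) (y₁ : k) (p₂ : Fin 2 → k) (y₂ : k),
    C.IsPoint p₁ y₁ ∧ C.IsPoint p₂ y₂ ∧ p₁ 0 * p₂ 1 + p₂ 0 * p₁ 1 ≠ 0 ∧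
    ∃ hv : C.kummerCoord p₁ y₁ p₂ y₂ ≠ 0, P = Projectivization.mk k _ hv}

/-- The homogeneous ideal of a subset of `ℙ³`. -/
def homogeneousIdeal {k : Type*} [Field k] (X : Set (P3 k)) : Ideal (MvPolynomial (Fin 4) k) :=
  Ideal.span {G | (∃ d : ℕ, G.IsHomogeneous d) ∧ X ⊆ zeros G}

/-- `F = 0` is the equation, in suitable projective coordinates of `ℙ³`, of the Kummer quartic
surface of the curve `C`. -/
def IsKummerEquation {k : Type*} [Field k] (C : GenusTwoCurve k) (F : MvPolynomial (Fin 4) k) :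
    Prop :=
  ∃ g : (Fin 4 → k) ≃ₗ[k] (Fin 4 → k),
    homogeneousIdeal
      (Projectivization.map (g : (Fin 4 → k) →ₗ[k] (Fin 4 → k)) g.injective '' C.kummer)
      = Ideal.span {F}

/-- The quartic form
`a (x²y² + z²w²) + b (x²z² + y²w²) + c (x²w² + y²z²) + xyzw`. -/
def kummerQuartic {k : Type*} [Field k] (a b c : k) : MvPolynomial (Fin 4) k :=
  C a * (X 0 ^ 2 * X 1 ^ 2 + X 2 ^ 2 * X 3 ^ 2)
    + C b * (X 0 ^ 2 * X 2 ^ 2 + X 1 ^ 2 * X 3 ^ 2)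
    + C c * (X 0 ^ 2 * X 3 ^ 2 + X 1 ^ 2 * X 2 ^ 2)
    + X 0 * X 1 * X 2 * X 3

end KummerBit

end

open MvPolynomial LinearAlgebra.Projectivization

namespace KummerBit

/-! Let α, β, γ be square roots of a, b, c. In characteristic two the quartic is Q² + xyzw with Q =
`rootQuadric α β γ`, and squares have zero derivative, so differentiating the quartic only sees
xyzw. A binary quartic over an algebraically closed field of characteristic two is a square exactly
when its partial derivatives vanish. Hence a line is bitangent if and only if `polar p q = 0` for
all p, q on it, a condition in which a, b, c no longer occur.

Suppose that such a line lies in no coordinate plane. At its point on xᵢ = 0 the condition says that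
another coordinate vanishes too. Having the same zero on the line is thus an equivalence relation on
the four coordinates without singleton classes, so the coordinates can be matched in pairs, and the
line belongs to a skew congruence (`exists_component_of_polar_eq_zero`). The same reduction for
planes gives the tropes (`eq_coordPlane_of_polar_eq_zero`). Each of the seven components is cut out
by the vanishing of Plücker coordinates and covered by affine planes, from which irreducibility,
dimension and bidegree are read off.

On a line of a skew congruence, with parameters s and t, the quartic is e(A²s⁴ + B²t⁴) + M s²t². Its
zeros are exchanged by the Cremona map sending xᵢ to xyzw divided by the coordinate paired with xᵢ;
this is the bitangent involution. Conversely, a bitangent involution moves a general point along one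
of the three rays through it, and irreducibility of the surface makes the choice of ray constant
(`exists_sameRationalMap_cremona`).

For the equation of the Kummer surface, factor h into linear forms with roots r₁, r₂, r₃. The
Hasse-Witt determinant is the product of their brackets, so ordinary means that the roots are
distinct. Let mᵢ be the product of the brackets of rᵢ with the two points, σ the bracket of the
points, and x a suitable shift of the fourth coordinate. Then σ²x² + m₁m₂m₃x + A₁(m₂m₃)² + A₂(m₁m₃)²
+ A₃(m₁m₂)² = 0 (`kummerValue_eq_zero`). Smoothness of the curve above rᵢ gives Aᵢ ≠ 0. As σ is a
linear combination of the mᵢ, its square is a sum of squares, and rescaling the mᵢ yields the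
standard form. -/

/-- A homogeneous polynomial scales with its degree. -/
lemma eval_smul_of_isHomogeneous {k ι : Type*} [CommSemiring k] {d : ℕ} {G : MvPolynomial ι k}
    (hG : G.IsHomogeneous d) (c : k) (x : ι → k) : eval (c • x) G = c ^ d * eval x G := by
  rw [eval_eq, eval_eq, Finset.mul_sum]
  refine Finset.sum_congr rfl fun m hm => ?_
  have hd : ∑ i ∈ m.support, m i = d := by
    simpa [Finsupp.weight_apply, Finsupp.sum] using hG (mem_support_iff.1 hm)
  simp only [Pi.smul_apply, smul_eq_mul, mul_pow, Finset.prod_mul_distrib,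
    Finset.prod_pow_eq_pow_sum, hd]
  ring

/-! ### Topologies defined by homogeneous polynomials -/

section HomZariski

variable {k : Type*} [Field k] {ι : Type*} {T : Type*} [TopologicalSpace T]

/-- The topology of `T` is generated by the non-vanishing loci of homogeneous polynomials in the
homogeneous coordinates `coord`. -/
def HomZariski (coord : T → ι → k) : Prop :=
  ‹TopologicalSpace T› = TopologicalSpace.generateFrom
    {U | ∃ (d : ℕ) (G : MvPolynomial ι k), G.IsHomogeneous d ∧ U = {t | eval (coord t) G ≠ 0}}

namespace HomZariski

variable {coord : T → ι → k}

lemma isOpen_ne (hT : HomZariski coord) {d : ℕ} {G : MvPolynomial ι k} (hG : G.IsHomogeneous d) :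
    IsOpen {t | eval (coord t) G ≠ 0} := by
  rw [hT]
  exact TopologicalSpace.isOpen_generateFrom_of_mem ⟨d, G, hG, rfl⟩

lemma isClosed_eq (hT : HomZariski coord) {d : ℕ} {G : MvPolynomial ι k} (hG : G.IsHomogeneous d) :
    IsClosed {t | eval (coord t) G = 0} := by
  rw [← isOpen_compl_iff]
  exact hT.isOpen_ne hG

lemma isTopologicalBasis (hT : HomZariski coord) :
    TopologicalSpace.IsTopologicalBasis
      {U : Set T | ∃ (d : ℕ) (G : MvPolynomial ι k), G.IsHomogeneous d ∧
        U = {t | eval (coord t) G ≠ 0}} where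
  exists_subset_inter := by
    rintro _ ⟨d, G, hG, rfl⟩ _ ⟨e, H, hH, rfl⟩ t ht
    refine ⟨_, ⟨d + e, G * H, hG.mul hH, rfl⟩, ?_, ?_⟩
    · simpa using ht
    · intro s hs
      simpa using hs
  sUnion_eq := by
    refine Set.eq_univ_of_forall fun t => ⟨_, ⟨0, 1, isHomogeneous_one _ _, rfl⟩, by simp⟩
  eq_generateFrom := hT

/-- Every neighbourhood of `t` contains a basic one. -/
lemma exists_ne_subset (hT : HomZariski coord) {U : Set T} (hU : IsOpen U) {t : T} (ht : t ∈ U) :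
    ∃ (d : ℕ) (G : MvPolynomial ι k), G.IsHomogeneous d ∧ eval (coord t) G ≠ 0 ∧
      ∀ s, eval (coord s) G ≠ 0 → s ∈ U := by
  obtain ⟨_, ⟨d, G, hG, rfl⟩, h1, h2⟩ := hT.isTopologicalBasis.exists_subset_of_mem_open ht hU
  exact ⟨d, G, hG, h1, h2⟩

/-- Needed because the dimension of a component is that of the subspace with its induced topology.
-/
lemma subtype (hT : HomZariski coord) (Z : Set T) :
    HomZariski (fun t : Z => coord t) := by
  unfold HomZariski
  change TopologicalSpace.induced _ _ = _
  rw [hT, induced_generateFrom_eq]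
  congr 1
  ext U
  constructor
  · rintro ⟨_, ⟨d, G, hG, rfl⟩, rfl⟩
    exact ⟨d, G, hG, rfl⟩
  · rintro ⟨d, G, hG, rfl⟩
    exact ⟨_, ⟨d, G, hG, rfl⟩, rfl⟩

/-- A set that is parametrized by polynomials is irreducible. -/
lemma isIrreducible_of_param (hT : HomZariski coord) [Infinite k] {τ : Type*} {S : Set T}
    (D : MvPolynomial τ k) (hD : D ≠ 0) (q : ι → MvPolynomial τ k)
    (h1 : ∀ w, eval w D ≠ 0 → ∃ t ∈ S, ∃ c : k, c ≠ 0 ∧ (fun i => eval w (q i)) = c • coord t)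
    (h2 : ∀ t ∈ S, ∃ w, ∃ c : k, c ≠ 0 ∧ (fun i => eval w (q i)) = c • coord t) :
    IsIrreducible S := by
  have exists_ne : ∀ g : MvPolynomial τ k, g ≠ 0 → ∃ w, eval w g ≠ 0 := by
    intro g hg
    by_contra! h
    exact hg (MvPolynomial.funext fun x => by simpa using h x)
  have key : ∀ {d : ℕ} {G : MvPolynomial ι k}, G.IsHomogeneous d → ∀ (w : τ → k) (t : T) (c : k),
      (fun i => eval w (q i)) = c • coord t →
      eval w (aeval q G) = c ^ d * eval (coord t) G := by
    intro d G hG w t c h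
    have h0 : eval w (aeval q G) = eval (fun i => eval w (q i)) G := by
      rw [← coe_aeval_eq_eval, ← coe_aeval_eq_eval, RingHom.coe_coe, RingHom.coe_coe,
        MvPolynomial.comp_aeval_apply]
    rw [h0, h, eval_smul_of_isHomogeneous hG]
  refine ⟨?_, ?_⟩
  · obtain ⟨w, hw⟩ := exists_ne D hD
    obtain ⟨t, ht, -⟩ := h1 w hw
    exact ⟨t, ht⟩
  · rintro U V hU hV ⟨t, htS, htU⟩ ⟨s, hsS, hsV⟩
    obtain ⟨d, G, hG, hGt, hGU⟩ := hT.exists_ne_subset hU htU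
    obtain ⟨e, H, hH, hHs, hHV⟩ := hT.exists_ne_subset hV hsV
    obtain ⟨w, c, hc, hw⟩ := h2 t htS
    obtain ⟨w', c', hc', hw'⟩ := h2 s hsS
    have hg : aeval q G ≠ 0 := fun h0 => by
      have := key hG w t c hw
      rw [h0, map_zero] at this
      exact mul_ne_zero (pow_ne_zero _ hc) hGt this.symm
    have hh : aeval q H ≠ 0 := fun h0 => by
      have := key hH w' s c' hw'
      rw [h0, map_zero] at this
      exact mul_ne_zero (pow_ne_zero _ hc') hHs this.symm
    -- Both pulled back forms are non-zero polynomials, hence so is their product with D. Over an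
    -- infinite field there is a parameter at which none of the three vanishes, and its image lies
    -- in both open sets.
    obtain ⟨v, hv⟩ := exists_ne _ (mul_ne_zero (mul_ne_zero hg hh) hD)
    simp only [map_mul, mul_ne_zero_iff] at hv
    obtain ⟨r, hrS, b, hb, hr⟩ := h1 v hv.2
    refine ⟨r, hrS, hGU r ?_, hHV r ?_⟩
    · have := hv.1.1
      rw [key hG v r b hr] at this
      exact (mul_ne_zero_iff.1 this).2
    · have := hv.1.2
      rw [key hH v r b hr] at this
      exact (mul_ne_zero_iff.1 this).2

end HomZariski

end HomZariski

/-! ### Dimension of spaces covered by affine planes -/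

section Dimension

variable {k : Type*} [Field k] {ι : Type*} {T : Type*} [TopologicalSpace T]

lemma eval_aeval {k σ τ : Type*} [CommSemiring k] (q : σ → MvPolynomial τ k)
    (G : MvPolynomial σ k) (w : τ → k) :
    eval w (aeval q G) = eval (fun i => eval w (q i)) G := by
  rw [← coe_aeval_eq_eval, ← coe_aeval_eq_eval, RingHom.coe_coe, RingHom.coe_coe,
    MvPolynomial.comp_aeval_apply]

/-- Homogenization of a polynomial in the affine coordinates `x (c j) / x i`. -/
lemma exists_homogenization {σ : Type*} (i : ι) (c : σ → ι) (g : MvPolynomial σ k) :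
    ∃ N₀ : ℕ, ∀ N ≥ N₀, ∃ G : MvPolynomial ι k, G.IsHomogeneous N ∧
      ∀ x : ι → k, x i ≠ 0 → eval x G = x i ^ N * eval (fun j => x (c j) / x i) g := by
  induction g using MvPolynomial.induction_on with
  | C a =>
    refine ⟨0, fun N _ => ⟨C a * X i ^ N, ?_, fun x _ => ?_⟩⟩
    · simpa using (isHomogeneous_C ι a).mul ((isHomogeneous_X k i).pow N)
    · simp [mul_comm]
  -- Having a homogenization in every sufficiently large degree allows the two summands to be put in
  -- the same degree.
  | add p q hp hq =>
    obtain ⟨N₁, h1⟩ := hp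
    obtain ⟨N₂, h2⟩ := hq
    refine ⟨max N₁ N₂, fun N hN => ?_⟩
    obtain ⟨G, hG, hG'⟩ := h1 N (le_trans (le_max_left _ _) hN)
    obtain ⟨H, hH, hH'⟩ := h2 N (le_trans (le_max_right _ _) hN)
    refine ⟨G + H, hG.add hH, fun x hx => ?_⟩
    rw [map_add, hG' x hx, hH' x hx, map_add]
    ring
  | mul_X p j hp =>
    obtain ⟨N₁, h1⟩ := hp
    refine ⟨N₁ + 1, fun N hN => ?_⟩
    obtain ⟨N, rfl⟩ : ∃ M, N = M + 1 := ⟨N - 1, by omega⟩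
    obtain ⟨G, hG, hG'⟩ := h1 N (by omega)
    refine ⟨G * X (c j), hG.mul (isHomogeneous_X k _), fun x hx => ?_⟩
    rw [map_mul, hG' x hx, map_mul, eval_X, eval_X]
    field_simp
    ring

variable {coord : T → ι → k}

/-- If `T` is covered by charts on which all coordinates are polynomials in two of them, then the
dimension of `T` is at most two. -/
lemma HomZariski.topologicalKrullDim_le (hT : HomZariski coord)
    (hcov : ∀ t : T, ∃ (i : ι) (c : Fin 2 → ι) (q : ι → MvPolynomial (Fin 2) k), coord t i ≠ 0 ∧
      ∀ s : T, coord s i ≠ 0 →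
        coord s = coord s i • fun m => eval (fun j => coord s (c j) / coord s i) (q m)) :
    topologicalKrullDim T ≤ 2 := by
  have hdim : ringKrullDim (MvPolynomial (Fin 2) k) = 2 := by
    rw [MvPolynomial.ringKrullDim_of_isNoetherianRing]
    simp
  -- All members of a chain of irreducible closed sets contain a point t₀ of the smallest one. In
  -- the chart at t₀ they correspond to prime ideals of k[x, y] in a strictly decreasing chain, so
  -- the length is at most two.
  refine iSup_le fun p => ?_
  obtain ⟨t₀, ht₀⟩ := (p 0).2.nonempty
  obtain ⟨i, c, q, hi, hq⟩ := hcov t₀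
  let w : T → Fin 2 → k := fun s j => coord s (c j) / coord s i
  let U : Set T := {s | coord s i ≠ 0}
  have hU : IsOpen U := by
    have := hT.isOpen_ne (isHomogeneous_X k i)
    simpa using this
  -- Points outside the chart are added to the set, which makes it the zero set of the i-th
  -- coordinate times a homogenization of g.
  have hclosed : ∀ g : MvPolynomial (Fin 2) k, IsClosed {s | coord s i = 0 ∨ eval (w s) g = 0} := by
    intro g
    obtain ⟨N₀, h⟩ := exists_homogenization i c g
    obtain ⟨G, hG, hG'⟩ := h N₀ le_rfl
    convert hT.isClosed_eq ((isHomogeneous_X k i).mul hG) using 1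
    ext s
    simp only [Set.mem_ofPred_eq, map_mul, eval_X, mul_eq_zero]
    by_cases hs : coord s i = 0
    · simp [hs]
    · simp [hs, hG' _ hs, w]
  have hmeet : ∀ n, t₀ ∈ (p n : Set T) := fun n => (p.strictMono.monotone (Fin.zero_le n)) ht₀
  let I : Fin (p.length + 1) → PrimeSpectrum (MvPolynomial (Fin 2) k) := fun n =>
    { asIdeal :=
        { carrier := {g | ∀ s ∈ (p n : Set T), coord s i ≠ 0 → eval (w s) g = 0}
          add_mem' := fun ha hb s hs hsi => by rw [map_add, ha s hs hsi, hb s hs hsi, add_zero]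
          zero_mem' := fun s _ _ => map_zero _
          smul_mem' := fun a b hb s hs hsi => by
            rw [smul_eq_mul, map_mul, hb s hs hsi, mul_zero] }
      isPrime := by
        refine ⟨?_, ?_⟩
        · rw [Ne, Ideal.eq_top_iff_one]
          intro h
          exact one_ne_zero ((map_one (eval (w t₀))).symm.trans (h t₀ (hmeet n) hi))
        · intro g₁ g₂ h
          have hsub : (p n : Set T) ⊆ {s | coord s i = 0 ∨ eval (w s) g₁ = 0} ∪
              {s | coord s i = 0 ∨ eval (w s) g₂ = 0} := by
            intro s hs
            by_cases hsi : coord s i = 0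
            · exact Or.inl (Or.inl hsi)
            · have := h s hs hsi
              rw [map_mul, mul_eq_zero] at this
              exact this.imp Or.inr Or.inr
          rcases isPreirreducible_iff_isClosed_union_isClosed.1 (p n).2.isPreirreducible _ _
              (hclosed g₁) (hclosed g₂) hsub with h | h
          · exact Or.inl fun s hs hsi => (h hs).resolve_left hsi
          · exact Or.inr fun s hs hsi => (h hs).resolve_left hsi }
  have hI : ∀ m n, m < n → I n < I m := by
    intro m n hmn
    have hlt : (p m : Set T) ⊂ p n := p.strictMono hmn
    refine lt_of_le_of_ne (fun g hg s hs hsi => hg s (hlt.subset hs) hsi) fun heq => ?_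
    -- The part of an irreducible set inside the chart is dense in it, so a strict inclusion is
    -- already visible in the chart.
    obtain ⟨s, ⟨hsn, hsU⟩, hsm⟩ : ∃ s ∈ (p n : Set T) ∩ U, s ∉ (p m : Set T) := by
      by_contra! hcon
      have h1 := subset_closure_inter_of_isPreirreducible_of_isOpen (p n).2.isPreirreducible hU
        ⟨t₀, hmeet n, hi⟩
      exact hlt.not_subset (h1.trans ((p m).3.closure_subset_iff.2 hcon))
    obtain ⟨d, G, hG, hGs, hGm⟩ := hT.exists_ne_subset (p m).3.isOpen_compl hsm
    have hval : ∀ r : T, coord r i ≠ 0 →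
        eval (coord r) G = coord r i ^ d * eval (w r) (aeval q G) := by
      intro r hr
      rw [hq r hr, eval_smul_of_isHomogeneous hG, eval_aeval]
      have h1 : (coord r i • fun m => eval (fun j => coord r (c j) / coord r i) (q m)) i
          = coord r i := by rw [← hq r hr]
      rw [h1]
    have hmem : aeval q G ∈ (I m).asIdeal := by
      intro r hr hri
      have h1 : eval (coord r) G = 0 := by
        by_contra h
        exact hGm r h hr
      rw [hval r hri] at h1
      exact (mul_eq_zero.1 h1).resolve_left (pow_ne_zero _ hri)
    rw [← heq] at hmem
    exact hGs (by rw [hval s hsU, hmem s hsn hsU, mul_zero])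
  have hser : (p.length : WithBot ℕ∞) ≤ Order.krullDim (PrimeSpectrum (MvPolynomial (Fin 2) k))ᵒᵈ :=
    Order.LTSeries.length_le_krullDim
      (LTSeries.mk p.length (fun n => OrderDual.toDual (I n)) fun m n h => hI m n h)
  rw [Order.krullDim_orderDual] at hser
  exact hser.trans hdim.le

/-- Three nested irreducible closed sets show that the dimension is at least two. -/
lemma two_le_topologicalKrullDim {A B C : Set T} (hA : IsIrreducible A) (hB : IsIrreducible B)
    (hC : IsIrreducible C) (hAB : A ⊆ B) (hBC : B ⊆ C) (hAB' : ¬ B ⊆ closure A)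
    (hBC' : ¬ C ⊆ closure B) : 2 ≤ topologicalKrullDim T := by
  let a : TopologicalSpace.IrreducibleCloseds T := ⟨closure A, hA.closure, isClosed_closure⟩
  let b : TopologicalSpace.IrreducibleCloseds T := ⟨closure B, hB.closure, isClosed_closure⟩
  let c : TopologicalSpace.IrreducibleCloseds T := ⟨closure C, hC.closure, isClosed_closure⟩
  have hab : a < b := lt_of_le_not_ge (closure_mono hAB) fun h => hAB' (subset_closure.trans h)
  have hbc : b < c := lt_of_le_not_ge (closure_mono hBC) fun h => hBC' (subset_closure.trans h)
  have := Order.LTSeries.length_le_krullDim (LTSeries.mk 2 ![a, b, c] (by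
    rw [Fin.strictMono_iff_lt_succ]
    intro i
    fin_cases i
    · exact hab
    · exact hbc))
  exact this

end Dimension

/-! ### Lines and their Plücker coordinates -/

section Lines

variable {k : Type*} [Field k]

lemma plucker_ne_zero_iff {u v : Fin 4 → k} :
    plucker u v ≠ 0 ↔ LinearIndependent k ![u, v] := by
  rw [LinearIndependent.pair_iff]
  constructor
  · intro h s t hst
    have hst' : ∀ i, s * u i + t * v i = 0 := fun i => by simpa using congrFun hst i
    have h1 : ∀ p, s * plucker u v p = 0 := by
      rintro ⟨i, j⟩
      simp only [plucker]
      linear_combination v j * hst' i - v i * hst' j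
    have h2 : ∀ p, t * plucker u v p = 0 := by
      rintro ⟨i, j⟩
      simp only [plucker]
      linear_combination u i * hst' j - u j * hst' i
    obtain ⟨p, hp⟩ := Function.ne_iff.1 h
    exact ⟨(mul_eq_zero.1 (h1 p)).resolve_right hp, (mul_eq_zero.1 (h2 p)).resolve_right hp⟩
  · intro h h0
    have h0' : ∀ i j, u i * v j - u j * v i = 0 := fun i j => congrFun h0 (i, j)
    have hv : ∀ i, v i = 0 := by
      intro i
      -- The entries of v i • u - u i • v are Plücker coordinates up to sign, so this combination
      -- vanishes.
      refine (h (v i) (-(u i)) ?_).1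
      ext j
      simp only [Pi.add_apply, Pi.smul_apply, smul_eq_mul, Pi.zero_apply]
      linear_combination -h0' i j
    have := (h 0 1 (by ext j; simp [hv j])).2
    exact one_ne_zero this

/-- The line spanned by two independent vectors. -/
noncomputable def Line.ofPair (u v : Fin 4 → k) (h : plucker u v ≠ 0) : Line k where
  space := Submodule.span k {u, v}
  finrank_space := by
    have := finrank_span_eq_card (plucker_ne_zero_iff.1 h)
    rwa [Matrix.range_cons_cons_empty, Fintype.card_fin] at this

lemma Line.exists_pair (l : Line k) :
    ∃ u v : Fin 4 → k, l.space = Submodule.span k {u, v} ∧ plucker u v ≠ 0 := by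
  have b := Module.finBasisOfFinrankEq k l.space l.finrank_space
  refine ⟨b 0, b 1, ?_, ?_⟩
  · have h := congrArg (Submodule.map l.space.subtype) b.span_eq
    rw [Submodule.map_span, ← Set.range_comp, Submodule.map_top, Submodule.range_subtype] at h
    refine h.symm.trans ?_
    congr 1
    ext x
    simp [Fin.exists_fin_two, eq_comm]
  · rw [plucker_ne_zero_iff]
    have h := b.linearIndependent.map' l.space.subtype (Submodule.ker_subtype _)
    have h' : l.space.subtype ∘ b = ![(b 0 : Fin 4 → k), (b 1 : Fin 4 → k)] := by
      ext i
      fin_cases i <;> rfl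
    rwa [h'] at h

lemma plucker_combination (u v : Fin 4 → k) (a b c d : k) :
    plucker (a • u + b • v) (c • u + d • v) = (a * d - b * c) • plucker u v := by
  ext p
  simp only [plucker, Pi.add_apply, Pi.smul_apply, smul_eq_mul]
  ring

lemma Line.plucker_ne_zero {l : Line k} {u v : Fin 4 → k} (h : l.space = Submodule.span k {u, v}) :
    plucker u v ≠ 0 := by
  rw [plucker_ne_zero_iff]
  have := l.finrank_space
  rw [h] at this
  rw [linearIndependent_iff_card_eq_finrank_span, Matrix.range_cons_cons_empty, Set.finrank, this,
    Fintype.card_fin]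

lemma plucker_proportional {l : Line k} {u v u' v' : Fin 4 → k}
    (h : l.space = Submodule.span k {u, v}) (h' : l.space = Submodule.span k {u', v'}) :
    ∃ c : k, c ≠ 0 ∧ plucker u' v' = c • plucker u v := by
  have hu : u' ∈ l.space := h' ▸ Submodule.subset_span (by simp)
  have hv : v' ∈ l.space := h' ▸ Submodule.subset_span (by simp)
  rw [h, Submodule.mem_span_pair] at hu hv
  obtain ⟨a, b, rfl⟩ := hu
  obtain ⟨c, d, rfl⟩ := hv
  refine ⟨_, ?_, plucker_combination u v a b c d⟩
  intro h0
  have := Line.plucker_ne_zero h'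
  rw [plucker_combination, h0, zero_smul] at this
  exact this rfl

/-- The Plücker coordinates of a line, with respect to some basis. -/
noncomputable def Line.coord (l : Line k) : Fin 4 × Fin 4 → k :=
  plucker l.exists_pair.choose l.exists_pair.choose_spec.choose

lemma Line.exists_coord (l : Line k) :
    ∃ u v : Fin 4 → k, l.space = Submodule.span k {u, v} ∧ l.coord = plucker u v :=
  ⟨_, _, l.exists_pair.choose_spec.choose_spec.1, rfl⟩

lemma Line.coord_ne_zero (l : Line k) : l.coord ≠ 0 :=
  l.exists_pair.choose_spec.choose_spec.2

/-- A change of basis multiplies the Plücker vector by a determinant. Homogeneous conditions can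
therefore be tested on the single chosen vector `Line.coord`. -/
lemma Line.plucker_eq_smul_coord {l : Line k} {u v : Fin 4 → k}
    (h : l.space = Submodule.span k {u, v}) : ∃ c : k, c ≠ 0 ∧ plucker u v = c • l.coord := by
  obtain ⟨u', v', h1, h2⟩ := l.exists_coord
  rw [h2]
  exact plucker_proportional h1 h

lemma Line.coord_eq_zero_iff {l : Line k} {u v : Fin 4 → k}
    (h : l.space = Submodule.span k {u, v}) (p : Fin 4 × Fin 4) :
    l.coord p = 0 ↔ plucker u v p = 0 := by
  obtain ⟨c, hc, h'⟩ := Line.plucker_eq_smul_coord h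
  simp [h', hc]

lemma Line.coord_swap (l : Line k) (i j : Fin 4) : l.coord (i, j) = -l.coord (j, i) := by
  obtain ⟨u, v, -, h⟩ := l.exists_coord
  simp [h, plucker]

lemma Line.coord_self (l : Line k) (i : Fin 4) : l.coord (i, i) = 0 := by
  obtain ⟨u, v, -, h⟩ := l.exists_coord
  simp [h, plucker]

lemma homZariski_line : HomZariski (Line.coord : Line k → Fin 4 × Fin 4 → k) := by
  unfold HomZariski
  change TopologicalSpace.generateFrom _ = _
  congr 1
  ext U
  refine exists_congr fun d => exists_congr fun G => and_congr_right fun hG => ?_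
  suffices h : {l : Line k | ∃ u v : Fin 4 → k,
      l.space = Submodule.span k {u, v} ∧ eval (plucker u v) G ≠ 0}
      = {l | eval l.coord G ≠ 0} by rw [h]
  ext l
  constructor
  · rintro ⟨u, v, h1, h2⟩
    obtain ⟨c, hc, h'⟩ := Line.plucker_eq_smul_coord h1
    rw [h', eval_smul_of_isHomogeneous hG] at h2
    exact (mul_ne_zero_iff.1 h2).2
  · intro h
    obtain ⟨u, v, h1, h2⟩ := l.exists_coord
    exact ⟨u, v, h1, h2 ▸ h⟩

/-- The first vector of the basis of a line that is normalized at the coordinates `i` and `j`. -/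
noncomputable def Line.vecFst (l : Line k) (i j : Fin 4) : Fin 4 → k :=
  fun m => l.coord (m, j) / l.coord (i, j)

/-- The second vector of the basis of a line that is normalized at the coordinates `i` and `j`. -/
noncomputable def Line.vecSnd (l : Line k) (i j : Fin 4) : Fin 4 → k :=
  fun m => l.coord (i, m) / l.coord (i, j)

/-- This is the Plücker relation c_ij c_mn = c_mj c_in - c_nj c_im. -/
lemma Line.coord_eq_smul_plucker_vec {l : Line k} {i j : Fin 4} (h : l.coord (i, j) ≠ 0) :
    l.coord = l.coord (i, j) • plucker (l.vecFst i j) (l.vecSnd i j) := by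
  ext ⟨m, n⟩
  simp only [plucker, Line.vecFst, Line.vecSnd, Pi.smul_apply, smul_eq_mul]
  field_simp
  obtain ⟨u, v, -, h⟩ := l.exists_coord
  simp only [h, plucker]
  ring

/-- The two vectors are the points of the line with (i, j)-entries (1, 0) and (0, 1); Cramer's rule
gives their coefficients in terms of u and v. -/
lemma Line.space_eq_span_vec {l : Line k} {i j : Fin 4} (h : l.coord (i, j) ≠ 0) :
    l.space = Submodule.span k {l.vecFst i j, l.vecSnd i j} := by
  obtain ⟨u, v, h1, h2⟩ := l.exists_coord
  have hp : plucker (l.vecFst i j) (l.vecSnd i j) ≠ 0 := by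
    intro h0
    have := Line.coord_eq_smul_plucker_vec h
    rw [h0, smul_zero] at this
    exact l.coord_ne_zero this
  refine (Submodule.eq_of_le_of_finrank_eq ?_ ?_).symm
  · rw [Submodule.span_le, h1]
    rintro x (rfl | rfl)
    · refine Submodule.mem_span_pair.2 ⟨v j / l.coord (i, j), -(u j) / l.coord (i, j), ?_⟩
      ext m
      simp only [Line.vecFst, Pi.add_apply, Pi.smul_apply, smul_eq_mul, h2, plucker]
      ring
    · refine Submodule.mem_span_pair.2 ⟨-(v i) / l.coord (i, j), u i / l.coord (i, j), ?_⟩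
      ext m
      simp only [Line.vecSnd, Pi.add_apply, Pi.smul_apply, smul_eq_mul, h2, plucker]
      ring
  · rw [l.finrank_space]
    exact (Line.ofPair _ _ hp).finrank_space

end Lines

/-! ### The seven components -/

/-- The pairing of the coordinates that belongs to a pair of skew coordinate lines. -/
def partner : Fin 3 → Fin 4 → Fin 4 := ![![1, 0, 3, 2], ![2, 3, 0, 1], ![3, 2, 1, 0]]

/-- The Plücker coordinates that vanish on a component. -/
def Vanishes : Fin 3 ⊕ Fin 4 → Fin 4 → Fin 4 → Prop
  | Sum.inl r, i, j => i = j ∨ j = partner r i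
  | Sum.inr m, i, j => i = j ∨ i = m ∨ j = m

instance : ∀ t i j, Decidable (Vanishes t i j)
  | Sum.inl r, i, j => inferInstanceAs (Decidable (i = j ∨ j = partner r i))
  | Sum.inr m, i, j => inferInstanceAs (Decidable (i = j ∨ i = m ∨ j = m))

/-- The coordinates of the first of the two points that span a line of a component. -/
def supportFst : Fin 3 ⊕ Fin 4 → Fin 4 → Prop
  | Sum.inl r, i => i = 0 ∨ i = partner r 0
  | Sum.inr m, i => i ≠ m

/-- The coordinates of the second of the two points that span a line of a component. -/
def supportSnd : Fin 3 ⊕ Fin 4 → Fin 4 → Prop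
  | Sum.inl r, i => i ≠ 0 ∧ i ≠ partner r 0
  | Sum.inr m, i => i ≠ m

instance : ∀ t i, Decidable (supportFst t i)
  | Sum.inl r, i => inferInstanceAs (Decidable (i = 0 ∨ i = partner r 0))
  | Sum.inr m, i => inferInstanceAs (Decidable (i ≠ m))

instance : ∀ t i, Decidable (supportSnd t i)
  | Sum.inl r, i => inferInstanceAs (Decidable (i ≠ 0 ∧ i ≠ partner r 0))
  | Sum.inr m, i => inferInstanceAs (Decidable (i ≠ m))

/-- `(i, j, p, q)` is a chart of the component `t`: its lines with `(i, j)`-coordinate different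
from `0` are spanned by `eᵢ + α eₚ` and `eⱼ + δ e_q`. -/
def IsChart (t : Fin 3 ⊕ Fin 4) (i j p q : Fin 4) : Prop :=
  ¬ Vanishes t i j ∧ p ≠ i ∧ p ≠ j ∧ q ≠ i ∧ q ≠ j ∧
  supportFst t i ∧ supportSnd t j ∧ supportFst t p ∧ supportSnd t q ∧
  (∀ m, m ≠ i → m ≠ p → Vanishes t m j) ∧ (∀ m, m ≠ j → m ≠ q → Vanishes t i m)

instance (t : Fin 3 ⊕ Fin 4) (i j p q : Fin 4) : Decidable (IsChart t i j p q) := by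
  unfold IsChart; infer_instance

/-- Together with the next statements this puts all combinatorics of the seven components into
finite checks: every coordinate that is not identically zero on a component is, up to a swap, the
base of a chart. -/
lemma exists_isChart : ∀ (t : Fin 3 ⊕ Fin 4) (i j : Fin 4), ¬ Vanishes t i j →
    ∃ p q, IsChart t i j p q ∨ IsChart t j i p q := by decide

lemma IsChart.vanishes_of_support : ∀ (t : Fin 3 ⊕ Fin 4) (i j : Fin 4), Vanishes t i j → i ≠ j →
    ¬ (supportFst t i ∧ supportSnd t j) := by decide

lemma exists_isChart' : ∀ t : Fin 3 ⊕ Fin 4, ∃ i j p q, IsChart t i j p q := by decide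

lemma Vanishes.symm : ∀ (t : Fin 3 ⊕ Fin 4) (i j : Fin 4), Vanishes t i j → Vanishes t j i := by
  decide

/-- This separates the components: it excludes inclusions between them and makes rays of different
components distinct. -/
lemma exists_vanishes_of_ne : ∀ s t : Fin 3 ⊕ Fin 4, s ≠ t →
    ∃ i j, Vanishes s i j ∧ ¬ Vanishes t i j := by decide

/-- In a chart, the coordinates that do not vanish identically are monomials. -/
lemma IsChart.not_vanishes : ∀ (t : Fin 3 ⊕ Fin 4) (i j p q : Fin 4), IsChart t i j p q →
    ∀ m n, ¬ Vanishes t m n →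
      (m = i ∨ m = p) ∧ (n = j ∨ n = q) ∨ (n = i ∨ n = p) ∧ (m = j ∨ m = q) := by decide

section Components

variable {k : Type*} [Field k]

/-- The congruences of lines that turn out to be the components of the bitangent surface. -/
def component (k : Type*) [Field k] : Fin 3 ⊕ Fin 4 → Set (Line k) :=
  Sum.elim (skewCongruence k) fun i => betaPlane (coordPlane k i)

lemma eq_zero_of_smul_sub_smul_eq_zero {u v : Fin 4 → k} (h : plucker u v ≠ 0) {a b : k}
    (hab : a • u - b • v = 0) : a = 0 ∧ b = 0 := by
  rw [plucker_ne_zero_iff, LinearIndependent.pair_iff] at h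
  simpa using h a (-b) (by rw [← hab, neg_smul, sub_eq_add_neg])

lemma mem_coordLine {i j : Fin 4} {w : Fin 4 → k} : w ∈ coordLine k i j ↔ w i = 0 ∧ w j = 0 := by
  simp [coordLine, coordPlane]

lemma mem_coordPlane {i : Fin 4} {w : Fin 4 → k} : w ∈ coordPlane k i ↔ w i = 0 := by
  simp [coordPlane]

/-- The coordinate c_ij is the determinant of the linear forms xᵢ and xⱼ restricted to the line, so
it vanishes exactly when they have a common zero there. -/
lemma inf_coordLine_ne_bot_iff (l : Line k) (i j : Fin 4) :
    l.space ⊓ coordLine k i j ≠ ⊥ ↔ l.coord (i, j) = 0 := by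
  obtain ⟨u, v, h1, h2⟩ := l.exists_coord
  have hp : plucker u v ≠ 0 := h2 ▸ l.coord_ne_zero
  rw [h2, Submodule.ne_bot_iff]
  have hu : u ∈ l.space := h1 ▸ Submodule.subset_span (by simp)
  have hv : v ∈ l.space := h1 ▸ Submodule.subset_span (by simp)
  constructor
  · rintro ⟨w, ⟨hw1, hw2⟩, hw0⟩
    rw [h1, SetLike.mem_coe, Submodule.mem_span_pair] at hw1
    obtain ⟨s, t, rfl⟩ := hw1
    obtain ⟨hi, hj⟩ := mem_coordLine.1 hw2
    simp only [Pi.add_apply, Pi.smul_apply, smul_eq_mul] at hi hj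
    simp only [plucker]
    have e1 : s * (u i * v j - u j * v i) = 0 := by linear_combination v j * hi - v i * hj
    have e2 : t * (u i * v j - u j * v i) = 0 := by linear_combination u i * hj - u j * hi
    by_contra h
    apply hw0
    rw [(mul_eq_zero.1 e1).resolve_right h, (mul_eq_zero.1 e2).resolve_right h]
    simp
  · intro h
    simp only [plucker] at h
    -- The common zero is the zero of xᵢ, or of xⱼ, on the line; if both forms vanish identically,
    -- any point will do.
    by_cases hi : v i • u - u i • v = 0
    · obtain ⟨h3, h4⟩ := eq_zero_of_smul_sub_smul_eq_zero hp hi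
      by_cases hj : v j • u - u j • v = 0
      · obtain ⟨h5, h6⟩ := eq_zero_of_smul_sub_smul_eq_zero hp hj
        refine ⟨u, ⟨hu, mem_coordLine.2 ⟨h4, h6⟩⟩, ?_⟩
        rintro rfl
        exact hp (by ext p; simp [plucker])
      · refine ⟨_, ⟨sub_mem (Submodule.smul_mem _ _ hu) (Submodule.smul_mem _ _ hv),
          mem_coordLine.2 ⟨?_, ?_⟩⟩, hj⟩
        · simp [h3, h4]
        · simp [mul_comm]
    · refine ⟨_, ⟨sub_mem (Submodule.smul_mem _ _ hu) (Submodule.smul_mem _ _ hv),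
          mem_coordLine.2 ⟨?_, ?_⟩⟩, hi⟩
      · simp [mul_comm]
      · simp only [Pi.sub_apply, Pi.smul_apply, smul_eq_mul]
        linear_combination -h

lemma mem_betaPlane_coordPlane_iff (l : Line k) (m : Fin 4) :
    l ∈ betaPlane (coordPlane k m) ↔ ∀ j, l.coord (m, j) = 0 := by
  obtain ⟨u, v, h1, h2⟩ := l.exists_coord
  have hp : plucker u v ≠ 0 := h2 ▸ l.coord_ne_zero
  have hb : l ∈ betaPlane (coordPlane k m) ↔ u m = 0 ∧ v m = 0 := by
    change l.space ≤ _ ↔ _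
    rw [h1, Submodule.span_le, Set.pair_subset_iff]
    exact and_congr mem_coordPlane mem_coordPlane
  rw [hb, h2]
  constructor
  · rintro ⟨h3, h4⟩ j
    simp [plucker, h3, h4]
  · intro h
    refine (eq_zero_of_smul_sub_smul_eq_zero hp (a := v m) (b := u m) ?_).symm
    ext j
    have := h j
    simp only [plucker] at this
    simp only [Pi.sub_apply, Pi.smul_apply, smul_eq_mul, Pi.zero_apply]
    linear_combination -this

/-- This description treats skew congruences and β-planes alike, so that the later arguments need no
case distinction. -/
lemma mem_component_iff (t : Fin 3 ⊕ Fin 4) (l : Line k) :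
    l ∈ component k t ↔ ∀ i j, Vanishes t i j → l.coord (i, j) = 0 := by
  have hskew : ∀ i j m n : Fin 4, l ∈ linesMeeting (coordLine k i j) (coordLine k m n) ↔
      l.coord (i, j) = 0 ∧ l.coord (m, n) = 0 := fun i j m n =>
    and_congr (inf_coordLine_ne_bot_iff l i j) (inf_coordLine_ne_bot_iff l m n)
  rcases t with r | m
  · have key : ∀ i j m n : Fin 4, (∀ a b, Vanishes (Sum.inl r) a b →
        a = b ∨ (a, b) = (i, j) ∨ (b, a) = (i, j) ∨ (a, b) = (m, n) ∨ (b, a) = (m, n)) →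
        Vanishes (Sum.inl r) i j → Vanishes (Sum.inl r) m n →
        (l ∈ linesMeeting (coordLine k i j) (coordLine k m n) ↔
          ∀ i j, Vanishes (Sum.inl r) i j → l.coord (i, j) = 0) := by
      intro i j m n h hij hmn
      rw [hskew]
      refine ⟨fun ⟨h1, h2⟩ a b hab => ?_, fun h' => ⟨h' _ _ hij, h' _ _ hmn⟩⟩
      rcases h a b hab with rfl | h | h | h | h
      · exact l.coord_self _
      · rw [h, h1]
      · rw [l.coord_swap, h, h1, neg_zero]
      · rw [h, h2]
      · rw [l.coord_swap, h, h2, neg_zero]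
    fin_cases r
    · exact key 0 1 2 3 (by decide) (by decide) (by decide)
    · exact key 0 2 1 3 (by decide) (by decide) (by decide)
    · exact key 0 3 1 2 (by decide) (by decide) (by decide)
  · refine (mem_betaPlane_coordPlane_iff l m).trans ⟨fun h i j hij => ?_, fun h j => ?_⟩
    · rcases hij with rfl | rfl | rfl
      · exact l.coord_self _
      · exact h _
      · rw [l.coord_swap, h, neg_zero]
    · exact h m j (Or.inr (Or.inl rfl))

lemma isClosed_component (t : Fin 3 ⊕ Fin 4) : IsClosed (component k t) := by
  have : component k t = ⋂ (i) (j) (_ : Vanishes t i j), {l | l.coord (i, j) = 0} := by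
    ext l
    simp [mem_component_iff]
  rw [this]
  refine isClosed_iInter fun i => isClosed_iInter fun j => isClosed_iInter fun _ => ?_
  have := homZariski_line.isClosed_eq (isHomogeneous_X k (i, j))
  simpa using this

/-- The vector `eᵢ + α eₚ`. -/
def chartVec (i p : Fin 4) (α : k) : Fin 4 → k := Pi.single i 1 + α • Pi.single p 1

lemma vecFst_eq_chartVec {t : Fin 3 ⊕ Fin 4} {i j p q : Fin 4} (h : IsChart t i j p q) {l : Line k}
    (hl : l ∈ component k t) (h0 : l.coord (i, j) ≠ 0) :
    l.vecFst i j = chartVec i p (l.coord (p, j) / l.coord (i, j)) := by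
  rw [mem_component_iff] at hl
  ext m
  simp only [Line.vecFst, chartVec, Pi.add_apply, Pi.smul_apply, Pi.single_apply, smul_eq_mul]
  by_cases hmi : m = i
  · subst hmi
    simp [h0, h.2.1.symm]
  · by_cases hmp : m = p
    · subst hmp
      simp [hmi]
    · simp [hmi, hmp, hl _ _ (h.2.2.2.2.2.2.2.2.2.1 m hmi hmp)]

lemma vecSnd_eq_chartVec {t : Fin 3 ⊕ Fin 4} {i j p q : Fin 4} (h : IsChart t i j p q) {l : Line k}
    (hl : l ∈ component k t) (h0 : l.coord (i, j) ≠ 0) :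
    l.vecSnd i j = chartVec j q (l.coord (i, q) / l.coord (i, j)) := by
  rw [mem_component_iff] at hl
  ext m
  simp only [Line.vecSnd, chartVec, Pi.add_apply, Pi.smul_apply, Pi.single_apply, smul_eq_mul]
  by_cases hmi : m = j
  · subst hmi
    simp [h0, h.2.2.2.2.1.symm]
  · by_cases hmp : m = q
    · subst hmp
      simp [hmi]
    · simp [hmi, hmp, hl _ _ (h.2.2.2.2.2.2.2.2.2.2 m hmi hmp)]

/-- Every line of a component lies in a chart. -/
lemma exists_chart {t : Fin 3 ⊕ Fin 4} {l : Line k} (hl : l ∈ component k t) :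
    ∃ i j p q, IsChart t i j p q ∧ l.coord (i, j) ≠ 0 := by
  obtain ⟨⟨i, j⟩, h0⟩ := Function.ne_iff.1 l.coord_ne_zero
  have hv : ¬ Vanishes t i j := fun h => h0 ((mem_component_iff t l).1 hl i j h)
  obtain ⟨p, q, h | h⟩ := exists_isChart t i j hv
  · exact ⟨i, j, p, q, h, h0⟩
  · refine ⟨j, i, p, q, h, fun h' => h0 ?_⟩
    rw [l.coord_swap, h', neg_zero]
    rfl

lemma mem_component_of_support {t : Fin 3 ⊕ Fin 4} {l : Line k} {u v : Fin 4 → k}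
    (h : l.space = Submodule.span k {u, v}) (hu : ∀ i, ¬ supportFst t i → u i = 0)
    (hv : ∀ i, ¬ supportSnd t i → v i = 0) : l ∈ component k t := by
  rw [mem_component_iff]
  intro i j hij
  rw [Line.coord_eq_zero_iff h]
  by_cases hne : i = j
  · subst hne
    simp [plucker]
  · have h1 := IsChart.vanishes_of_support t i j hij hne
    have h2 := IsChart.vanishes_of_support t j i hij.symm (Ne.symm hne)
    have e1 : u i * v j = 0 := by
      by_cases h3 : supportFst t i
      · rw [hv j fun h4 => h1 ⟨h3, h4⟩, mul_zero]
      · rw [hu i h3, zero_mul]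
    have e2 : u j * v i = 0 := by
      by_cases h3 : supportFst t j
      · rw [hv i fun h4 => h2 ⟨h3, h4⟩, mul_zero]
      · rw [hu j h3, zero_mul]
    simp [plucker, e1, e2]

lemma chartVec_supportFst {t : Fin 3 ⊕ Fin 4} {i j p q : Fin 4} (h : IsChart t i j p q) (α : k)
    (m : Fin 4) (hm : ¬ supportFst t m) : chartVec i p α m = 0 := by
  have h1 : m ≠ i := by rintro rfl; exact hm h.2.2.2.2.2.1
  have h2 : m ≠ p := by rintro rfl; exact hm h.2.2.2.2.2.2.2.1
  simp [chartVec, h1, h2]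

lemma chartVec_supportSnd {t : Fin 3 ⊕ Fin 4} {i j p q : Fin 4} (h : IsChart t i j p q) (α : k)
    (m : Fin 4) (hm : ¬ supportSnd t m) : chartVec j q α m = 0 := by
  have h1 : m ≠ j := by rintro rfl; exact hm h.2.2.2.2.2.2.1
  have h2 : m ≠ q := by rintro rfl; exact hm h.2.2.2.2.2.2.2.2.1
  simp [chartVec, h1, h2]

/-- The component is parametrized by pairs of vectors with prescribed supports and otherwise free
entries; pairs with a non-zero (i, j)-minor do span lines. -/
lemma isIrreducible_component [Infinite k] (t : Fin 3 ⊕ Fin 4) :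
    IsIrreducible (component k t) := by
  let u : Fin 4 → MvPolynomial (Fin 4 ⊕ Fin 4) k := fun i =>
    if supportFst t i then X (Sum.inl i) else 0
  let v : Fin 4 → MvPolynomial (Fin 4 ⊕ Fin 4) k := fun i =>
    if supportSnd t i then X (Sum.inr i) else 0
  obtain ⟨i, j, p, q, hc⟩ := exists_isChart' t
  have hq : ∀ w : Fin 4 ⊕ Fin 4 → k,
      (fun m : Fin 4 × Fin 4 => eval w (u m.1 * v m.2 - u m.2 * v m.1))
      = plucker (fun i => eval w (u i)) (fun i => eval w (v i)) := by
    intro w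
    ext m
    simp [plucker]
  refine homZariski_line.isIrreducible_of_param (u i * v j - u j * v i) ?_
    (fun m => u m.1 * v m.2 - u m.2 * v m.1) ?_ ?_
  · intro h0
    have := congrArg (eval (Sum.elim (chartVec i p 0) (chartVec j q 0))) h0
    have hij : i ≠ j := fun h => hc.1 (by subst h; cases t <;> exact Or.inl rfl)
    by_cases h1 : supportFst t j <;> by_cases h2 : supportSnd t i <;>
      simp [u, v, hc.2.2.2.2.2.1, hc.2.2.2.2.2.2.1, chartVec, hij, hij.symm, h1, h2] at this
  · intro w hw
    have h0 : plucker (fun i => eval w (u i)) (fun i => eval w (v i)) ≠ 0 := by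
      intro h0
      have := congrFun h0 (i, j)
      rw [← hq] at this
      exact hw this
    refine ⟨Line.ofPair _ _ h0, mem_component_of_support rfl ?_ ?_, ?_⟩
    · intro m hm
      simp [u, hm]
    · intro m hm
      simp [v, hm]
    · rw [hq]
      exact Line.plucker_eq_smul_coord rfl
  · intro l hl
    obtain ⟨i, j, p, q, hc, h0⟩ := exists_chart hl
    refine ⟨Sum.elim (l.vecFst i j) (l.vecSnd i j), ?_⟩
    rw [hq]
    convert Line.plucker_eq_smul_coord (Line.space_eq_span_vec h0) using 6
    · rename_i m
      by_cases hm : supportFst t m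
      · simp [u, hm]
      · simp [u, hm, vecFst_eq_chartVec hc hl h0, chartVec_supportFst hc _ m hm]
    · rename_i m
      by_cases hm : supportSnd t m
      · simp [v, hm]
      · simp [v, hm, vecSnd_eq_chartVec hc hl h0, chartVec_supportSnd hc _ m hm]

end Components

section Components

variable {k : Type*} [Field k]

lemma IsChart.ne {t : Fin 3 ⊕ Fin 4} {i j p q : Fin 4} (h : IsChart t i j p q) : i ≠ j := by
  rintro rfl
  exact h.1 (by cases t <;> exact Or.inl rfl)

section PluckerChart

variable {t : Fin 3 ⊕ Fin 4} {i j p q : Fin 4}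

lemma plucker_chart_base (h : IsChart t i j p q) (α δ : k) : plucker (chartVec i p α) (chartVec j q δ) (i, j) = 1 := by
  simp [plucker, chartVec, h.ne, h.ne.symm, h.2.1.symm, h.2.2.1.symm, h.2.2.2.1.symm,
    h.2.2.2.2.1.symm]

lemma plucker_chart_fst (h : IsChart t i j p q) (α δ : k) : plucker (chartVec i p α) (chartVec j q δ) (p, j) = α := by
  simp [plucker, chartVec, h.ne.symm, h.2.1, h.2.2.1, h.2.2.1.symm, h.2.2.2.2.1.symm]

lemma plucker_chart_snd (h : IsChart t i j p q) (α δ : k) : plucker (chartVec i p α) (chartVec j q δ) (i, q) = δ := by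
  simp [plucker, chartVec, h.ne, h.2.1.symm, h.2.2.2.1, h.2.2.2.1.symm, h.2.2.2.2.1]

lemma plucker_chart_ne_zero (h : IsChart t i j p q) (α δ : k) : plucker (chartVec i p α) (chartVec j q δ) ≠ 0 := fun h0 => by
  have := congrFun h0 (i, j)
  rw [plucker_chart_base h] at this
  exact one_ne_zero this

lemma plucker_chart_ne_zero_of_not_vanishes (h : IsChart t i j p q) {α δ : k} (hα : α ≠ 0) (hδ : δ ≠ 0) {m n : Fin 4}
    (hmn : ¬ Vanishes t m n) : plucker (chartVec i p α) (chartVec j q δ) (m, n) ≠ 0 := by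
  have hne : m ≠ n := by
    rintro rfl
    exact hmn (by cases t <;> exact Or.inl rfl)
  have hpq : ∀ m n : Fin 4, (m = i ∨ m = p) → (n = j ∨ n = q) → m ≠ n →
      plucker (chartVec i p α) (chartVec j q δ) (m, n) ≠ 0 := by
    rintro m n (rfl | rfl) (rfl | rfl) hne
    · simp [plucker_chart_base h]
    · simpa [plucker_chart_snd h] using hδ
    · simpa [plucker_chart_fst h] using hα
    · simp [plucker, chartVec, hne, h.2.1, h.2.2.1, h.2.2.2.1, h.2.2.2.2.1, hα, hδ, hne.symm]
  rcases IsChart.not_vanishes t i j p q h m n hmn with ⟨h1, h2⟩ | ⟨h1, h2⟩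
  · exact hpq m n h1 h2 hne
  · have := hpq n m h1 h2 hne.symm
    simp only [plucker] at this ⊢
    intro h0
    apply this
    linear_combination -h0

/-- The line of a chart with given affine coordinates. -/
noncomputable def chartLine (h : IsChart t i j p q) (α δ : k) : Line k := Line.ofPair _ _ (plucker_chart_ne_zero h α δ)

lemma chartLine_mem (h : IsChart t i j p q) (α δ : k) : chartLine h α δ ∈ component k t :=
  mem_component_of_support rfl (chartVec_supportFst h α) (chartVec_supportSnd h δ)

lemma chartLine_coord_eq_zero_iff (h : IsChart t i j p q) (α δ : k) (x : Fin 4 × Fin 4) :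
    (chartLine h α δ).coord x = 0 ↔ plucker (chartVec i p α) (chartVec j q δ) x = 0 :=
  Line.coord_eq_zero_iff rfl x

lemma eq_chartLine (h : IsChart t i j p q) (α δ : k) {l : Line k} (hl : l ∈ component k t) (h0 : l.coord (i, j) ≠ 0)
    (h1 : l.coord (p, j) / l.coord (i, j) = α) (h2 : l.coord (i, q) / l.coord (i, j) = δ) :
    l = chartLine h α δ := by
  ext1
  rw [Line.space_eq_span_vec h0, vecFst_eq_chartVec h hl h0, vecSnd_eq_chartVec h hl h0, h1, h2]
  rfl

end PluckerChart

/-- The charts bound the dimension above. For the lower bound, the origin of a chart, its axis δ = 0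
and the whole component form a chain; the coordinates (p, j) and (i, q), equal to α and δ in the
chart, show that it is strict. -/
lemma topologicalKrullDim_component [Infinite k] (t : Fin 3 ⊕ Fin 4) :
    topologicalKrullDim (component k t) = 2 := by
  have hZ := homZariski_line.subtype (component k t)
  refine le_antisymm (hZ.topologicalKrullDim_le ?_) ?_
  · rintro ⟨l, hl⟩
    obtain ⟨i, j, p, q, hc, h0⟩ := exists_chart hl
    let u : Fin 4 → MvPolynomial (Fin 2) k := fun m =>
      C ((Pi.single i 1 : Fin 4 → k) m) + X 0 * C ((Pi.single p 1 : Fin 4 → k) m)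
    let v : Fin 4 → MvPolynomial (Fin 2) k := fun m =>
      C ((Pi.single j 1 : Fin 4 → k) m) + X 1 * C ((Pi.single q 1 : Fin 4 → k) m)
    refine ⟨(i, j), ![(p, j), (i, q)], fun m => u m.1 * v m.2 - u m.2 * v m.1, h0, ?_⟩
    rintro ⟨s, hs⟩ hs0
    refine (Line.coord_eq_smul_plucker_vec hs0).trans ?_
    congr 1
    rw [vecFst_eq_chartVec hc hs hs0, vecSnd_eq_chartVec hc hs hs0]
    ext m
    simp [plucker, chartVec, u, v]
  · obtain ⟨i, j, p, q, hc⟩ := exists_isChart' t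
    let ψ : k → k → component k t := fun α δ => ⟨chartLine hc α δ, chartLine_mem hc α δ⟩
    have hcl : ∀ x : Fin 4 × Fin 4, IsClosed {l : component k t | l.1.coord x = 0} := by
      intro x
      simpa using hZ.isClosed_eq (isHomogeneous_X k x)
    have := isIrreducible_iff_irreducibleSpace.1 (isIrreducible_component (k := k) t)
    refine two_le_topologicalKrullDim (A := {ψ 0 0}) (B := Set.range fun α => ψ α 0)
      (C := Set.univ) isIrreducible_singleton ?_ (IrreducibleSpace.isIrreducible_univ _)
      (by rintro _ rfl; exact ⟨0, rfl⟩) (Set.subset_univ _) ?_ ?_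
    · let u : Fin 4 → MvPolynomial Unit k := fun m =>
        C ((Pi.single i 1 : Fin 4 → k) m) + X () * C ((Pi.single p 1 : Fin 4 → k) m)
      let v : Fin 4 → MvPolynomial Unit k := fun m => C ((Pi.single j 1 : Fin 4 → k) m)
      have hq : ∀ w : Unit → k,
          (fun m : Fin 4 × Fin 4 => eval w (u m.1 * v m.2 - u m.2 * v m.1))
          = plucker (chartVec i p (w ())) (chartVec j q 0) := by
        intro w
        ext m
        simp [plucker, chartVec, u, v]
      refine hZ.isIrreducible_of_param (1 : MvPolynomial Unit k) one_ne_zero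
        (fun m => u m.1 * v m.2 - u m.2 * v m.1) ?_ ?_
      · intro w _
        refine ⟨_, ⟨w (), rfl⟩, ?_⟩
        rw [hq]
        exact Line.plucker_eq_smul_coord rfl
      · rintro _ ⟨α, rfl⟩
        refine ⟨fun _ => α, ?_⟩
        rw [hq]
        exact Line.plucker_eq_smul_coord rfl
    · intro hsub
      have h1 : closure {ψ 0 0} ⊆ {l : component k t | l.1.coord (p, j) = 0} := by
        rw [(hcl _).closure_subset_iff]
        rintro _ rfl
        exact (chartLine_coord_eq_zero_iff hc 0 0 _).2 (plucker_chart_fst hc 0 0)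
      have h2 := (chartLine_coord_eq_zero_iff hc 1 0 _).1 (h1 (hsub ⟨1, rfl⟩))
      rw [plucker_chart_fst hc] at h2
      exact one_ne_zero h2
    · intro hsub
      have h1 : closure (Set.range fun α => ψ α 0) ⊆ {l : component k t | l.1.coord (i, q) = 0} := by
        rw [(hcl _).closure_subset_iff]
        rintro _ ⟨α, rfl⟩
        exact (chartLine_coord_eq_zero_iff hc α 0 _).2 (plucker_chart_snd hc α 0)
      have h2 := (chartLine_coord_eq_zero_iff hc 0 1 _).1 (h1 (hsub (Set.mem_univ (ψ 0 1))))
      rw [plucker_chart_snd hc] at h2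
      exact one_ne_zero h2

/-- The line with α = δ = 1 in a chart has no vanishing Plücker coordinate other than those forced
by its component. -/
lemma component_not_subset {s t : Fin 3 ⊕ Fin 4} (hst : s ≠ t) :
    ¬ component k t ⊆ component k s := by
  intro hsub
  obtain ⟨m, n, h1, h2⟩ := exists_vanishes_of_ne s t hst
  obtain ⟨i, j, p, q, hc⟩ := exists_isChart' t
  have h3 := (mem_component_iff s _).1 (hsub (chartLine_mem hc 1 1)) m n h1
  exact plucker_chart_ne_zero_of_not_vanishes hc one_ne_zero one_ne_zero h2
    ((chartLine_coord_eq_zero_iff hc 1 1 _).1 h3)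

lemma component_injective : Function.Injective (component k) := fun s t h => by
  by_contra hst
  exact component_not_subset hst h.ge

/-- The irreducible components of a finite union of irreducible closed sets without inclusions. -/
lemma componentsOf_iUnion {T ι : Type*} [TopologicalSpace T] [Finite ι] {Z : ι → Set T}
    (hirr : ∀ t, IsIrreducible (Z t)) (hcl : ∀ t, IsClosed (Z t))
    (hne : ∀ s t, s ≠ t → ¬ Z t ⊆ Z s) : componentsOf (⋃ t, Z t) = Set.range Z := by
  have key : ∀ W : Set T, IsIrreducible W → W ⊆ ⋃ t, Z t → ∃ t, W ⊆ Z t := by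
    intro W hW hsub
    have := (isIrreducible_iff_sUnion_isClosed.1 hW) (Set.finite_range Z).toFinset (by simpa using hcl)
      (by simpa using hsub)
    simpa using this
  ext W
  constructor
  · rintro ⟨⟨hW, hsub⟩, hmax⟩
    obtain ⟨t, ht⟩ := key W hW hsub
    exact ⟨t, (hmax ⟨hirr t, Set.subset_iUnion Z t⟩ ht).antisymm ht⟩
  · rintro ⟨t, rfl⟩
    refine ⟨⟨hirr t, Set.subset_iUnion Z t⟩, fun W hW hsub => ?_⟩
    obtain ⟨s, hs⟩ := key W hW.1 hW.2
    have : s = t := by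
      by_contra hst
      exact hne s t hst (hsub.trans hs)
    exact this ▸ hs

lemma componentsOf_iUnion_component [Infinite k] :
    componentsOf (⋃ t, component k t) = Set.range (component k) :=
  componentsOf_iUnion isIrreducible_component isClosed_component fun _ _ => component_not_subset

lemma isCongruence_iUnion_component [Infinite k] : IsCongruence (⋃ t, component k t) := by
  refine ⟨isClosed_iUnion_of_finite isClosed_component, ?_⟩
  rw [componentsOf_iUnion_component]
  rintro _ ⟨t, rfl⟩
  exact topologicalKrullDim_component t

lemma isCongruence_component [Infinite k] (t : Fin 3 ⊕ Fin 4) : IsCongruence (component k t) := by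
  refine ⟨isClosed_component t, ?_⟩
  have := componentsOf_iUnion (Z := fun _ : Unit => component k t) (fun _ => isIrreducible_component t)
    (fun _ => isClosed_component t) fun s t h => (h rfl).elim
  rw [Set.iUnion_const] at this
  rw [this]
  rintro _ ⟨_, rfl⟩
  exact topologicalKrullDim_component t

end Components

/-! ### Projective space -/

section ProjectiveSpace

variable {k : Type*} [Field k]

lemma homZariski_P3 : HomZariski (Projectivization.rep : P3 k → Fin 4 → k) := rfl

lemma isClosed_zeros {d : ℕ} {G : MvPolynomial (Fin 4) k} (hG : G.IsHomogeneous d) :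
    IsClosed (zeros G) := homZariski_P3.isClosed_eq hG

lemma isOpen_compl_zeros {d : ℕ} {G : MvPolynomial (Fin 4) k} (hG : G.IsHomogeneous d) :
    IsOpen (zeros G)ᶜ := (isClosed_zeros hG).isOpen_compl

lemma exists_mk_rep (v : Fin 4 → k) (hv : v ≠ 0) :
    ∃ c : k, c ≠ 0 ∧ v = c • (Projectivization.mk k v hv).rep := by
  obtain ⟨a, ha⟩ := Projectivization.exists_smul_eq_mk_rep k v hv
  refine ⟨(a⁻¹ : kˣ), (a⁻¹).ne_zero, ?_⟩
  rw [← ha, ← Units.smul_def, inv_smul_smul]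

lemma mk_mem_zeros_iff {d : ℕ} {G : MvPolynomial (Fin 4) k} (hG : G.IsHomogeneous d)
    (v : Fin 4 → k) (hv : v ≠ 0) : Projectivization.mk k v hv ∈ zeros G ↔ eval v G = 0 := by
  obtain ⟨c, hc, h⟩ := exists_mk_rep v hv
  conv_rhs => rw [h, eval_smul_of_isHomogeneous hG]
  simp [hc, zeros]

lemma isIrreducible_univ_P3 [Infinite k] : IsIrreducible (Set.univ : Set (P3 k)) := by
  refine homZariski_P3.isIrreducible_of_param (X 0 : MvPolynomial (Fin 4) k) (X_ne_zero _) X ?_ ?_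
  · intro w hw
    have hw0 : w ≠ 0 := by rintro rfl; simp at hw
    refine ⟨Projectivization.mk k w hw0, Set.mem_univ _, ?_⟩
    simpa using exists_mk_rep w hw0
  · intro P _
    exact ⟨P.rep, 1, one_ne_zero, by simp⟩

/-- The points all of whose coordinates are different from `0`. -/
def torus (k : Type*) [Field k] : Set (P3 k) := {P | ∀ i, P.rep i ≠ 0}

lemma isHomogeneous_prod_X : (X 0 * X 1 * X 2 * X 3 : MvPolynomial (Fin 4) k).IsHomogeneous 4 :=
  (((isHomogeneous_X k 0).mul (isHomogeneous_X k 1)).mul (isHomogeneous_X k 2)).mul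
    (isHomogeneous_X k 3)

lemma torus_eq : torus k = (zeros (X 0 * X 1 * X 2 * X 3 : MvPolynomial (Fin 4) k))ᶜ := by
  ext P
  simp [torus, zeros, Fin.forall_fin_succ, and_assoc]

lemma isOpen_torus : IsOpen (torus k) := by
  rw [torus_eq]
  exact isOpen_compl_zeros isHomogeneous_prod_X

lemma mk_mem_torus {v : Fin 4 → k} (hv : v ≠ 0) (h : ∀ i, v i ≠ 0) :
    Projectivization.mk k v hv ∈ torus k := by
  obtain ⟨c, hc, hcv⟩ := exists_mk_rep v hv
  intro i h0
  apply h i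
  rw [hcv, Pi.smul_apply, h0, smul_zero]

/-- A condition that holds on the torus holds generically. -/
lemma generically_univ_of_torus [Infinite k] {p : P3 k → Prop} (h : ∀ P ∈ torus k, p P) :
    Generically Set.univ p := by
  refine ⟨torus k, isOpen_torus, ?_, fun P hP => h P hP.2⟩
  refine subset_closure_inter_of_isPreirreducible_of_isOpen
    isIrreducible_univ_P3.isPreirreducible isOpen_torus ?_
  have hv : (fun _ => 1 : Fin 4 → k) ≠ 0 := fun h => one_ne_zero (congrFun h 0)
  exact ⟨Projectivization.mk k _ hv, Set.mem_univ _, mk_mem_torus hv fun _ => one_ne_zero⟩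

end ProjectiveSpace

/-! ### Bidegrees -/

section Bidegree

variable {k : Type*} [Field k]

lemma sum_mul_chartVec (h : Fin 4 → k) (i p : Fin 4) (α : k) :
    ∑ m, h m * chartVec i p α m = h i + α * h p := by
  simp [chartVec, mul_add, Finset.sum_add_distrib, Pi.single_apply, mul_comm]

lemma coord_ne_zero_of_chart {t : Fin 3 ⊕ Fin 4} {i j p q : Fin 4} (hc : IsChart t i j p q)
    {l : Line k} (hl : l ∈ component k t) (h0 : l.coord (i, j) ≠ 0)
    (hα : l.coord (p, j) / l.coord (i, j) ≠ 0) (hδ : l.coord (i, q) / l.coord (i, j) ≠ 0)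
    {m n : Fin 4} (hmn : ¬ Vanishes t m n) : l.coord (m, n) ≠ 0 := by
  rw [eq_chartLine hc _ _ hl h0 rfl rfl, Ne, chartLine_coord_eq_zero_iff]
  exact plucker_chart_ne_zero_of_not_vanishes hc hα hδ hmn

/-- The plane contains eᵢ + α eₚ and eⱼ + δ e_q only for α = -Hᵢ/Hₚ and δ = -Hⱼ/H_q. These values
are non-zero, so every ray lies in every chart, and one fixed chart gives existence and uniqueness.
The second clause serves to distinguish rays of different components. -/
lemma exists_raysIn_component_eq (t : Fin 3 ⊕ Fin 4) {H : P3 k} (hH : H ∈ torus k) :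
    ∃ l : Line k, raysIn (component k t) H = {l} ∧
      ∀ m n, ¬ Vanishes t m n → l.coord (m, n) ≠ 0 := by
  have hchart : ∀ {i j p q : Fin 4}, IsChart t i j p q → ∀ l ∈ raysIn (component k t) H,
      l.coord (i, j) ≠ 0 →
      l.coord (p, j) / l.coord (i, j) = -(H.rep i) / H.rep p ∧
      l.coord (i, q) / l.coord (i, j) = -(H.rep j) / H.rep q := by
    intro i j p q hc l hl h0
    have hspan := Line.space_eq_span_vec h0
    constructor
    · have h1 := hl.2 (l.vecFst i j) (hspan ▸ Submodule.subset_span (by simp))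
      rw [vecFst_eq_chartVec hc hl.1 h0, sum_mul_chartVec] at h1
      rw [eq_div_iff (hH p)]
      linear_combination h1
    · have h1 := hl.2 (l.vecSnd i j) (hspan ▸ Submodule.subset_span (by simp))
      rw [vecSnd_eq_chartVec hc hl.1 h0, sum_mul_chartVec] at h1
      rw [eq_div_iff (hH q)]
      linear_combination h1
  have hne : ∀ l ∈ raysIn (component k t) H, ∀ m n, ¬ Vanishes t m n → l.coord (m, n) ≠ 0 := by
    intro l hl m n hmn
    obtain ⟨i, j, p, q, hc, h0⟩ := exists_chart hl.1
    obtain ⟨h1, h2⟩ := hchart hc l hl h0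
    refine coord_ne_zero_of_chart hc hl.1 h0 ?_ ?_ hmn
    · rw [h1]
      exact div_ne_zero (neg_ne_zero.2 (hH _)) (hH _)
    · rw [h2]
      exact div_ne_zero (neg_ne_zero.2 (hH _)) (hH _)
  obtain ⟨i, j, p, q, hc⟩ := exists_isChart' t
  have hmem : chartLine hc (-(H.rep i) / H.rep p) (-(H.rep j) / H.rep q) ∈
      raysIn (component k t) H := by
    refine ⟨chartLine_mem hc _ _, fun v hv => ?_⟩
    obtain ⟨a, b, rfl⟩ := Submodule.mem_span_pair.1 hv
    have e1 := sum_mul_chartVec H.rep i p (-(H.rep i) / H.rep p)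
    have e2 := sum_mul_chartVec H.rep j q (-(H.rep j) / H.rep q)
    rw [div_mul_cancel₀ _ (hH _), add_neg_cancel] at e1 e2
    have : ∀ m, H.rep m * (a • chartVec i p (-(H.rep i) / H.rep p) +
        b • chartVec j q (-(H.rep j) / H.rep q)) m =
        a * (H.rep m * chartVec i p (-(H.rep i) / H.rep p) m) +
        b * (H.rep m * chartVec j q (-(H.rep j) / H.rep q) m) := fun m => by
      simp only [Pi.add_apply, Pi.smul_apply, smul_eq_mul]
      ring
    simp only [this]
    rw [Finset.sum_add_distrib, ← Finset.mul_sum, ← Finset.mul_sum, e1, e2]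
    simp
  refine ⟨_, Set.eq_singleton_iff_unique_mem.2 ⟨hmem, fun l hl => ?_⟩, hne _ hmem⟩
  have h0 := hne l hl i j hc.1
  obtain ⟨h1, h2⟩ := hchart hc l hl h0
  exact eq_chartLine hc _ _ hl.1 h0 h1 h2

lemma IsChart.fst_ne_snd : ∀ (r : Fin 3) (i j p q : Fin 4), IsChart (Sum.inl r) i j p q →
    p ≠ q := by decide

lemma IsChart.exhaust : ∀ (r : Fin 3) (i j p q : Fin 4), IsChart (Sum.inl r) i j p q →
    ∀ m, m = i ∨ m = j ∨ m = p ∨ m = q := by decide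

/-- For a skew congruence i, j, p, q exhaust the coordinates. Writing P as Pᵢ(eᵢ + α eₚ) + Pⱼ(eⱼ + δ
e_q) forces α = Pₚ/Pᵢ and δ = P_q/Pⱼ. -/
lemma exists_raysThrough_component_eq (r : Fin 3) {P : P3 k} (hP : P ∈ torus k) :
    ∃ l : Line k, raysThrough (component k (Sum.inl r)) P = {l} ∧
      ∀ m n, ¬ Vanishes (Sum.inl r) m n → l.coord (m, n) ≠ 0 := by
  have hchart : ∀ {i j p q : Fin 4}, IsChart (Sum.inl r) i j p q →
      ∀ l ∈ raysThrough (component k (Sum.inl r)) P, l.coord (i, j) ≠ 0 →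
      l.coord (p, j) / l.coord (i, j) = P.rep p / P.rep i ∧
      l.coord (i, q) / l.coord (i, j) = P.rep q / P.rep j := by
    intro i j p q hc l hl h0
    have hpq := IsChart.fst_ne_snd _ _ _ _ _ hc
    have hmem : P.rep ∈ l.space := hl.2 (by
      rw [Projectivization.submodule_eq]
      exact Submodule.mem_span_singleton_self _)
    rw [Line.space_eq_span_vec h0, vecFst_eq_chartVec hc hl.1 h0, vecSnd_eq_chartVec hc hl.1 h0,
      Submodule.mem_span_pair] at hmem
    obtain ⟨s, t, hst⟩ := hmem
    have hi := congrFun hst i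
    have hj := congrFun hst j
    have hp := congrFun hst p
    have hq := congrFun hst q
    simp [chartVec, hc.ne, hc.2.1.symm, hc.2.2.2.1.symm] at hi
    simp [chartVec, hc.ne.symm, hc.2.2.1.symm, hc.2.2.2.2.1.symm] at hj
    simp [chartVec, hc.2.1, hc.2.2.1, hpq] at hp
    simp [chartVec, hc.2.2.2.1, hc.2.2.2.2.1, hpq.symm] at hq
    constructor
    · rw [eq_div_iff (hP i), ← hp, hi]
      ring
    · rw [eq_div_iff (hP j), ← hq, hj]
      ring
  have hne : ∀ l ∈ raysThrough (component k (Sum.inl r)) P,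
      ∀ m n, ¬ Vanishes (Sum.inl r) m n → l.coord (m, n) ≠ 0 := by
    intro l hl m n hmn
    obtain ⟨i, j, p, q, hc, h0⟩ := exists_chart hl.1
    obtain ⟨h1, h2⟩ := hchart hc l hl h0
    refine coord_ne_zero_of_chart hc hl.1 h0 ?_ ?_ hmn
    · rw [h1]
      exact div_ne_zero (hP _) (hP _)
    · rw [h2]
      exact div_ne_zero (hP _) (hP _)
  obtain ⟨i, j, p, q, hc⟩ := exists_isChart' (Sum.inl r)
  have hmem : chartLine hc (P.rep p / P.rep i) (P.rep q / P.rep j) ∈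
      raysThrough (component k (Sum.inl r)) P := by
    refine ⟨chartLine_mem hc _ _, ?_⟩
    have hpq := IsChart.fst_ne_snd _ _ _ _ _ hc
    rw [Projectivization.submodule_eq, Submodule.span_singleton_le_iff_mem]
    refine Submodule.mem_span_pair.2 ⟨P.rep i, P.rep j, ?_⟩
    ext m
    rcases IsChart.exhaust _ _ _ _ _ hc m with rfl | rfl | rfl | rfl
    · simp [chartVec, hc.ne, hc.2.1.symm, hc.2.2.2.1.symm]
    · simp [chartVec, hc.ne.symm, hc.2.2.1.symm, hc.2.2.2.2.1.symm]
    · simp [chartVec, hc.2.1, hc.2.2.1, hpq, mul_div_cancel₀, hP i]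
    · simp [chartVec, hc.2.2.2.1, hc.2.2.2.2.1, hpq.symm, mul_div_cancel₀, hP j]
  refine ⟨_, Set.eq_singleton_iff_unique_mem.2 ⟨hmem, fun l hl => ?_⟩, hne _ hmem⟩
  have h0 := hne l hl i j hc.1
  obtain ⟨h1, h2⟩ := hchart hc l hl h0
  exact eq_chartLine hc _ _ hl.1 h0 h1 h2

lemma raysThrough_betaPlane_eq_empty (m : Fin 4) {P : P3 k} (hP : P ∈ torus k) :
    raysThrough (component k (Sum.inr m)) P = ∅ := by
  refine Set.eq_empty_iff_forall_notMem.2 fun l hl => hP m ?_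
  have h1 : P.rep ∈ l.space := hl.2 (by
    rw [Projectivization.submodule_eq]
    exact Submodule.mem_span_singleton_self _)
  exact mem_coordPlane.1 (hl.1 h1)

lemma hasBidegree_skewCongruence [Infinite k] (r : Fin 3) :
    HasBidegree (component k (Sum.inl r)) 1 1 := by
  refine ⟨isCongruence_component _, generically_univ_of_torus fun P hP => ?_,
    generically_univ_of_torus fun H hH => ?_⟩
  · obtain ⟨l, hl, -⟩ := exists_raysThrough_component_eq r hP
    simp [hl]
  · obtain ⟨l, hl, -⟩ := exists_raysIn_component_eq (Sum.inl r) hH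
    simp [hl]

lemma hasBidegree_betaPlane [Infinite k] (m : Fin 4) :
    HasBidegree (component k (Sum.inr m)) 0 1 := by
  refine ⟨isCongruence_component _, generically_univ_of_torus fun P hP => ?_,
    generically_univ_of_torus fun H hH => ?_⟩
  · simp [raysThrough_betaPlane_eq_empty m hP]
  · obtain ⟨l, hl, -⟩ := exists_raysIn_component_eq (Sum.inr m) hH
    simp [hl]

/-- Lines of different components with no unexpected vanishing Plücker coordinate differ. -/
lemma injective_of_coord_ne_zero {ι : Type*} {f : ι → Fin 3 ⊕ Fin 4} (hf : Function.Injective f)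
    {l : ι → Line k} (hl : ∀ t, l t ∈ component k (f t))
    (hne : ∀ t m n, ¬ Vanishes (f t) m n → (l t).coord (m, n) ≠ 0) : Function.Injective l := by
  intro s t hst
  by_contra h
  obtain ⟨m, n, h1, h2⟩ := exists_vanishes_of_ne (f s) (f t) (hf.ne h)
  exact hne t m n h2 (hst ▸ (mem_component_iff _ _).1 (hl s) m n h1)

lemma encard_raysIn_iUnion {H : P3 k} (hH : H ∈ torus k) :
    (raysIn (⋃ t, component k t) H).encard = 7 := by
  choose l hl hne using fun t => exists_raysIn_component_eq t hH
  have hmem : ∀ t, l t ∈ raysIn (component k t) H := fun t => by rw [hl t]; rfl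
  have hinj := injective_of_coord_ne_zero Function.injective_id (fun t => (hmem t).1) hne
  have : raysIn (⋃ t, component k t) H = Set.range l := by
    ext x
    constructor
    · rintro ⟨hx, hx'⟩
      obtain ⟨t, ht⟩ := Set.mem_iUnion.1 hx
      have : x ∈ raysIn (component k t) H := ⟨ht, hx'⟩
      rw [hl t] at this
      exact ⟨t, this.symm⟩
    · rintro ⟨t, rfl⟩
      exact ⟨Set.mem_iUnion.2 ⟨t, (hmem t).1⟩, (hmem t).2⟩
  rw [this, ← Set.image_univ, hinj.encard_image, Set.encard_univ]
  simp

lemma encard_raysThrough_iUnion {P : P3 k} (hP : P ∈ torus k) :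
    (raysThrough (⋃ t, component k t) P).encard = 3 := by
  choose l hl hne using fun r => exists_raysThrough_component_eq (k := k) r hP
  have hmem : ∀ r, l r ∈ raysThrough (component k (Sum.inl r)) P := fun r => by rw [hl r]; rfl
  have hinj := injective_of_coord_ne_zero Sum.inl_injective (fun r => (hmem r).1) hne
  have : raysThrough (⋃ t, component k t) P = Set.range l := by
    ext x
    constructor
    · rintro ⟨hx, hx'⟩
      obtain ⟨t | m, ht⟩ := Set.mem_iUnion.1 hx
      · have : x ∈ raysThrough (component k (Sum.inl t)) P := ⟨ht, hx'⟩
        rw [hl t] at this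
        exact ⟨t, this.symm⟩
      · have : x ∈ raysThrough (component k (Sum.inr m)) P := ⟨ht, hx'⟩
        rw [raysThrough_betaPlane_eq_empty m hP] at this
        exact this.elim
    · rintro ⟨t, rfl⟩
      exact ⟨Set.mem_iUnion.2 ⟨_, (hmem t).1⟩, (hmem t).2⟩
  rw [this, ← Set.image_univ, hinj.encard_image, Set.encard_univ]
  simp

lemma hasBidegree_iUnion_component [Infinite k] : HasBidegree (⋃ t, component k t) 3 7 :=
  ⟨isCongruence_iUnion_component, generically_univ_of_torus fun _ => encard_raysThrough_iUnion,
    generically_univ_of_torus fun _ => encard_raysIn_iUnion⟩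

end Bidegree

/-! ### The bitangent lines -/

section Bitangents

variable {k : Type*} [Field k]

/-- The derivative of `xyzw` at `p` in the direction of `q`. -/
def polar (p q : Fin 4 → k) : k :=
  q 0 * p 1 * p 2 * p 3 + p 0 * q 1 * p 2 * p 3 + p 0 * p 1 * q 2 * p 3 + p 0 * p 1 * p 2 * q 3

lemma isHomogeneous_kummerQuartic (a b c : k) : (kummerQuartic a b c).IsHomogeneous 4 := by
  have hX : ∀ i j : Fin 4, (X i ^ 2 * X j ^ 2 : MvPolynomial (Fin 4) k).IsHomogeneous 4 :=
    fun i j => ((isHomogeneous_X k i).pow 2).mul ((isHomogeneous_X k j).pow 2)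
  have hC : ∀ (e : k) {G : MvPolynomial (Fin 4) k}, G.IsHomogeneous 4 →
      (C e * G).IsHomogeneous 4 := fun e G hG => by
    simpa using (isHomogeneous_C (Fin 4) e).mul hG
  exact (((hC a ((hX 0 1).add (hX 2 3))).add (hC b ((hX 0 2).add (hX 1 3)))).add
    (hC c ((hX 0 3).add (hX 1 2)))).add isHomogeneous_prod_X

lemma eval_kummerQuartic (a b c : k) (v : Fin 4 → k) :
    eval v (kummerQuartic a b c) = a * (v 0 ^ 2 * v 1 ^ 2 + v 2 ^ 2 * v 3 ^ 2)
      + b * (v 0 ^ 2 * v 2 ^ 2 + v 1 ^ 2 * v 3 ^ 2) + c * (v 0 ^ 2 * v 3 ^ 2 + v 1 ^ 2 * v 2 ^ 2)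
      + v 0 * v 1 * v 2 * v 3 := by
  simp [kummerQuartic]

lemma isHomogeneous_restrictToLine {d : ℕ} {F : MvPolynomial (Fin 4) k} (hF : F.IsHomogeneous d)
    (u v : Fin 4 → k) : (restrictToLine F u v).IsHomogeneous d := by
  have h : ∀ i : Fin 4, (C (u i) * X 0 + C (v i) * X 1 : MvPolynomial (Fin 2) k).IsHomogeneous 1 :=
    fun i => by
      simpa using ((isHomogeneous_C (Fin 2) (u i)).mul (isHomogeneous_X k 0)).add
        ((isHomogeneous_C (Fin 2) (v i)).mul (isHomogeneous_X k 1))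
  have := hF.aeval _ h
  rwa [one_mul] at this

lemma pderiv_sq [CharP k 2] {τ : Type*} (i : τ) (G : MvPolynomial τ k) : pderiv i (G ^ 2) = 0 := by
  rw [pderiv_pow]
  simp [CharTwo.two_eq_zero]

/-- All terms with coefficients a, b, c are constants times squares, so only xyzw survives
differentiation in characteristic two. -/
lemma eval_pderiv_restrictToLine [CharP k 2] (a b c : k) (u v : Fin 4 → k) (w : Fin 2 → k)
    (i : Fin 2) : eval w (pderiv i (restrictToLine (kummerQuartic a b c) u v)) =
      polar (w 0 • u + w 1 • v) (![u, v] i) := by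
  have h : restrictToLine (kummerQuartic a b c) u v =
      (C a * ((C (u 0) * X 0 + C (v 0) * X 1) * (C (u 1) * X 0 + C (v 1) * X 1)) ^ 2
      + C a * ((C (u 2) * X 0 + C (v 2) * X 1) * (C (u 3) * X 0 + C (v 3) * X 1)) ^ 2
      + C b * ((C (u 0) * X 0 + C (v 0) * X 1) * (C (u 2) * X 0 + C (v 2) * X 1)) ^ 2
      + C b * ((C (u 1) * X 0 + C (v 1) * X 1) * (C (u 3) * X 0 + C (v 3) * X 1)) ^ 2
      + C c * ((C (u 0) * X 0 + C (v 0) * X 1) * (C (u 3) * X 0 + C (v 3) * X 1)) ^ 2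
      + C c * ((C (u 1) * X 0 + C (v 1) * X 1) * (C (u 2) * X 0 + C (v 2) * X 1)) ^ 2)
      + (C (u 0) * X 0 + C (v 0) * X 1) * (C (u 1) * X 0 + C (v 1) * X 1) *
        (C (u 2) * X 0 + C (v 2) * X 1) * (C (u 3) * X 0 + C (v 3) * X 1) := by
    simp only [restrictToLine, kummerQuartic, map_add, map_mul, map_pow, aeval_X, aeval_C,
      algebraMap_eq]
    ring
  have hX : ∀ m : Fin 4, pderiv i (C (u m) * X 0 + C (v m) * X 1 : MvPolynomial (Fin 2) k)
      = C (![u, v] i m) := by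
    intro m
    fin_cases i <;> simp [pderiv_X]
  rw [h]
  simp only [map_add, pderiv_sq, zero_add, Derivation.leibniz,
    smul_eq_mul, hX, pderiv_C, add_zero, mul_zero, map_mul, eval_X, eval_C, polar, Pi.add_apply,
    Pi.smul_apply]
  ring

lemma polar_add_smul (p q q' : Fin 4 → k) (s t : k) :
    polar p (s • q + t • q') = s * polar p q + t * polar p q' := by
  simp only [polar, Pi.add_apply, Pi.smul_apply, smul_eq_mul]
  ring

/-- If the restriction to a line is a square up to a constant, then the derivatives of `xyzw`
vanish along the line. -/
lemma polar_eq_zero_of_pderiv_eq_zero [CharP k 2] {a b c : k} {l : Line k} {u v : Fin 4 → k}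
    (hl : l.space = Submodule.span k {u, v})
    (h : ∀ i, pderiv i (restrictToLine (kummerQuartic a b c) u v) = 0) :
    ∀ p ∈ l.space, ∀ q ∈ l.space, polar p q = 0 := by
  intro p hp q hq
  rw [hl, Submodule.mem_span_pair] at hp hq
  obtain ⟨s, t, rfl⟩ := hp
  obtain ⟨s', t', rfl⟩ := hq
  have h0 := eval_pderiv_restrictToLine a b c u v ![s, t] 0
  have h1 := eval_pderiv_restrictToLine a b c u v ![s, t] 1
  rw [h, map_zero] at h0 h1
  simp only [Matrix.cons_val_zero, Matrix.cons_val_one] at h0 h1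
  rw [polar_add_smul, ← h0, ← h1]
  simp

lemma polar_eq_zero_of_mem_Bit [CharP k 2] {a b c : k} {l : Line k}
    (hl : l ∈ Bit (kummerQuartic a b c)) : ∀ p ∈ l.space, ∀ q ∈ l.space, polar p q = 0 := by
  obtain ⟨u, v, h1, h2⟩ := hl
  refine polar_eq_zero_of_pderiv_eq_zero (a := a) (b := b) (c := c) h1 fun i => ?_
  by_cases h0 : restrictToLine (kummerQuartic a b c) u v = 0
  · rw [h0, map_zero]
  · obtain ⟨A, B, hA, hB, hA0, hB0, D, hD⟩ := h2.resolve_left h0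
    have hD0 : D ≠ 0 := by
      rintro rfl
      exact h0 (by rw [hD, mul_zero])
    -- The restriction and A²B² both have degree four. The cofactor D is thus a constant, and a
    -- constant times a square has zero derivative.
    have hdeg := (isHomogeneous_restrictToLine (isHomogeneous_kummerQuartic a b c) u v).totalDegree h0
    have hAB : (A ^ 2 * B ^ 2).totalDegree = 4 :=
      ((hA.pow 2).mul (hB.pow 2)).totalDegree (mul_ne_zero (pow_ne_zero _ hA0) (pow_ne_zero _ hB0))
    rw [hD, totalDegree_mul_of_isDomain (mul_ne_zero (pow_ne_zero _ hA0) (pow_ne_zero _ hB0)) hD0,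
      hAB] at hdeg
    rw [hD, (totalDegree_eq_zero_iff_eq_C (p := D)).1 (by omega), mul_comm, pderiv_C_mul, ← mul_pow,
      pderiv_sq, mul_zero]

/-- A binary quadratic form over an algebraically closed field is a product of linear forms. -/
lemma exists_linear_factors [IsAlgClosed k] (d e f : k)
    (h : (C d * X 0 ^ 2 + C e * X 0 * X 1 + C f * X 1 ^ 2 : MvPolynomial (Fin 2) k) ≠ 0) :
    ∃ A B : MvPolynomial (Fin 2) k, A.IsHomogeneous 1 ∧ B.IsHomogeneous 1 ∧ A ≠ 0 ∧ B ≠ 0 ∧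
      C d * X 0 ^ 2 + C e * X 0 * X 1 + C f * X 1 ^ 2 = A * B := by
  have hlin : ∀ s t : k, (C s * X 0 + C t * X 1 : MvPolynomial (Fin 2) k).IsHomogeneous 1 :=
    fun s t => by
      simpa using ((isHomogeneous_C (Fin 2) s).mul (isHomogeneous_X k 0)).add
        ((isHomogeneous_C (Fin 2) t).mul (isHomogeneous_X k 1))
  suffices ∃ s t s' t' : k, C d * X 0 ^ 2 + C e * X 0 * X 1 + C f * X 1 ^ 2
      = (C s * X 0 + C t * X 1) * (C s' * X 0 + C t' * X 1 : MvPolynomial (Fin 2) k) by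
    obtain ⟨s, t, s', t', h'⟩ := this
    refine ⟨_, _, hlin s t, hlin s' t', ?_, ?_, h'⟩
    · rintro h0
      exact h (by rw [h', h0, zero_mul])
    · rintro h0
      exact h (by rw [h', h0, mul_zero])
  by_cases hd : d = 0
  · refine ⟨0, 1, e, f, ?_⟩
    simp only [hd, map_zero, map_one]
    ring
  · obtain ⟨r, hr⟩ := IsAlgClosed.exists_root
      (Polynomial.C d * Polynomial.X ^ 2 + Polynomial.C e * Polynomial.X + Polynomial.C f)
      (by rw [Polynomial.degree_quadratic hd]; decide)
    simp only [Polynomial.IsRoot, Polynomial.eval_add, Polynomial.eval_mul, Polynomial.eval_C,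
      Polynomial.eval_pow, Polynomial.eval_X] at hr
    refine ⟨d, d * r + e, 1, -r, ?_⟩
    have hf : f = -(d * r + e) * r := by linear_combination hr
    rw [hf]
    simp only [map_mul, map_add, map_neg, map_one]
    ring

/-- The two polars are the coefficients of s³t and st³ in the restricted quartic. Without these
terms it is d²s⁴ + e²s²t² + f²t⁴ = (ds² + est + ft²)², and the quadratic form splits into linear
factors unless it is zero. -/
lemma mem_Bit_of_polar_eq_zero [IsAlgClosed k] [CharP k 2] (a b c : k) {l : Line k}
    {u v : Fin 4 → k} (hl : l.space = Submodule.span k {u, v}) (h1 : polar u v = 0)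
    (h2 : polar v u = 0) : l ∈ Bit (kummerQuartic a b c) := by
  have hsq : ∀ x : k, ∃ y, x = y ^ 2 := fun x => by
    obtain ⟨y, hy⟩ := IsAlgClosed.exists_pow_nat_eq x (n := 2) (by norm_num)
    exact ⟨y, hy.symm⟩
  have htwo : (2 : MvPolynomial (Fin 2) k) = 0 := CharTwo.two_eq_zero
  refine ⟨u, v, hl, ?_⟩
  obtain ⟨d, hd⟩ := hsq (eval u (kummerQuartic a b c))
  obtain ⟨f, hf⟩ := hsq (eval v (kummerQuartic a b c))
  obtain ⟨e, he⟩ := hsq (a * (u 0 * v 1 + u 1 * v 0) ^ 2 + a * (u 2 * v 3 + u 3 * v 2) ^ 2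
    + b * (u 0 * v 2 + u 2 * v 0) ^ 2 + b * (u 1 * v 3 + u 3 * v 1) ^ 2
    + c * (u 0 * v 3 + u 3 * v 0) ^ 2 + c * (u 1 * v 2 + u 2 * v 1) ^ 2
    + (u 0 * u 1 * v 2 * v 3 + u 0 * u 2 * v 1 * v 3 + u 0 * u 3 * v 1 * v 2
      + u 1 * u 2 * v 0 * v 3 + u 1 * u 3 * v 0 * v 2 + u 2 * u 3 * v 0 * v 1))
  have key : restrictToLine (kummerQuartic a b c) u v =
      (C d * X 0 ^ 2 + C e * X 0 * X 1 + C f * X 1 ^ 2) ^ 2 := by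
    have : restrictToLine (kummerQuartic a b c) u v = C (d ^ 2) * X 0 ^ 4
        + C (polar u v) * X 0 ^ 3 * X 1 + C (e ^ 2) * X 0 ^ 2 * X 1 ^ 2
        + C (polar v u) * X 0 * X 1 ^ 3 + C (f ^ 2) * X 1 ^ 4 := by
      rw [← hd, ← he, ← hf, eval_kummerQuartic, eval_kummerQuartic]
      simp only [restrictToLine, kummerQuartic, polar, map_add, map_mul, map_pow, aeval_X, aeval_C,
        algebraMap_eq]
      have hsquare : ∀ p q p' q' s t : MvPolynomial (Fin 2) k,
          (p * s + q * t) ^ 2 * (p' * s + q' * t) ^ 2 = p ^ 2 * p' ^ 2 * s ^ 4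
            + (p * q' + p' * q) ^ 2 * s ^ 2 * t ^ 2 + q ^ 2 * q' ^ 2 * t ^ 4 := by
        intro p q p' q' s t
        linear_combination (p * p' * s ^ 2 * ((p * q' + p' * q) * s * t)
          + p * p' * s ^ 2 * (q * q' * t ^ 2) + (p * q' + p' * q) * s * t * (q * q' * t ^ 2)) * htwo
      simp only [hsquare]
      ring
    rw [this, h1, h2]
    simp only [map_zero, map_pow]
    linear_combination -(C d * C e * X 0 ^ 3 * X 1 + C d * C f * X 0 ^ 2 * X 1 ^ 2
      + C e * C f * X 0 * X 1 ^ 3) * htwo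
  by_cases h0 : (C d * X 0 ^ 2 + C e * X 0 * X 1 + C f * X 1 ^ 2 : MvPolynomial (Fin 2) k) = 0
  · left
    rw [key, h0]
    simp
  · right
    obtain ⟨A, B, hA, hB, hA0, hB0, hAB⟩ := exists_linear_factors d e f h0
    refine ⟨A, B, hA, hB, hA0, hB0, ?_⟩
    rw [key, hAB, mul_pow]

lemma plucker_eq_zero_of_mem {l : Line k} {p q : Fin 4 → k} (hp : p ∈ l.space) (hq : q ∈ l.space)
    {x : Fin 4 × Fin 4} (hx : l.coord x = 0) : plucker p q x = 0 := by
  obtain ⟨u, v, h1, h2⟩ := l.exists_coord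
  rw [h1, Submodule.mem_span_pair] at hp hq
  obtain ⟨s, t, rfl⟩ := hp
  obtain ⟨s', t', rfl⟩ := hq
  rw [plucker_combination, ← h2, Pi.smul_apply, hx, smul_zero]

/-- On a skew congruence pᵢqⱼ = pⱼqᵢ for paired i and j, so the four terms of the polar cancel in
pairs in characteristic two. On a β-plane every term contains a vanishing coordinate. -/
lemma polar_eq_zero_of_mem_component [CharP k 2] {t : Fin 3 ⊕ Fin 4} {l : Line k}
    (hl : l ∈ component k t) : ∀ p ∈ l.space, ∀ q ∈ l.space, polar p q = 0 := by
  intro p hp q hq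
  have htwo : (2 : k) = 0 := CharTwo.two_eq_zero
  rcases t with r | m
  · rw [mem_component_iff] at hl
    have h : ∀ i, p i * q (partner r i) - p (partner r i) * q i = 0 := fun i =>
      plucker_eq_zero_of_mem hp hq (hl i _ (Or.inr rfl))
    simp only [polar]
    fin_cases r
    · have h0 : p 0 * q 1 - p 1 * q 0 = 0 := h 0
      have h2 : p 2 * q 3 - p 3 * q 2 = 0 := h 2
      linear_combination p 2 * p 3 * h0 + p 0 * p 1 * h2
        + (p 2 * p 3 * p 1 * q 0 + p 0 * p 1 * p 3 * q 2) * htwo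
    · have h0 : p 0 * q 2 - p 2 * q 0 = 0 := h 0
      have h2 : p 1 * q 3 - p 3 * q 1 = 0 := h 1
      linear_combination p 1 * p 3 * h0 + p 0 * p 2 * h2
        + (p 1 * p 3 * p 2 * q 0 + p 0 * p 2 * p 3 * q 1) * htwo
    · have h0 : p 0 * q 3 - p 3 * q 0 = 0 := h 0
      have h2 : p 1 * q 2 - p 2 * q 1 = 0 := h 1
      linear_combination p 1 * p 2 * h0 + p 0 * p 3 * h2
        + (p 1 * p 2 * p 3 * q 0 + p 0 * p 3 * p 2 * q 1) * htwo
  · have h1 : p m = 0 := mem_coordPlane.1 (hl hp)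
    have h2 : q m = 0 := mem_coordPlane.1 (hl hq)
    fin_cases m <;> simp at h1 h2 <;> simp [polar, h1, h2]

/-- For a line in no coordinate plane, v i • u - u i • v is its point on xᵢ = 0, with j-th entry
-c_ij. The polar there in a direction q is qᵢ times the product of the three other entries, so c_ij
= 0 for some j ≠ i. -/
lemma exists_component_of_polar_eq_zero {l : Line k}
    (h : ∀ p ∈ l.space, ∀ q ∈ l.space, polar p q = 0) : ∃ t, l ∈ component k t := by
  by_cases hβ : ∃ m, l ∈ component k (Sum.inr m)
  · exact ⟨_, hβ.choose_spec⟩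
  push Not at hβ
  obtain ⟨u, v, h1, h2⟩ := l.exists_coord
  have hu : u ∈ l.space := h1 ▸ Submodule.subset_span (by simp)
  have hv : v ∈ l.space := h1 ▸ Submodule.subset_span (by simp)
  have hne : ∀ m, ∃ q ∈ l.space, q m ≠ 0 := by
    intro m
    by_contra! hcon
    exact hβ m fun q hq => mem_coordPlane.2 (hcon q hq)
  let z : Fin 4 → Fin 4 → Prop := fun i j => l.coord (i, j) = 0
  have hsymm : ∀ i j, z i j → z j i := fun i j hij => by
    change l.coord (j, i) = 0
    rw [l.coord_swap, hij, neg_zero]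
  have htrans : ∀ i j m, z i j → z j m → z i m := by
    intro i j m hij hjm
    obtain ⟨q, hq, hq0⟩ := hne j
    -- A three-term relation valid for every q on the line. With q j ≠ 0 it gives transitivity.
    have e : q j * l.coord (i, m) = q i * l.coord (j, m) + q m * l.coord (i, j) := by
      rw [h1, Submodule.mem_span_pair] at hq
      obtain ⟨s, t, rfl⟩ := hq
      simp only [h2, plucker, Pi.add_apply, Pi.smul_apply, smul_eq_mul]
      ring
    rw [hij, hjm, mul_zero, mul_zero, add_zero] at e
    exact (mul_eq_zero.1 e).resolve_left hq0
  have hw : ∀ i, (v i • u - u i • v) ∈ l.space := fun i =>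
    sub_mem (Submodule.smul_mem _ _ hu) (Submodule.smul_mem _ _ hv)
  have hwj : ∀ i j, (v i • u - u i • v) j = -l.coord (i, j) := fun i j => by
    simp only [h2, plucker, Pi.sub_apply, Pi.smul_apply, smul_eq_mul]
    ring
  have hnb : ∀ i, ∀ q ∈ l.space, polar (v i • u - u i • v) q = 0 := fun i q hq => h _ (hw i) q hq
  simp only [polar, hwj] at hnb
  have n0 : z 0 1 ∨ z 0 2 ∨ z 0 3 := by
    obtain ⟨q, hq, hq0⟩ := hne 0
    have := hnb 0 q hq
    simpa [l.coord_self, hq0, or_assoc] using this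
  have n1 : z 1 0 ∨ z 1 2 ∨ z 1 3 := by
    obtain ⟨q, hq, hq0⟩ := hne 1
    have := hnb 1 q hq
    simpa [l.coord_self, hq0, or_assoc] using this
  have n2 : z 2 0 ∨ z 2 1 ∨ z 2 3 := by
    obtain ⟨q, hq, hq0⟩ := hne 2
    have := hnb 2 q hq
    simpa [l.coord_self, hq0, or_assoc] using this
  have n3 : z 3 0 ∨ z 3 1 ∨ z 3 2 := by
    obtain ⟨q, hq, hq0⟩ := hne 3
    have := hnb 3 q hq
    simpa [l.coord_self, hq0, or_assoc] using this
  have hrefl : ∀ i, z i i := l.coord_self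
  -- An equivalence relation on four elements without singleton classes has classes of sizes 2 + 2
  -- or 4, so it contains a perfect matching.
  have hmatch : (z 0 1 ∧ z 2 3) ∨ (z 0 2 ∧ z 1 3) ∨ (z 0 3 ∧ z 1 2) := by
    clear_value z
    grind
  have mem : ∀ r, (∀ i, z i (partner r i)) → ∃ t, l ∈ component k t := fun r hr =>
    ⟨Sum.inl r, (mem_component_iff _ _).2 fun i j hij => by
      rcases hij with rfl | rfl
      · exact hrefl _
      · exact hr i⟩
  rcases hmatch with ⟨h3, h4⟩ | ⟨h3, h4⟩ | ⟨h3, h4⟩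
  · refine mem 0 fun i => ?_
    fin_cases i
    exacts [h3, hsymm _ _ h3, h4, hsymm _ _ h4]
  · refine mem 1 fun i => ?_
    fin_cases i
    exacts [h3, h4, hsymm _ _ h3, hsymm _ _ h4]
  · refine mem 2 fun i => ?_
    fin_cases i
    exacts [h3, h4, hsymm _ _ h4, hsymm _ _ h3]

/-- The bitangent lines are the lines of the seven components. -/
theorem Bit_kummerQuartic [IsAlgClosed k] [CharP k 2] (a b c : k) :
    Bit (kummerQuartic a b c) = ⋃ t, component k t := by
  ext l
  rw [Set.mem_iUnion]
  refine ⟨fun h => exists_component_of_polar_eq_zero (polar_eq_zero_of_mem_Bit h), ?_⟩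
  rintro ⟨t, ht⟩
  obtain ⟨u, v, h1, -⟩ := l.exists_coord
  have h := polar_eq_zero_of_mem_component ht
  have hu : u ∈ l.space := h1 ▸ Submodule.subset_span (by simp)
  have hv : v ∈ l.space := h1 ▸ Submodule.subset_span (by simp)
  exact mem_Bit_of_polar_eq_zero a b c h1 (h u hu v hv) (h v hv u hu)

end Bitangents

/-! ### Trope planes -/

section Tropes

variable {k : Type*} [Field k]

lemma finrank_coordPlane (i : Fin 4) : Module.finrank k (coordPlane k i) = 3 := by
  have h : (LinearMap.proj i : (Fin 4 → k) →ₗ[k] k) ≠ 0 := fun h => by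
    have := LinearMap.congr_fun h (Pi.single i 1)
    simp at this
  have := Module.Dual.finrank_ker_add_one_of_ne_zero (K := k) h
  rw [Module.finrank_fin_fun] at this
  exact Nat.succ_injective this

/-- The conic `A xₛxₜ + B xₛxᵣ + C xₜxᵣ = 0` of a coordinate plane contains no line. -/
lemma not_forall_conic_eq_zero {i s t r : Fin 4} (hex : ∀ m, m = i ∨ m = s ∨ m = t ∨ m = r)
    {l : Line k} (hl : l.space ≤ coordPlane k i) {A B C : k} (hA : A ≠ 0) (hB : B ≠ 0) (hC : C ≠ 0)
    (h : ∀ v ∈ l.space, A * (v s * v t) + B * (v s * v r) + C * (v t * v r) = 0) : False := by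
  obtain ⟨u, v, h1, h2⟩ := l.exists_coord
  have hu : u ∈ l.space := h1 ▸ Submodule.subset_span (by simp)
  have hv : v ∈ l.space := h1 ▸ Submodule.subset_span (by simp)
  have hw : ∀ a b : k, a • u + b • v ∈ l.space := fun a b =>
    add_mem (Submodule.smul_mem _ _ hu) (Submodule.smul_mem _ _ hv)
  have hP := l.coord_ne_zero
  have hi := (mem_betaPlane_coordPlane_iff l i).1 hl
  have hst : ∀ a b : k, A * ((a * u s + b * v s) * (a * u t + b * v t))
      + B * ((a * u s + b * v s) * (a * u r + b * v r))
      + C * ((a * u t + b * v t) * (a * u r + b * v r)) = 0 := fun a b => h _ (hw a b)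
  -- The conic is evaluated at the points of the line where xₛ, xₜ and xᵣ vanish; hence at most one
  -- of the three Plücker coordinates is non-zero.
  have es : C * (plucker u v (s, t) * plucker u v (s, r)) = 0 := by
    have := hst (v s) (-u s)
    simp only [plucker]
    linear_combination this
  have et : B * (plucker u v (s, t) * plucker u v (t, r)) = 0 := by
    have := hst (v t) (-u t)
    simp only [plucker]
    linear_combination -this
  have er : A * (plucker u v (s, r) * plucker u v (t, r)) = 0 := by
    have := hst (v r) (-u r)
    simp only [plucker]
    linear_combination this
  -- The points where xₛ + xₜ and its analogues vanish exclude a single non-zero coordinate.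
  have fst : A * plucker u v (s, t) ^ 2 = (C - B) * plucker u v (s, t) *
      (plucker u v (s, r) + plucker u v (t, r)) := by
    have := hst (v s + v t) (-(u s + u t))
    simp only [plucker]
    linear_combination -this
  have fsr : B * plucker u v (s, r) ^ 2 = (C - A) * plucker u v (s, r) *
      (plucker u v (s, t) - plucker u v (t, r)) := by
    have := hst (v s + v r) (-(u s + u r))
    simp only [plucker]
    linear_combination -this
  have ftr : C * plucker u v (t, r) ^ 2 = (A - B) * plucker u v (t, r) *
      (plucker u v (s, t) + plucker u v (s, r)) := by
    have := hst (v t + v r) (-(u t + u r))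
    simp only [plucker]
    linear_combination -this
  have zst : plucker u v (s, t) = 0 := by
    by_contra h0
    have e1 : plucker u v (s, r) = 0 := by simpa [hC, h0] using es
    have e2 : plucker u v (t, r) = 0 := by simpa [hB, h0] using et
    simp [e1, e2, hA, h0] at fst
  have zsr : plucker u v (s, r) = 0 := by
    by_contra h0
    have e2 : plucker u v (t, r) = 0 := by simpa [hA, h0] using er
    simp [zst, e2, hB, h0] at fsr
  have ztr : plucker u v (t, r) = 0 := by
    by_contra h0
    simp [zst, zsr, hC, h0] at ftr
  rw [← h2] at zst zsr ztr
  apply hP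
  ext ⟨m, n⟩
  rcases hex m with rfl | rfl | rfl | rfl <;> rcases hex n with rfl | rfl | rfl | rfl <;>
    first
    | exact l.coord_self _
    | exact hi _
    | assumption
    | (refine (l.coord_swap _ _).trans (neg_eq_zero.2 ?_); first | exact hi _ | assumption)

/-- The quadratic form whose square is the quartic up to the term `xyzw`. -/
noncomputable def rootQuadric (α β γ : k) : MvPolynomial (Fin 4) k :=
  C α * (X 0 * X 1 + X 2 * X 3) + C β * (X 0 * X 2 + X 1 * X 3) + C γ * (X 0 * X 3 + X 1 * X 2)

lemma isHomogeneous_rootQuadric (α β γ : k) : (rootQuadric α β γ).IsHomogeneous 2 := by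
  have hX : ∀ i j : Fin 4, (X i * X j : MvPolynomial (Fin 4) k).IsHomogeneous 2 :=
    fun i j => (isHomogeneous_X k i).mul (isHomogeneous_X k j)
  have hC : ∀ (e : k) {G : MvPolynomial (Fin 4) k}, G.IsHomogeneous 2 →
      (C e * G).IsHomogeneous 2 := fun e G hG => by
    simpa using (isHomogeneous_C (Fin 4) e).mul hG
  exact ((hC α ((hX 0 1).add (hX 2 3))).add (hC β ((hX 0 2).add (hX 1 3)))).add
    (hC γ ((hX 0 3).add (hX 1 2)))

lemma eval_rootQuadric (α β γ : k) (v : Fin 4 → k) : eval v (rootQuadric α β γ) =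
    α * (v 0 * v 1 + v 2 * v 3) + β * (v 0 * v 2 + v 1 * v 3) + γ * (v 0 * v 3 + v 1 * v 2) := by
  simp [rootQuadric]

lemma kummerQuartic_eq [CharP k 2] (α β γ : k) : kummerQuartic (α ^ 2) (β ^ 2) (γ ^ 2) =
    rootQuadric α β γ ^ 2 + X 0 * X 1 * X 2 * X 3 := by
  simp only [rootQuadric, kummerQuartic, CharTwo.add_sq, mul_pow, map_pow]

/-- On a coordinate plane xyzw vanishes and the quartic becomes the square of `rootQuadric`. The
latter restricts to a conic in three variables with all three mixed coefficients non-zero. -/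
lemma isTropePlane_coordPlane [IsAlgClosed k] [CharP k 2] {a b c : k} (ha : a ≠ 0) (hb : b ≠ 0)
    (hc : c ≠ 0) (i : Fin 4) : IsTropePlane (kummerQuartic a b c) (coordPlane k i) := by
  obtain ⟨α, rfl⟩ := IsAlgClosed.exists_pow_nat_eq a (n := 2) (by norm_num)
  obtain ⟨β, rfl⟩ := IsAlgClosed.exists_pow_nat_eq b (n := 2) (by norm_num)
  obtain ⟨γ, rfl⟩ := IsAlgClosed.exists_pow_nat_eq c (n := 2) (by norm_num)
  have hα : α ≠ 0 := by rintro rfl; simp at ha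
  have hβ : β ≠ 0 := by rintro rfl; simp at hb
  have hγ : γ ≠ 0 := by rintro rfl; simp at hc
  refine ⟨finrank_coordPlane i, rootQuadric α β γ, isHomogeneous_rootQuadric α β γ, ?_, ?_⟩
  · intro v hv
    rw [mem_coordPlane] at hv
    rw [kummerQuartic_eq, map_add, map_pow, add_eq_left]
    fin_cases i <;> simp at hv <;> simp [hv]
  · rintro ⟨l, hl, hQ⟩
    simp only [eval_rootQuadric] at hQ
    have hi : ∀ v ∈ l.space, v i = 0 := fun v hv => mem_coordPlane.1 (hl hv)
    fin_cases i
    · refine not_forall_conic_eq_zero (s := 1) (t := 2) (r := 3) (by decide) hl hγ hβ hα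
        fun v hv => ?_
      have h0 : v 0 = 0 := hi v hv
      have := hQ v hv
      rw [h0] at this
      linear_combination this
    · refine not_forall_conic_eq_zero (s := 0) (t := 2) (r := 3) (by decide) hl hβ hγ hα
        fun v hv => ?_
      have h0 : v 1 = 0 := hi v hv
      have := hQ v hv
      rw [h0] at this
      linear_combination this
    · refine not_forall_conic_eq_zero (s := 0) (t := 1) (r := 3) (by decide) hl hα hγ hβ
        fun v hv => ?_
      have h0 : v 2 = 0 := hi v hv
      have := hQ v hv
      rw [h0] at this
      linear_combination this
    · refine not_forall_conic_eq_zero (s := 0) (t := 1) (r := 2) (by decide) hl hα hβ hγ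
        fun v hv => ?_
      have h0 : v 3 = 0 := hi v hv
      have := hQ v hv
      rw [h0] at this
      linear_combination this

lemma eval_restrictToLine (F : MvPolynomial (Fin 4) k) (u v : Fin 4 → k) (w : Fin 2 → k) :
    eval w (restrictToLine F u v) = eval (w 0 • u + w 1 • v) F := by
  rw [restrictToLine, eval_aeval]
  congr 2
  ext i
  simp [mul_comm]

/-- On a trope plane, the derivatives of `xyzw` vanish. -/
lemma polar_eq_zero_of_isTropePlane [Infinite k] [CharP k 2] {a b c : k}
    {E : Submodule k (Fin 4 → k)} (hE : IsTropePlane (kummerQuartic a b c) E) :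
    ∀ p ∈ E, ∀ q ∈ E, polar p q = 0 := by
  obtain ⟨-, Q, -, hQ, -⟩ := hE
  intro p hp q hq
  have hsq : restrictToLine (kummerQuartic a b c) p q = restrictToLine Q p q ^ 2 := by
    refine MvPolynomial.funext fun w => ?_
    rw [map_pow, eval_restrictToLine, eval_restrictToLine]
    exact hQ _ (add_mem (E.smul_mem _ hp) (E.smul_mem _ hq))
  have := eval_pderiv_restrictToLine a b c p q ![1, 0] 1
  rw [hsq, pderiv_sq, map_zero] at this
  simpa using this.symm

/-- Used with B a meaning that e_a lies in the plane. For every i the bad indices lie in some {i,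
j}, so a good index exists; taking i good leaves at most one bad index. -/
lemma exists_forall_of_pairs : ∀ B : Fin 4 → Bool,
    (∀ i, ∃ j, ∀ a, a ≠ i → a ≠ j → B a = true) → ∃ m, ∀ a, a ≠ m → B a = true := by decide

lemma eq_of_notMem_pair : ∀ i j a m n : Fin 4, m ≠ i → m ≠ j → n ≠ i → n ≠ j → m ≠ n → i ≠ j →
    a ≠ i → a ≠ j → a = m ∨ a = n := by decide

lemma single_mem_of_le_coordPlane {l : Line k} {i j : Fin 4} (hij : i ≠ j)
    (hi : l.space ≤ coordPlane k i) (hj : l.space ≤ coordPlane k j) {a : Fin 4} (hai : a ≠ i)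
    (haj : a ≠ j) : (Pi.single a 1 : Fin 4 → k) ∈ l.space := by
  have hi' := (mem_betaPlane_coordPlane_iff l i).1 hi
  have hj' := (mem_betaPlane_coordPlane_iff l j).1 hj
  obtain ⟨⟨m, n⟩, h0⟩ := Function.ne_iff.1 l.coord_ne_zero
  have hmi : m ≠ i := by rintro rfl; exact h0 (hi' n)
  have hmj : m ≠ j := by rintro rfl; exact h0 (hj' n)
  have hni : n ≠ i := by rintro rfl; exact h0 (by rw [l.coord_swap, hi' m, neg_zero]; rfl)
  have hnj : n ≠ j := by rintro rfl; exact h0 (by rw [l.coord_swap, hj' m, neg_zero]; rfl)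
  have hmn : m ≠ n := by rintro rfl; exact h0 (l.coord_self m)
  have h0' : l.coord (m, n) ≠ 0 := h0
  have hex : ∀ x, x = i ∨ x = j ∨ x = m ∨ x = n := by
    intro x
    by_cases hxi : x = i
    · exact Or.inl hxi
    · by_cases hxj : x = j
      · exact Or.inr (Or.inl hxj)
      · exact Or.inr (Or.inr (eq_of_notMem_pair i j x m n hmi hmj hni hnj hmn hij hxi hxj))
  have e1 : l.vecFst m n = Pi.single m 1 := by
    ext x
    simp only [Line.vecFst]
    rcases hex x with rfl | rfl | rfl | rfl
    · simp [hi', hmi.symm]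
    · simp [hj', hmj.symm]
    · simp [h0']
    · simp [l.coord_self, hmn.symm]
  have e2 : l.vecSnd m n = Pi.single n 1 := by
    ext x
    simp only [Line.vecSnd]
    rcases hex x with rfl | rfl | rfl | rfl
    · rw [l.coord_swap]
      simp [hi', hni.symm]
    · rw [l.coord_swap]
      simp [hj', hnj.symm]
    · simp [l.coord_self, hmn]
    · simp [h0']
  rw [Line.space_eq_span_vec h0', e1, e2]
  rcases eq_of_notMem_pair i j a m n hmi hmj hni hnj hmn hij hai haj with rfl | rfl
  · exact Submodule.subset_span (by simp)
  · exact Submodule.subset_span (by simp)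

/-- A line on which a product of three coordinates vanishes lies in a coordinate plane. -/
lemma exists_le_coordPlane_of_mul_eq_zero [Infinite k] {l : Line k} {s t r : Fin 4}
    (h : ∀ p ∈ l.space, p s * p t * p r = 0) :
    l.space ≤ coordPlane k s ∨ l.space ≤ coordPlane k t ∨ l.space ≤ coordPlane k r := by
  obtain ⟨u, v, h1, -⟩ := l.exists_coord
  have hu : u ∈ l.space := h1 ▸ Submodule.subset_span (by simp)
  have hv : v ∈ l.space := h1 ▸ Submodule.subset_span (by simp)
  let L : Fin 4 → MvPolynomial (Fin 2) k := fun i => C (u i) * X 0 + C (v i) * X 1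
  have hL : ∀ i, L i = 0 → l.space ≤ coordPlane k i := by
    intro i h0
    rw [h1, Submodule.span_le, Set.pair_subset_iff]
    have e0 := congrArg (eval ![1, 0]) h0
    have e1 := congrArg (eval ![0, 1]) h0
    simp only [L, map_add, map_mul, eval_C, eval_X, map_zero] at e0 e1
    exact ⟨mem_coordPlane.2 (by simpa using e0), mem_coordPlane.2 (by simpa using e1)⟩
  have hprod : L s * L t * L r = 0 := by
    refine MvPolynomial.funext fun w => ?_
    have := h (w 0 • u + w 1 • v) (add_mem (Submodule.smul_mem _ _ hu) (Submodule.smul_mem _ _ hv))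
    simp only [L, map_add, map_mul, eval_C, eval_X, map_zero]
    simp only [Pi.add_apply, Pi.smul_apply, smul_eq_mul] at this
    linear_combination this
  rcases mul_eq_zero.1 hprod with h0 | h0
  · exact (mul_eq_zero.1 h0).imp (hL _) fun h => Or.inl (hL _ h)
  · exact Or.inr (Or.inr (hL _ h0))

/-- If E is no coordinate plane, it meets xᵢ = 0 in a line. There the polar towards a q in E with qᵢ
≠ 0 is qᵢ times the product of the other coordinates, so the line lies in a second coordinate plane
and is spanned by two basis vectors. Varying i puts three basis vectors into E, a contradiction. -/
lemma eq_coordPlane_of_polar_eq_zero [Infinite k] {E : Submodule k (Fin 4 → k)}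
    (hE : Module.finrank k E = 3) (h : ∀ p ∈ E, ∀ q ∈ E, polar p q = 0) :
    ∃ i, E = coordPlane k i := by
  by_contra! hcon
  have hline : ∀ i, ∃ l : Line k, l.space = E ⊓ coordPlane k i := by
    intro i
    have h1 := Submodule.finrank_sup_add_finrank_inf_eq E (coordPlane k i)
    have hlt : E < E ⊔ coordPlane k i := by
      refine lt_of_le_of_ne le_sup_left fun heq => hcon i ?_
      have hle : coordPlane k i ≤ E := by rw [heq]; exact le_sup_right
      exact (Submodule.eq_of_le_of_finrank_eq hle (by rw [hE, finrank_coordPlane])).symm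
    have h2 := Submodule.finrank_lt_finrank_of_lt hlt
    have h3 := Submodule.finrank_le (E ⊔ coordPlane k i)
    rw [Module.finrank_fin_fun] at h3
    rw [hE, finrank_coordPlane] at h1
    exact ⟨⟨_, by omega⟩, rfl⟩
  have hne : ∀ i, ∃ q ∈ E, q i ≠ 0 := by
    intro i
    by_contra! hq
    exact hcon i (Submodule.eq_of_le_of_finrank_eq (fun q hqE => mem_coordPlane.2 (hq q hqE))
      (by rw [hE, finrank_coordPlane]))
  have hpair : ∀ i, ∃ j, ∀ a, a ≠ i → a ≠ j → (Pi.single a 1 : Fin 4 → k) ∈ E := by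
    intro i
    obtain ⟨l, hl⟩ := hline i
    obtain ⟨q, hq, hq0⟩ := hne i
    have hlE : l.space ≤ E := hl ▸ inf_le_left
    have hli : l.space ≤ coordPlane k i := hl ▸ inf_le_right
    have hp : ∀ p ∈ l.space, polar p q = 0 ∧ p i = 0 := fun p hp =>
      ⟨h p (hlE hp) q hq, mem_coordPlane.1 (hli hp)⟩
    have hj : ∃ j, i ≠ j ∧ l.space ≤ coordPlane k j := by
      fin_cases i
      · have h3 : ∀ p ∈ l.space, p 1 * p 2 * p 3 = 0 := fun p hpl => by
          obtain ⟨e, e0⟩ := hp p hpl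
          simp at e0 hq0
          simpa [polar, e0, hq0] using e
        rcases exists_le_coordPlane_of_mul_eq_zero h3 with h | h | h
        exacts [⟨1, by decide, h⟩, ⟨2, by decide, h⟩, ⟨3, by decide, h⟩]
      · have h3 : ∀ p ∈ l.space, p 0 * p 2 * p 3 = 0 := fun p hpl => by
          obtain ⟨e, e0⟩ := hp p hpl
          simp at e0 hq0
          simpa [polar, e0, hq0] using e
        rcases exists_le_coordPlane_of_mul_eq_zero h3 with h | h | h
        exacts [⟨0, by decide, h⟩, ⟨2, by decide, h⟩, ⟨3, by decide, h⟩]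
      · have h3 : ∀ p ∈ l.space, p 0 * p 1 * p 3 = 0 := fun p hpl => by
          obtain ⟨e, e0⟩ := hp p hpl
          simp at e0 hq0
          simpa [polar, e0, hq0] using e
        rcases exists_le_coordPlane_of_mul_eq_zero h3 with h | h | h
        exacts [⟨0, by decide, h⟩, ⟨1, by decide, h⟩, ⟨3, by decide, h⟩]
      · have h3 : ∀ p ∈ l.space, p 0 * p 1 * p 2 = 0 := fun p hpl => by
          obtain ⟨e, e0⟩ := hp p hpl
          simp at e0 hq0
          simpa [polar, e0, hq0] using e
        rcases exists_le_coordPlane_of_mul_eq_zero h3 with h | h | h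
        exacts [⟨0, by decide, h⟩, ⟨1, by decide, h⟩, ⟨2, by decide, h⟩]
    obtain ⟨j, hij, hlj⟩ := hj
    exact ⟨j, fun a hai haj => hlE (single_mem_of_le_coordPlane hij hli hlj hai haj)⟩
  classical
  obtain ⟨m, hm⟩ := exists_forall_of_pairs
    (fun a => decide ((Pi.single a 1 : Fin 4 → k) ∈ E)) (by simpa using hpair)
  simp only [decide_eq_true_eq] at hm
  refine hcon m (Submodule.eq_of_le_of_finrank_eq (fun v hv => ?_)
    (by rw [hE, finrank_coordPlane])).symm
  rw [pi_eq_sum_univ' v]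
  refine Submodule.sum_mem _ fun a _ => ?_
  by_cases ham : a = m
  · subst ham
    rw [mem_coordPlane.1 hv, zero_smul]
    exact zero_mem _
  · exact Submodule.smul_mem _ _ (by simpa [Pi.single, Function.update_apply, eq_comm] using hm a ham)

theorem isTropePlane_iff [IsAlgClosed k] [CharP k 2] {a b c : k} (ha : a ≠ 0) (hb : b ≠ 0)
    (hc : c ≠ 0) (E : Submodule k (Fin 4 → k)) :
    IsTropePlane (kummerQuartic a b c) E ↔ ∃ i, E = coordPlane k i := by
  constructor
  · intro hE
    exact eq_coordPlane_of_polar_eq_zero hE.1 (polar_eq_zero_of_isTropePlane hE)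
  · rintro ⟨i, rfl⟩
    exact isTropePlane_coordPlane ha hb hc i

end Tropes

/-! ### Irreducibility of the quartic surface -/

section Irreducibility

variable {k : Type*} [Field k]

/-- A divisor with non-zero constant term of a homogeneous polynomial is constant. -/
lemma isUnit_of_dvd_of_isHomogeneous [Infinite k] {τ : Type*} {d : ℕ} {F G : MvPolynomial τ k}
    (hF : F.IsHomogeneous d) (hF0 : F ≠ 0) (hGF : G ∣ F) (hG : eval 0 G ≠ 0) : IsUnit G := by
  -- Restriction to the line through the origin and v: φ v H is the polynomial t ↦ H(t v).
  let φ : (τ → k) → MvPolynomial τ k →ₐ[k] Polynomial k := fun v =>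
    aeval fun i => Polynomial.C (v i) * Polynomial.X
  have hφ : ∀ v H (t : k), Polynomial.eval t (φ v H) = eval (t • v) H := by
    intro v H t
    have h1 : (Polynomial.aeval t).comp (φ v) = MvPolynomial.aeval (t • v) := by
      ext i
      simp only [φ, AlgHom.comp_apply, aeval_X, map_mul, Polynomial.aeval_C, Polynomial.aeval_X,
        Algebra.algebraMap_self, RingHom.id_apply, Pi.smul_apply, smul_eq_mul]
      exact mul_comm _ _
    have := AlgHom.congr_fun h1 H
    simpa [Polynomial.coe_aeval_eq_eval, coe_aeval_eq_eval] using this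
  -- On this line F is F(v) t^d, so its divisor G is a constant times a power of t; as G(0) ≠ 0, it
  -- is constant on the line.
  have key : ∀ v, eval v F ≠ 0 → eval v G = eval 0 G := by
    intro v hv
    have hX : φ v F = Polynomial.C (eval v F) * Polynomial.X ^ d := by
      refine Polynomial.funext fun t => ?_
      rw [hφ, eval_smul_of_isHomogeneous hF, Polynomial.eval_mul, Polynomial.eval_C,
        Polynomial.eval_pow, Polynomial.eval_X, mul_comm]
    have hdvd : φ v G ∣ Polynomial.X ^ d := by
      have h1 : φ v G ∣ φ v F := map_dvd _ hGF
      rw [hX] at h1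
      exact ((Polynomial.isUnit_C.2 (isUnit_iff_ne_zero.2 hv)).dvd_mul_left).1 h1
    obtain ⟨n, -, hn⟩ := (dvd_prime_pow Polynomial.prime_X d).1 hdvd
    have hn0 : n = 0 := by
      by_contra hn0
      have h1 : (Polynomial.X : Polynomial k) ∣ φ v G := (dvd_pow_self _ hn0).trans hn.symm.dvd
      rw [Polynomial.X_dvd_iff, Polynomial.coeff_zero_eq_eval_zero, hφ, zero_smul] at h1
      exact hG h1
    rw [hn0, pow_zero] at hn
    obtain ⟨e, -, he⟩ := Polynomial.isUnit_iff.1 (associated_one_iff_isUnit.1 hn)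
    have e0 := hφ v G 0
    have e1 := hφ v G 1
    rw [← he] at e0 e1
    simp only [Polynomial.eval_C, zero_smul, one_smul] at e0 e1
    rw [← e0, ← e1]
  have hmul : F * (G - C (eval 0 G)) = 0 := by
    refine MvPolynomial.funext fun v => ?_
    by_cases hv : eval v F = 0
    · simp [hv]
    · simp [key v hv]
  rw [sub_eq_zero.1 ((mul_eq_zero.1 hmul).resolve_left hF0), isUnit_map_iff]
  exact isUnit_iff_ne_zero.2 hG

/-- The conic cut out on `w = 0`. -/
noncomputable def tropeConic (α β γ : k) : MvPolynomial (Fin 4) k :=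
  (C α * X 1 + C β * X 2) * X 0 + C γ * (X 1 * X 2)

/-- The conic is linear in X 0, with leading coefficient an irreducible linear form that does not
divide the rest. -/
lemma irreducible_tropeConic [CharP k 2] {α β γ : k} (hα : α ≠ 0) (hβ : β ≠ 0) (hγ : γ ≠ 0) :
    Irreducible (tropeConic α β γ) := by
  have hv : ∀ i : Fin 4, i = 0 ∨ i = 3 → i ∉ (C α * X 1 + C β * X 2 : MvPolynomial (Fin 4) k).vars := by
    intro i hi hmem
    have := vars_add_subset _ _ hmem
    rw [vars_C_mul _ hα, vars_C_mul _ hβ, vars_X, vars_X] at this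
    rcases hi with rfl | rfl <;> revert this <;> decide
  have hlin : Irreducible (C α * X 1 + C β * X 2 : MvPolynomial (Fin 4) k) := by
    refine irreducible_mul_X_add _ _ _ (C_ne_zero.2 hα) (by simp) ?_ ?_
    · rw [vars_C_mul _ hβ, vars_X]
      decide
    · exact ((isUnit_iff_ne_zero.2 hα).map C).isRelPrime_left
  refine irreducible_mul_X_add _ _ _ hlin.ne_zero (hv 0 (Or.inl rfl)) ?_
    (hlin.isRelPrime_iff_not_dvd.2 fun hdvd => ?_)
  · rw [vars_C_mul _ hγ]
    intro hmem
    have := vars_mul _ _ hmem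
    rw [vars_X, vars_X] at this
    revert this
    decide
  · obtain ⟨H, hH⟩ := hdvd
    -- At this point α X 1 + β X 2 is 2αβ = 0, whereas γ X 1 X 2 is not zero.
    have := congrArg (eval ![0, β, α, 0]) hH
    have h2 : α * β + β * α = 0 := by rw [mul_comm β, CharTwo.add_self_eq_zero]
    simp [h2, hα, hβ, hγ] at this

/-- Setting w = 0 turns the quartic into N² with N = `tropeConic α β γ` irreducible. In a
factorization, either one factor reduces to a unit and is then itself a unit, being a divisor of a
form with non-zero constant term, or N divides both reductions. The derivative with respect to w
excludes the latter. -/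
lemma irreducible_kummerQuartic [IsAlgClosed k] [CharP k 2] {a b c : k} (ha : a ≠ 0) (hb : b ≠ 0)
    (hc : c ≠ 0) : Irreducible (kummerQuartic a b c) := by
  obtain ⟨α, rfl⟩ := IsAlgClosed.exists_pow_nat_eq a (n := 2) (by norm_num)
  obtain ⟨β, rfl⟩ := IsAlgClosed.exists_pow_nat_eq b (n := 2) (by norm_num)
  obtain ⟨γ, rfl⟩ := IsAlgClosed.exists_pow_nat_eq c (n := 2) (by norm_num)
  have hα : α ≠ 0 := by rintro rfl; simp at ha
  have hβ : β ≠ 0 := by rintro rfl; simp at hb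
  have hγ : γ ≠ 0 := by rintro rfl; simp at hc
  have hN := (irreducible_tropeConic hα hβ hγ).prime
  let ρ : MvPolynomial (Fin 4) k →ₐ[k] MvPolynomial (Fin 4) k := aeval ![X 0, X 1, X 2, 0]
  have hρF : ρ (kummerQuartic (α ^ 2) (β ^ 2) (γ ^ 2)) = tropeConic α β γ ^ 2 := by
    rw [kummerQuartic_eq, map_add, map_pow]
    simp only [ρ, rootQuadric, tropeConic, map_add, map_mul, aeval_X, aeval_C, algebraMap_eq,
      Matrix.cons_val]
    ring
  have hdF : pderiv 3 (kummerQuartic (α ^ 2) (β ^ 2) (γ ^ 2)) = X 0 * X 1 * X 2 := by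
    rw [kummerQuartic_eq, map_add, pderiv_sq, zero_add]
    simp [Derivation.leibniz, pderiv_X]
  have heval0 : ∀ G, eval 0 (ρ G) = eval 0 G := by
    intro G
    rw [eval_aeval]
    congr 2
    ext i
    fin_cases i <;> simp
  have hF0 : kummerQuartic (α ^ 2) (β ^ 2) (γ ^ 2) ≠ 0 := by
    intro h0
    rw [h0, map_zero] at hρF
    exact pow_ne_zero 2 hN.ne_zero hρF.symm
  have hunit : ∀ G, G ∣ kummerQuartic (α ^ 2) (β ^ 2) (γ ^ 2) → IsUnit (ρ G) → IsUnit G := by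
    intro G hG hu
    refine isUnit_of_dvd_of_isHomogeneous (isHomogeneous_kummerQuartic _ _ _) hF0 hG ?_
    rw [← heval0]
    exact (hu.map (eval 0)).ne_zero
  refine ⟨?_, ?_⟩
  · intro hu
    have := hu.map ρ
    rw [hρF] at this
    exact hN.not_isUnit (isUnit_of_dvd_unit (dvd_pow_self _ two_ne_zero) this)
  · intro G H hGH
    have hmul : tropeConic α β γ ^ 2 = ρ G * ρ H := by rw [← hρF, hGH, map_mul]
    by_cases hNG : tropeConic α β γ ∣ ρ G
    · by_cases hNH : tropeConic α β γ ∣ ρ H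
      · exfalso
        -- The w-derivative of the quartic is xyz. By Leibniz N would divide it, yet N divides no
        -- variable, since it vanishes at the coordinate points.
        have h1 : X 0 * X 1 * X 2 = ρ G * ρ (pderiv 3 H) + ρ H * ρ (pderiv 3 G) := by
          have h0 : G * pderiv 3 H + H * pderiv 3 G = X 0 * X 1 * X 2 := by
            rw [← hdF, hGH, Derivation.leibniz, smul_eq_mul, smul_eq_mul]
          rw [← map_mul, ← map_mul, ← map_add, h0]
          simp [ρ]
        have h2 : tropeConic α β γ ∣ X 0 * X 1 * X 2 := by
          rw [h1]
          exact dvd_add (hNG.mul_right _) (hNH.mul_right _)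
        have h3 : ∀ i : Fin 4, ¬ tropeConic α β γ ∣ X i := by
          rintro i ⟨q, hq⟩
          have := congrArg (eval (Pi.single i 1)) hq
          have h0 : eval (Pi.single i 1) (tropeConic α β γ) = 0 := by
            fin_cases i <;> simp [tropeConic]
          simp [h0] at this
        rcases hN.dvd_or_dvd h2 with h | h
        · rcases hN.dvd_or_dvd h with h | h
          exacts [h3 _ h, h3 _ h]
        · exact h3 _ h
      · right
        refine hunit H ⟨G, by rw [hGH, mul_comm]⟩ ?_
        obtain ⟨n, hn, hassoc⟩ := (dvd_prime_pow hN 2).1 ⟨ρ G, by rw [hmul, mul_comm]⟩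
        rcases Nat.eq_zero_or_pos n with rfl | hpos
        · rw [pow_zero] at hassoc
          exact associated_one_iff_isUnit.1 hassoc
        · exact (hNH ((dvd_pow_self _ hpos.ne').trans hassoc.symm.dvd)).elim
    · left
      refine hunit G ⟨H, hGH⟩ ?_
      obtain ⟨n, hn, hassoc⟩ := (dvd_prime_pow hN 2).1 ⟨ρ H, hmul⟩
      rcases Nat.eq_zero_or_pos n with rfl | hpos
      · rw [pow_zero] at hassoc
        exact associated_one_iff_isUnit.1 hassoc
      · exact (hNG ((dvd_pow_self _ hpos.ne').trans hassoc.symm.dvd)).elim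

section Surface

variable [IsAlgClosed k] [CharP k 2] {a b c : k}

lemma not_kummerQuartic_dvd (ha : a ≠ 0) (hb : b ≠ 0) (hc : c ≠ 0) {G : MvPolynomial (Fin 4) k}
    (hG0 : G ≠ 0) (hG : G.totalDegree < 4) : ¬ kummerQuartic a b c ∣ G := by
  intro h
  have h1 := totalDegree_le_of_dvd_of_isDomain h hG0
  rw [(isHomogeneous_kummerQuartic a b c).totalDegree
    (irreducible_kummerQuartic ha hb hc).ne_zero] at h1
  omega

/-- The projective Nullstellensatz for the quartic. -/
lemma kummerQuartic_dvd_of_zeros (ha : a ≠ 0) (hb : b ≠ 0) (hc : c ≠ 0) {G : MvPolynomial (Fin 4) k}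
    (h : ∀ v, v ≠ 0 → eval v (kummerQuartic a b c) = 0 → eval v G = 0) :
    kummerQuartic a b c ∣ G := by
  have hF := (irreducible_kummerQuartic ha hb hc).prime
  have : (Ideal.span {kummerQuartic a b c}).IsPrime :=
    (Ideal.span_singleton_prime hF.ne_zero).2 hF
  -- The hypothesis says nothing about the origin; the factor X 0 makes the product vanish there
  -- too, and is afterwards removed by primality.
  have hmem : G * X 0 ∈ vanishingIdeal k (zeroLocus k (Ideal.span {kummerQuartic a b c})) := by
    rw [mem_vanishingIdeal_iff]
    intro v hv
    rw [mem_zeroLocus_iff] at hv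
    have hv0 := hv _ (Ideal.mem_span_singleton_self _)
    simp only [map_mul, aeval_X] at hv0 ⊢
    by_cases hz : v = 0
    · simp [hz]
    · have := h v hz (by simpa [coe_aeval_eq_eval] using hv0)
      simp [this]
  rw [MvPolynomial.IsPrime.vanishingIdeal_zeroLocus, Ideal.mem_span_singleton] at hmem
  refine (hF.dvd_or_dvd hmem).resolve_right (not_kummerQuartic_dvd ha hb hc (X_ne_zero _) ?_)
  rw [totalDegree_X]
  norm_num

lemma kummerQuartic_dvd_of_zeros_subset (ha : a ≠ 0) (hb : b ≠ 0) (hc : c ≠ 0) {d : ℕ}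
    {G : MvPolynomial (Fin 4) k} (hG : G.IsHomogeneous d)
    (h : zeros (kummerQuartic a b c) ⊆ zeros G) : kummerQuartic a b c ∣ G :=
  kummerQuartic_dvd_of_zeros ha hb hc fun v hv hF =>
    (mk_mem_zeros_iff hG v hv).1 (h ((mk_mem_zeros_iff (isHomogeneous_kummerQuartic a b c) v hv).2 hF))

lemma isIrreducible_zeros_kummerQuartic (ha : a ≠ 0) (hb : b ≠ 0) (hc : c ≠ 0) :
    IsIrreducible (zeros (kummerQuartic a b c)) := by
  have hF := (irreducible_kummerQuartic ha hb hc).prime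
  refine ⟨?_, ?_⟩
  · by_contra hne
    rw [Set.not_nonempty_iff_eq_empty] at hne
    have := kummerQuartic_dvd_of_zeros_subset ha hb hc (isHomogeneous_one (Fin 4) k)
      (by rw [hne]; exact Set.empty_subset _)
    exact hF.not_isUnit (isUnit_of_dvd_one this)
  · rintro U V hU hV ⟨P, hP, hPU⟩ ⟨Q, hQ, hQV⟩
    obtain ⟨d, G, hG, hGP, hGU⟩ := homZariski_P3.exists_ne_subset hU hPU
    obtain ⟨e, H, hH, hHQ, hHV⟩ := homZariski_P3.exists_ne_subset hV hQV
    by_contra hcon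
    have hsub : zeros (kummerQuartic a b c) ⊆ zeros (G * H) := by
      intro R hR
      by_contra hR'
      have : eval R.rep G ≠ 0 ∧ eval R.rep H ≠ 0 := by simpa [zeros] using hR'
      exact hcon ⟨R, hR, hGU R this.1, hHV R this.2⟩
    have hdvd := kummerQuartic_dvd_of_zeros_subset ha hb hc (hG.mul hH) hsub
    rcases hF.dvd_or_dvd hdvd with ⟨q, rfl⟩ | ⟨q, rfl⟩
    · exact hGP (by rw [map_mul, show eval P.rep (kummerQuartic a b c) = 0 from hP, zero_mul])
    · exact hHQ (by rw [map_mul, show eval Q.rep (kummerQuartic a b c) = 0 from hQ, zero_mul])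

end Surface

end Irreducibility

/-! ### Bitangent involutions -/

section Involutions

variable {k : Type*} [Field k]

/-- The Cremona involution that belongs to a pair of skew coordinate lines. -/
noncomputable def cremona (k : Type*) [Field k] (r : Fin 3) (i : Fin 4) : MvPolynomial (Fin 4) k :=
  X i * X (partner (r + 1) i) * X (partner (r + 2) i)

/-- The values of the Cremona involution. -/
def cremonaVec (r : Fin 3) (v : Fin 4 → k) : Fin 4 → k := fun i =>
  v i * v (partner (r + 1) i) * v (partner (r + 2) i)

lemma eval_cremona (r : Fin 3) (v : Fin 4 → k) :
    (fun i => eval v (cremona k r i)) = cremonaVec r v := by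
  ext i
  simp [cremona, cremonaVec]

lemma isHomogeneous_cremona (r : Fin 3) (i : Fin 4) : (cremona k r i).IsHomogeneous 3 :=
  ((isHomogeneous_X k _).mul (isHomogeneous_X k _)).mul (isHomogeneous_X k _)

/-- The difference of the two products of paired coordinates. -/
noncomputable def pairForm (k : Type*) [Field k] (r : Fin 3) : MvPolynomial (Fin 4) k :=
  X 0 * X (partner r 0) - X (partner (r + 1) 0) * X (partner (r + 2) 0)

lemma isHomogeneous_pairForm (r : Fin 3) : (pairForm k r).IsHomogeneous 2 :=
  ((isHomogeneous_X k _).mul (isHomogeneous_X k _)).sub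
    ((isHomogeneous_X k _).mul (isHomogeneous_X k _))

/-- The three pairings together with the identity form a Klein four-group, so 0 and its partners
under r, r + 1, r + 2 exhaust the indices. Such coordinates handle all r at once. -/
lemma isChart_skew : ∀ r : Fin 3,
    IsChart (Sum.inl r) 0 (partner (r + 1) 0) (partner r 0) (partner (r + 2) 0) := by decide

/-- The quartic, in coordinates adapted to a pair of skew coordinate lines. -/
lemma exists_eval_kummerQuartic_eq {a b c : k} (ha : a ≠ 0) (hb : b ≠ 0) (hc : c ≠ 0)
    (r : Fin 3) : ∃ e f g : k, e ≠ 0 ∧ ∀ v : Fin 4 → k, eval v (kummerQuartic a b c) =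
      e * (v 0 ^ 2 * v (partner r 0) ^ 2 + v (partner (r + 1) 0) ^ 2 * v (partner (r + 2) 0) ^ 2)
      + f * (v 0 ^ 2 * v (partner (r + 1) 0) ^ 2 + v (partner r 0) ^ 2 * v (partner (r + 2) 0) ^ 2)
      + g * (v 0 ^ 2 * v (partner (r + 2) 0) ^ 2 + v (partner r 0) ^ 2 * v (partner (r + 1) 0) ^ 2)
      + v 0 * v (partner r 0) * v (partner (r + 1) 0) * v (partner (r + 2) 0) := by
  simp only [eval_kummerQuartic]
  fin_cases r
  · refine ⟨a, b, c, ha, fun v => ?_⟩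
    change _ = a * (v 0 ^ 2 * v 1 ^ 2 + v 2 ^ 2 * v 3 ^ 2)
      + b * (v 0 ^ 2 * v 2 ^ 2 + v 1 ^ 2 * v 3 ^ 2) + c * (v 0 ^ 2 * v 3 ^ 2 + v 1 ^ 2 * v 2 ^ 2)
      + v 0 * v 1 * v 2 * v 3
    ring
  · refine ⟨b, c, a, hb, fun v => ?_⟩
    change _ = b * (v 0 ^ 2 * v 2 ^ 2 + v 3 ^ 2 * v 1 ^ 2)
      + c * (v 0 ^ 2 * v 3 ^ 2 + v 2 ^ 2 * v 1 ^ 2) + a * (v 0 ^ 2 * v 1 ^ 2 + v 2 ^ 2 * v 3 ^ 2)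
      + v 0 * v 2 * v 3 * v 1
    ring
  · refine ⟨c, a, b, hc, fun v => ?_⟩
    change _ = c * (v 0 ^ 2 * v 3 ^ 2 + v 1 ^ 2 * v 2 ^ 2)
      + a * (v 0 ^ 2 * v 1 ^ 2 + v 3 ^ 2 * v 2 ^ 2) + b * (v 0 ^ 2 * v 2 ^ 2 + v 3 ^ 2 * v 1 ^ 2)
      + v 0 * v 3 * v 1 * v 2
    ring

/-- Each pair of coordinates is multiplied by the product of the other pair. The map thus moves a
point along the ray of the r-th congruence through it. -/
lemma cremonaVec_eq (r : Fin 3) (v : Fin 4 → k) :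
    cremonaVec r v 0 = v (partner (r + 1) 0) * v (partner (r + 2) 0) * v 0 ∧
    cremonaVec r v (partner r 0) = v (partner (r + 1) 0) * v (partner (r + 2) 0) * v (partner r 0) ∧
    cremonaVec r v (partner (r + 1) 0) = v 0 * v (partner r 0) * v (partner (r + 1) 0) ∧
    cremonaVec r v (partner (r + 2) 0) = v 0 * v (partner r 0) * v (partner (r + 2) 0) := by
  fin_cases r
  · change v 0 * v 2 * v 3 = v 2 * v 3 * v 0 ∧ v 1 * v 3 * v 2 = v 2 * v 3 * v 1 ∧
      v 2 * v 0 * v 1 = v 0 * v 1 * v 2 ∧ v 3 * v 1 * v 0 = v 0 * v 1 * v 3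
    refine ⟨?_, ?_, ?_, ?_⟩ <;> ring
  · change v 0 * v 3 * v 1 = v 3 * v 1 * v 0 ∧ v 2 * v 1 * v 3 = v 3 * v 1 * v 2 ∧
      v 3 * v 0 * v 2 = v 0 * v 2 * v 3 ∧ v 1 * v 2 * v 0 = v 0 * v 2 * v 1
    refine ⟨?_, ?_, ?_, ?_⟩ <;> ring
  · change v 0 * v 1 * v 2 = v 1 * v 2 * v 0 ∧ v 3 * v 2 * v 1 = v 1 * v 2 * v 3 ∧
      v 1 * v 0 * v 3 = v 0 * v 3 * v 1 ∧ v 2 * v 3 * v 0 = v 0 * v 3 * v 2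
    refine ⟨?_, ?_, ?_, ?_⟩ <;> ring

lemma ext_skew {K : Type*} (r : Fin 3) {v w : Fin 4 → K} (h0 : v 0 = w 0)
    (hp : v (partner r 0) = w (partner r 0))
    (hj : v (partner (r + 1) 0) = w (partner (r + 1) 0))
    (hq : v (partner (r + 2) 0) = w (partner (r + 2) 0)) : v = w := by
  ext m
  rcases IsChart.exhaust _ _ _ _ _ (isChart_skew r) m with rfl | rfl | rfl | rfl <;> assumption

lemma cremonaVec_smul (r : Fin 3) (s : k) (v : Fin 4 → k) :
    cremonaVec r (s • v) = s ^ 3 • cremonaVec r v := by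
  ext i
  simp only [cremonaVec, Pi.smul_apply, smul_eq_mul]
  ring

lemma cremonaVec_cremonaVec (r : Fin 3) (v : Fin 4 → k) :
    cremonaVec r (cremonaVec r v) =
      (v 0 * v (partner r 0) * v (partner (r + 1) 0) * v (partner (r + 2) 0)) ^ 2 • v := by
  obtain ⟨h0, hp, hj, hq⟩ := cremonaVec_eq r v
  obtain ⟨h0', hp', hj', hq'⟩ := cremonaVec_eq r (cremonaVec r v)
  refine ext_skew r ?_ ?_ ?_ ?_
  · rw [h0', h0, hj, hq, Pi.smul_apply, smul_eq_mul]; ring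
  · rw [hp', hp, hj, hq, Pi.smul_apply, smul_eq_mul]; ring
  · rw [hj', h0, hp, hj, Pi.smul_apply, smul_eq_mul]; ring
  · rw [hq', h0, hp, hq, Pi.smul_apply, smul_eq_mul]; ring

lemma cremonaVec_ne_zero (r : Fin 3) {v : Fin 4 → k} (h : ∀ i, v i ≠ 0) : cremonaVec r v ≠ 0 :=
  fun h0 => mul_ne_zero (mul_ne_zero (h _) (h _)) (h _) (congrFun h0 0)

section Sends

lemma mem_submodule_iff {P : P3 k} {v : Fin 4 → k} : v ∈ P.submodule ↔ ∃ s : k, s • P.rep = v := by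
  rw [Projectivization.submodule_eq, Submodule.mem_span_singleton]

lemma rep_mem_submodule (P : P3 k) : P.rep ∈ P.submodule := mem_submodule_iff.2 ⟨1, one_smul _ _⟩

lemma eq_of_mem_submodule {P Q : P3 k} {v : Fin 4 → k} (hv : v ≠ 0) (hP : v ∈ P.submodule)
    (hQ : v ∈ Q.submodule) : P = Q := by
  apply Projectivization.submodule_injective
  have h : ∀ R : P3 k, v ∈ R.submodule → R.submodule = Submodule.span k {v} := by
    intro R hR
    refine (Submodule.eq_of_le_of_finrank_eq ?_ ?_).symm
    · rwa [Submodule.span_singleton_le_iff_mem]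
    · rw [finrank_span_singleton hv, Projectivization.finrank_submodule]
  rw [h P hP, h Q hQ]

lemma Sends.unique {Φ : Fin 4 → MvPolynomial (Fin 4) k} {P Q Q' : P3 k} (h : Sends Φ P Q)
    (h' : Sends Φ P Q') : Q = Q' := eq_of_mem_submodule h.1 h.2 h'.2

lemma exists_line_of_ne {P Q : P3 k} (h : P ≠ Q) :
    ∃ l : Line k, l.space = P.submodule ⊔ Q.submodule ∧
      l.space = Submodule.span k {P.rep, Q.rep} := by
  have hp : plucker P.rep Q.rep ≠ 0 := by
    rw [plucker_ne_zero_iff, LinearIndependent.pair_iff]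
    intro s t hst
    by_cases ht : t = 0
    · subst ht
      simp only [zero_smul, add_zero, smul_eq_zero, P.rep_nonzero, or_false] at hst
      exact ⟨hst, rfl⟩
    · refine (h (eq_of_mem_submodule Q.rep_nonzero (mem_submodule_iff.2 ⟨-s / t, ?_⟩)
        (rep_mem_submodule Q))).elim
      have : t • Q.rep = -s • P.rep := by
        rw [neg_smul, eq_neg_iff_add_eq_zero, add_comm, hst]
      rw [div_eq_inv_mul, mul_smul, ← this, inv_smul_smul₀ ht]
  refine ⟨Line.ofPair _ _ hp, ?_, rfl⟩
  change Submodule.span k {P.rep, Q.rep} = _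
  rw [Submodule.span_insert, Projectivization.submodule_eq, Projectivization.submodule_eq]

end Sends

lemma sends_cremona_iff {r : Fin 3} {P Q : P3 k} :
    Sends (cremona k r) P Q ↔ cremonaVec r P.rep ≠ 0 ∧ cremonaVec r P.rep ∈ Q.submodule := by
  unfold Sends
  rw [eval_cremona]

lemma eval_pairForm (r : Fin 3) (v : Fin 4 → k) : eval v (pairForm k r) =
    v 0 * v (partner r 0) - v (partner (r + 1) 0) * v (partner (r + 2) 0) := by
  simp [pairForm]

/-- The line through a point and its image belongs to the congruence. -/
lemma mem_component_of_sends {r : Fin 3} {P Q : P3 k} (h : Sends (cremona k r) P Q) {l : Line k}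
    (hl : l.space = P.submodule ⊔ Q.submodule) : l ∈ component k (Sum.inl r) := by
  rw [sends_cremona_iff] at h
  obtain ⟨s, hs⟩ := mem_submodule_iff.1 h.2
  have hs0 : s ≠ 0 := by
    rintro rfl
    exact h.1 (by rw [← hs, zero_smul])
  have hspan : l.space = Submodule.span k {P.rep, cremonaVec r P.rep} := by
    rw [hl, Submodule.span_insert, Projectivization.submodule_eq, Projectivization.submodule_eq,
      ← hs, Submodule.span_singleton_smul_eq (isUnit_iff_ne_zero.2 hs0)]
  rw [mem_component_iff]
  intro i j hij
  rw [Line.coord_eq_zero_iff hspan]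
  rcases hij with rfl | rfl
  · simp [plucker, mul_comm]
  · simp only [plucker, cremonaVec]
    generalize P.rep = v
    fin_cases r <;> fin_cases i
    · change v 0 * (v 1 * v 3 * v 2) - v 1 * (v 0 * v 2 * v 3) = 0; ring
    · change v 1 * (v 0 * v 2 * v 3) - v 0 * (v 1 * v 3 * v 2) = 0; ring
    · change v 2 * (v 3 * v 1 * v 0) - v 3 * (v 2 * v 0 * v 1) = 0; ring
    · change v 3 * (v 2 * v 0 * v 1) - v 2 * (v 3 * v 1 * v 0) = 0; ring
    · change v 0 * (v 2 * v 1 * v 3) - v 2 * (v 0 * v 3 * v 1) = 0; ring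
    · change v 1 * (v 3 * v 0 * v 2) - v 3 * (v 1 * v 2 * v 0) = 0; ring
    · change v 2 * (v 0 * v 3 * v 1) - v 0 * (v 2 * v 1 * v 3) = 0; ring
    · change v 3 * (v 1 * v 2 * v 0) - v 1 * (v 3 * v 0 * v 2) = 0; ring
    · change v 0 * (v 3 * v 2 * v 1) - v 3 * (v 0 * v 1 * v 2) = 0; ring
    · change v 1 * (v 2 * v 3 * v 0) - v 2 * (v 1 * v 0 * v 3) = 0; ring
    · change v 2 * (v 1 * v 0 * v 3) - v 1 * (v 2 * v 3 * v 0) = 0; ring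
    · change v 3 * (v 0 * v 1 * v 2) - v 0 * (v 3 * v 2 * v 1) = 0; ring

/-- A line of the congruence, in adapted coordinates. -/
lemma exists_skew_basis {r : Fin 3} {l : Line k} (hl : l ∈ component k (Sum.inl r)) :
    ∃ u v : Fin 4 → k, l.space = Submodule.span k {u, v} ∧ u (partner (r + 1) 0) = 0 ∧
      u (partner (r + 2) 0) = 0 ∧ v 0 = 0 ∧ v (partner r 0) = 0 := by
  obtain ⟨i, j, p, q, hc, h0⟩ := exists_chart hl
  have h1 := fun m => chartVec_supportFst hc (l.coord (p, j) / l.coord (i, j)) m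
  have h2 := fun m => chartVec_supportSnd hc (l.coord (i, q) / l.coord (i, j)) m
  rw [← vecFst_eq_chartVec hc hl h0] at h1
  rw [← vecSnd_eq_chartVec hc hl h0] at h2
  have hs : ∀ r : Fin 3, ¬ supportFst (Sum.inl r) (partner (r + 1) 0) ∧
      ¬ supportFst (Sum.inl r) (partner (r + 2) 0) ∧ ¬ supportSnd (Sum.inl r) 0 ∧
      ¬ supportSnd (Sum.inl r) (partner r 0) := by decide
  obtain ⟨s1, s2, s3, s4⟩ := hs r
  exact ⟨_, _, Line.space_eq_span_vec h0, h1 _ s1, h1 _ s2, h2 _ s3, h2 _ s4⟩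

section Quartic

variable {a b c : k}

/-- With A and B the products over the two pairs, A becomes AB² and B becomes A²B. So A² + B² and AB
are multiplied by (AB)², and so are the terms that mix the pairs. -/
lemma eval_cremonaVec_kummerQuartic (ha : a ≠ 0) (hb : b ≠ 0) (hc : c ≠ 0) (r : Fin 3)
    (v : Fin 4 → k) : eval (cremonaVec r v) (kummerQuartic a b c) =
      (v 0 * v (partner r 0) * v (partner (r + 1) 0) * v (partner (r + 2) 0)) ^ 2 *
        eval v (kummerQuartic a b c) := by
  obtain ⟨e, f, g, -, hF⟩ := exists_eval_kummerQuartic_eq ha hb hc r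
  obtain ⟨h0, hp, hj, hq⟩ := cremonaVec_eq r v
  rw [hF, hF, h0, hp, hj, hq]
  ring

/-- A line of the congruence through a point `P` of the surface meets the surface only in `P` and
the image of `P`. -/
lemma eq_or_sends_of_mem_component [CharP k 2] (ha : a ≠ 0) (hb : b ≠ 0) (hc : c ≠ 0)
    {r : Fin 3} {P Q : P3 k} (hP : P ∈ zeros (kummerQuartic a b c)) (hPt : P ∈ torus k)
    (hQ : Q ∈ zeros (kummerQuartic a b c)) {l : Line k} (hl : l ∈ component k (Sum.inl r))
    (hPl : P.rep ∈ l.space) (hQl : Q.rep ∈ l.space) : Q = P ∨ Sends (cremona k r) P Q := by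
  have htwo : (2 : k) = 0 := CharTwo.two_eq_zero
  obtain ⟨e, f, g, he, hF⟩ := exists_eval_kummerQuartic_eq ha hb hc r
  obtain ⟨u, v, hspan, huj, huq, hv0, hvp⟩ := exists_skew_basis hl
  rw [hspan, Submodule.mem_span_pair] at hPl hQl
  obtain ⟨s, t, hst⟩ := hPl
  obtain ⟨s', t', hst'⟩ := hQl
  have hP0 := hPt 0
  have hPp := hPt (partner r 0)
  have hPj := hPt (partner (r + 1) 0)
  have hPq := hPt (partner (r + 2) 0)
  have p0 : P.rep 0 = s * u 0 := by simp [← hst, hv0]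
  have pp : P.rep (partner r 0) = s * u (partner r 0) := by simp [← hst, hvp]
  have pj : P.rep (partner (r + 1) 0) = t * v (partner (r + 1) 0) := by simp [← hst, huj]
  have pq : P.rep (partner (r + 2) 0) = t * v (partner (r + 2) 0) := by simp [← hst, huq]
  have q0 : Q.rep 0 = s' * u 0 := by simp [← hst', hv0]
  have qp : Q.rep (partner r 0) = s' * u (partner r 0) := by simp [← hst', hvp]
  have qj : Q.rep (partner (r + 1) 0) = t' * v (partner (r + 1) 0) := by simp [← hst', huj]
  have qq : Q.rep (partner (r + 2) 0) = t' * v (partner (r + 2) 0) := by simp [← hst', huq]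
  have hPF : eval P.rep (kummerQuartic a b c) = 0 := hP
  have hQF : eval Q.rep (kummerQuartic a b c) = 0 := hQ
  rw [hF, p0, pp, pj, pq] at hPF
  rw [hF, q0, qp, qj, qq] at hQF
  rw [p0] at hP0
  rw [pp] at hPp
  rw [pj] at hPj
  rw [pq] at hPq
  obtain ⟨hs, hu0⟩ := mul_ne_zero_iff.1 hP0
  obtain ⟨-, hup⟩ := mul_ne_zero_iff.1 hPp
  obtain ⟨ht, hvj⟩ := mul_ne_zero_iff.1 hPj
  obtain ⟨-, hvq⟩ := mul_ne_zero_iff.1 hPq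
  -- With A = u₀uₚ and B = vⱼv_q the quartic on the line is e(A²s⁴ + B²t⁴) + M s²t². Eliminating M
  -- between the equations of P and Q leaves this product in characteristic two. The first factor
  -- gives Q = P, the second that Q is the Cremona image.
  have hfac : e * (s * t' - s' * t) ^ 2 *
      (s * s' * u 0 * u (partner r 0) -
        t * t' * v (partner (r + 1) 0) * v (partner (r + 2) 0)) ^ 2 = 0 := by
    linear_combination (s * t) ^ 2 * hQF - (s' * t') ^ 2 * hPF
      + (-(e * s * t' * s' ^ 3 * t ^ 3 * u 0 * u (partner r 0) * v (partner (r + 1) 0)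
            * v (partner (r + 2) 0))
          - e * s * t' ^ 3 * s' * t ^ 3 * v (partner (r + 1) 0) ^ 2 * v (partner (r + 2) 0) ^ 2
          + e * s ^ 2 * t' ^ 2 * s' ^ 2 * t ^ 2 * u 0 * u (partner r 0) * v (partner (r + 1) 0)
            * v (partner (r + 2) 0) * 2
          - e * s ^ 3 * t' * s' ^ 3 * t * u 0 ^ 2 * u (partner r 0) ^ 2
          - e * s ^ 3 * t' ^ 3 * s' * t * u 0 * u (partner r 0) * v (partner (r + 1) 0)
            * v (partner (r + 2) 0)
          + e * s ^ 4 * t' ^ 2 * s' ^ 2 * u 0 ^ 2 * u (partner r 0) ^ 2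
          + e * t' ^ 2 * s' ^ 2 * t ^ 4 * v (partner (r + 1) 0) ^ 2 * v (partner (r + 2) 0) ^ 2)
        * htwo
  rcases mul_eq_zero.1 hfac with h | h
  · left
    have h1 : s * t' - s' * t = 0 := by
      have := (mul_eq_zero.1 h).resolve_left he
      exact pow_eq_zero_iff (two_ne_zero) |>.1 this
    refine (eq_of_mem_submodule P.rep_nonzero (rep_mem_submodule P)
      (mem_submodule_iff.2 ⟨s / s', ?_⟩)).symm
    have hs' : s' ≠ 0 := by
      rintro rfl
      have ht' : t' = 0 := by simpa [hs] using h1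
      exact Q.rep_nonzero (by rw [← hst', ht']; simp)
    rw [← hst, ← hst', smul_add, smul_smul, smul_smul, div_mul_cancel₀ _ hs']
    congr 2
    field_simp
    linear_combination h1
  · right
    have h1 : s * s' * u 0 * u (partner r 0) -
        t * t' * v (partner (r + 1) 0) * v (partner (r + 2) 0) = 0 :=
      pow_eq_zero_iff (two_ne_zero) |>.1 h
    rw [sends_cremona_iff]
    have hne := cremonaVec_ne_zero r hPt
    refine ⟨hne, mem_submodule_iff.2 ?_⟩
    have hs' : s' ≠ 0 := by
      rintro rfl
      have ht' : t' = 0 := by simpa [ht, hvj, hvq] using h1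
      exact Q.rep_nonzero (by rw [← hst', ht']; simp)
    obtain ⟨h0, hp, hj, hq⟩ := cremonaVec_eq r P.rep
    refine ⟨t ^ 2 * v (partner (r + 1) 0) * v (partner (r + 2) 0) * s / s', ext_skew r ?_ ?_ ?_ ?_⟩
    · rw [h0, Pi.smul_apply, smul_eq_mul, p0, pj, pq, q0]
      field_simp
    · rw [hp, Pi.smul_apply, smul_eq_mul, pp, pj, pq, qp]
      field_simp
    · rw [hj, Pi.smul_apply, smul_eq_mul, p0, pp, pj, qj]
      field_simp
      linear_combination -h1
    · rw [hq, Pi.smul_apply, smul_eq_mul, p0, pp, pq, qq]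
      field_simp
      linear_combination -h1

end Quartic

end Involutions

section Involutions

variable {k : Type*} [Field k]

lemma pairForm_ne_zero (r : Fin 3) : pairForm k r ≠ 0 := by
  intro h0
  have hp : ∀ r : Fin 3, partner r 0 ≠ 0 ∧ partner (r + 1) 0 ≠ 0 ∧
      partner (r + 1) 0 ≠ partner r 0 := by decide
  have h1 := eval_pairForm r (Pi.single 0 1 + Pi.single (partner r 0) 1 : Fin 4 → k)
  rw [h0] at h1
  simp [(hp r).1, (hp r).2.1, (hp r).2.2, (hp r).1.symm] at h1

variable [IsAlgClosed k] [CharP k 2] {a b c : k}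

/-- A non-empty open subset of the surface is dense. -/
lemma zeros_subset_closure_inter (ha : a ≠ 0) (hb : b ≠ 0) (hc : c ≠ 0)
    {U : Set (P3 k)} (hU : IsOpen U) (hne : (zeros (kummerQuartic a b c) ∩ U).Nonempty) :
    zeros (kummerQuartic a b c) ⊆ closure (zeros (kummerQuartic a b c) ∩ U) :=
  subset_closure_inter_of_isPreirreducible_of_isOpen
    (isIrreducible_zeros_kummerQuartic ha hb hc).isPreirreducible hU hne

lemma zeros_inter_compl_zeros_nonempty (ha : a ≠ 0) (hb : b ≠ 0) (hc : c ≠ 0) {d : ℕ}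
    {G : MvPolynomial (Fin 4) k} (hG : G.IsHomogeneous d) (h : ¬ kummerQuartic a b c ∣ G) :
    (zeros (kummerQuartic a b c) ∩ (zeros G)ᶜ).Nonempty := by
  by_contra hne
  apply h
  refine kummerQuartic_dvd_of_zeros_subset ha hb hc hG fun P hP => ?_
  by_contra hPG
  exact hne ⟨P, hP, hPG⟩

lemma zeros_inter_torus_nonempty (ha : a ≠ 0) (hb : b ≠ 0) (hc : c ≠ 0) :
    (zeros (kummerQuartic a b c) ∩ torus k).Nonempty := by
  rw [torus_eq]
  refine zeros_inter_compl_zeros_nonempty ha hb hc isHomogeneous_prod_X fun h => ?_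
  have hF := (irreducible_kummerQuartic ha hb hc).prime
  have hX : ∀ i : Fin 4, ¬ kummerQuartic a b c ∣ X i := fun i =>
    not_kummerQuartic_dvd ha hb hc (X_ne_zero i) (by rw [totalDegree_X]; norm_num)
  rcases hF.dvd_or_dvd h with h | h
  · rcases hF.dvd_or_dvd h with h | h
    · rcases hF.dvd_or_dvd h with h | h
      exacts [hX _ h, hX _ h]
    · exact hX _ h
  · exact hX _ h

/-- The open set on which the Cremona involution is well behaved. -/
def goodSet (k : Type*) [Field k] (r : Fin 3) : Set (P3 k) := torus k ∩ (zeros (pairForm k r))ᶜ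

lemma isOpen_goodSet {k : Type*} [Field k] (r : Fin 3) : IsOpen (goodSet k r) :=
  isOpen_torus.inter (isOpen_compl_zeros (isHomogeneous_pairForm r))

lemma zeros_subset_closure_inter_goodSet (ha : a ≠ 0) (hb : b ≠ 0) (hc : c ≠ 0) (r : Fin 3) :
    zeros (kummerQuartic a b c) ⊆ closure (zeros (kummerQuartic a b c) ∩ goodSet k r) := by
  refine zeros_subset_closure_inter ha hb hc (isOpen_goodSet r) ?_
  refine (isIrreducible_zeros_kummerQuartic ha hb hc).isPreirreducible _ _ isOpen_torus
    (isOpen_compl_zeros (isHomogeneous_pairForm r)) (zeros_inter_torus_nonempty ha hb hc)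
    (zeros_inter_compl_zeros_nonempty ha hb hc (isHomogeneous_pairForm r)
      (not_kummerQuartic_dvd ha hb hc (pairForm_ne_zero r) ?_))
  rw [(isHomogeneous_pairForm r).totalDegree (pairForm_ne_zero r)]
  norm_num

/-- The image of a general point of the surface under the Cremona involution. -/
lemma exists_sends_cremona {k : Type*} [Field k] {a b c : k} (ha : a ≠ 0) (hb : b ≠ 0) (hc : c ≠ 0)
    {r : Fin 3} {P : P3 k}
    (hP : P ∈ zeros (kummerQuartic a b c)) (hPg : P ∈ goodSet k r) :
    ∃ Q ∈ zeros (kummerQuartic a b c), Sends (cremona k r) P Q ∧ Sends (cremona k r) Q P ∧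
      Q ≠ P := by
  obtain ⟨hPt, hPd⟩ := hPg
  have hne := cremonaVec_ne_zero r hPt
  obtain ⟨s, hs, hrep⟩ := exists_mk_rep _ hne
  set Q : P3 k := Projectivization.mk k _ hne with hQ
  have hprod : P.rep 0 * P.rep (partner r 0) * P.rep (partner (r + 1) 0) *
      P.rep (partner (r + 2) 0) ≠ 0 :=
    mul_ne_zero (mul_ne_zero (mul_ne_zero (hPt _) (hPt _)) (hPt _)) (hPt _)
  have hPQ : Sends (cremona k r) P Q := sends_cremona_iff.2 ⟨hne, mem_submodule_iff.2 ⟨s, hrep.symm⟩⟩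
  refine ⟨Q, ?_, hPQ, ?_, ?_⟩
  · rw [hQ, mk_mem_zeros_iff (isHomogeneous_kummerQuartic a b c),
      eval_cremonaVec_kummerQuartic ha hb hc, show eval P.rep (kummerQuartic a b c) = 0 from hP,
      mul_zero]
  · have h1 : Q.rep = s⁻¹ • cremonaVec r P.rep := by rw [hrep, inv_smul_smul₀ hs]
    have h2 : cremonaVec r Q.rep = ((s⁻¹) ^ 3 * (P.rep 0 * P.rep (partner r 0) *
        P.rep (partner (r + 1) 0) * P.rep (partner (r + 2) 0)) ^ 2) • P.rep := by
      rw [h1, cremonaVec_smul, cremonaVec_cremonaVec, smul_smul]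
    rw [sends_cremona_iff, h2]
    exact ⟨smul_ne_zero (mul_ne_zero (pow_ne_zero _ (inv_ne_zero hs)) (pow_ne_zero _ hprod))
      P.rep_nonzero, Submodule.smul_mem _ _ (rep_mem_submodule P)⟩
  -- At a fixed point the scaling factors of the two pairs would agree, that is, `pairForm` would
  -- vanish.
  · intro hQP
    rw [sends_cremona_iff, hQP] at hPQ
    obtain ⟨e, he⟩ := mem_submodule_iff.1 hPQ.2
    obtain ⟨h0, -, hj, -⟩ := cremonaVec_eq r P.rep
    rw [← he, Pi.smul_apply, smul_eq_mul] at h0 hj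
    apply hPd
    change eval P.rep (pairForm k r) = 0
    rw [eval_pairForm, ← mul_right_cancel₀ (hPt _) h0, ← mul_right_cancel₀ (hPt _) hj, sub_self]

/-- The line determines the orbit because, by `eq_or_sends_of_mem_component`, it meets the surface
only in P and its image. -/
lemma isBitangentInvolution_cremona (ha : a ≠ 0) (hb : b ≠ 0) (hc : c ≠ 0) (r : Fin 3) :
    IsBitangentInvolution (kummerQuartic a b c) (cremona k r) := by
  have hdense := zeros_subset_closure_inter_goodSet ha hb hc r
  refine ⟨⟨⟨3, isHomogeneous_cremona r⟩, goodSet k r, isOpen_goodSet r, hdense, fun P hP =>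
    exists_sends_cremona ha hb hc hP.1 hP.2⟩, ⟨goodSet k r, isOpen_goodSet r, hdense,
    fun P hP Q hQ l hl => ?_⟩, goodSet k r, isOpen_goodSet r, hdense, ?_⟩
  · rw [Bit_kummerQuartic]
    exact Set.mem_iUnion.2 ⟨_, mem_component_of_sends hQ hl⟩
  · intro P hP P' hP' Q Q' hQ hQ' heq
    obtain ⟨R, -, hR, -, hne⟩ := exists_sends_cremona ha hb hc hP.1 hP.2
    obtain rfl := hQ.unique hR
    obtain ⟨l, hl, -⟩ := exists_line_of_ne hne.symm
    have hPl : P.rep ∈ l.space := by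
      rw [hl]
      exact Submodule.mem_sup_left (rep_mem_submodule P)
    have hPl' : P'.rep ∈ l.space := by
      rw [hl, heq]
      exact Submodule.mem_sup_left (rep_mem_submodule P')
    rcases eq_or_sends_of_mem_component ha hb hc hP.1 hP.2.1 hP'.1 (mem_component_of_sends hQ hl)
      hPl hPl' with h | h
    · exact Or.inl h
    · exact Or.inr (h.unique hQ)

/-- For the harder inclusion, a general line of the congruence contains a point P of the surface in
`goodSet`. The line joining P to its image is the unique ray through P, hence equal to the given
line. -/
lemma orbitCongruence_cremona (ha : a ≠ 0) (hb : b ≠ 0) (hc : c ≠ 0) (r : Fin 3) :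
    orbitCongruence (zeros (kummerQuartic a b c)) (cremona k r) = component k (Sum.inl r) := by
  refine Set.Subset.antisymm ?_ ?_
  · refine (isClosed_component _).closure_subset_iff.2 ?_
    rintro l ⟨P, -, Q, -, hQ, -, hl⟩
    exact mem_component_of_sends hQ hl
  obtain ⟨e, f, g, he, hF⟩ := exists_eval_kummerQuartic_eq ha hb hc r
  have hch := isChart_skew r
  set p := partner r 0 with hp
  set j := partner (r + 1) 0 with hj
  set q := partner (r + 2) 0 with hq
  have htwo : (2 : k) = 0 := CharTwo.two_eq_zero
  have hpq : p ≠ q := IsChart.fst_ne_snd _ _ _ _ _ hch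
  -- On the line with chart coordinates α, δ the quartic at x(e₀ + α eₚ) + eⱼ + δ e_q is eα²x⁴ + Bx²
  -- + eδ². Here G₁ and G₂ are, up to non-zero factors, αδ and B.
  let G₁ : MvPolynomial (Fin 4 × Fin 4) k := X (p, j) * X (0, q)
  let G₂ : MvPolynomial (Fin 4 × Fin 4) k :=
    C f * (X (0, j) ^ 2 + X (p, q) ^ 2) + C g * (X (0, q) ^ 2 + X (p, j) ^ 2)
      + X (0, j) * X (p, q)
  have hG₁ : G₁.IsHomogeneous 2 := (isHomogeneous_X k _).mul (isHomogeneous_X k _)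
  have hG₂ : G₂.IsHomogeneous 2 := by
    have hX : ∀ x : Fin 4 × Fin 4, (X x ^ 2 : MvPolynomial (Fin 4 × Fin 4) k).IsHomogeneous 2 :=
      fun x => (isHomogeneous_X k x).pow 2
    have hC : ∀ (e : k) {G : MvPolynomial (Fin 4 × Fin 4) k}, G.IsHomogeneous 2 →
        (C e * G).IsHomogeneous 2 := fun e G hG => by
      simpa using (isHomogeneous_C (Fin 4 × Fin 4) e).mul hG
    exact ((hC f ((hX _).add (hX _))).add (hC g ((hX _).add (hX _)))).add
      ((isHomogeneous_X k _).mul (isHomogeneous_X k _))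
  have hG : (X (0, j) * G₁ * G₂ : MvPolynomial (Fin 4 × Fin 4) k).IsHomogeneous (1 + 2 + 2) :=
    ((isHomogeneous_X k _).mul hG₁).mul hG₂
  have hval : ∀ α δ : k, ∃ s : k, s ≠ 0 ∧
      (chartLine hch α δ).coord (0, j) = s ∧ (chartLine hch α δ).coord (p, j) = s * α ∧
      (chartLine hch α δ).coord (0, q) = s * δ ∧ (chartLine hch α δ).coord (p, q) = s * (α * δ) := by
    intro α δ
    obtain ⟨s, hs, hsc⟩ := Line.plucker_eq_smul_coord (l := chartLine hch α δ) rfl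
    have hc' : (chartLine hch α δ).coord = s⁻¹ • plucker (chartVec 0 p α) (chartVec j q δ) := by
      rw [hsc, inv_smul_smul₀ hs]
    have hpqv : plucker (chartVec 0 p α) (chartVec j q δ) (p, q) = α * δ := by
      simp [plucker, chartVec, hch.2.1, hch.2.2.1, hpq, hpq.symm, hch.2.2.2.1, hch.2.2.2.2.1]
    refine ⟨s⁻¹, inv_ne_zero hs, ?_, ?_, ?_, ?_⟩
    · rw [hc', Pi.smul_apply, plucker_chart_base hch, smul_eq_mul, mul_one]
    · rw [hc', Pi.smul_apply, plucker_chart_fst hch, smul_eq_mul]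
    · rw [hc', Pi.smul_apply, plucker_chart_snd hch, smul_eq_mul]
    · rw [hc', Pi.smul_apply, hpqv, smul_eq_mul]
  have hdense := subset_closure_inter_of_isPreirreducible_of_isOpen
    (isIrreducible_component (k := k) (Sum.inl r)).isPreirreducible (homZariski_line.isOpen_ne hG) (by
      refine ⟨chartLine hch 1 1, chartLine_mem hch 1 1, ?_⟩
      obtain ⟨s, hs, h1, h2, h3, h4⟩ := hval 1 1
      -- For α = δ = 1 one has B = 2f + 2g + 1 = 1.
      have : eval (chartLine hch 1 1).coord (X (0, j) * G₁ * G₂) = s ^ 5 := by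
        simp only [G₁, G₂, map_mul, map_add, map_pow, eval_X, eval_C, h1, h2, h3, h4]
        linear_combination (f * s ^ 5 + g * s ^ 5) * htwo
      change eval _ _ ≠ 0
      rw [this]
      exact pow_ne_zero _ hs)
  refine hdense.trans (closure_mono ?_)
  rintro l ⟨hl, hlG⟩
  have hlG' : eval l.coord (X (0, j) * G₁ * G₂) ≠ 0 := hlG
  rw [map_mul, map_mul, eval_X] at hlG'
  obtain ⟨h12, h3⟩ := mul_ne_zero_iff.1 hlG'
  obtain ⟨h0, h1⟩ := mul_ne_zero_iff.1 h12
  have hlc := eq_chartLine hch _ _ hl h0 rfl rfl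
  generalize l.coord (p, j) / l.coord (0, j) = α at hlc
  generalize l.coord (0, q) / l.coord (0, j) = δ at hlc
  subst hlc
  obtain ⟨s, hs, c1, c2, c3, c4⟩ := hval α δ
  simp only [G₁, G₂, map_mul, map_add, map_pow, eval_X, eval_C, c1, c2, c3, c4] at h1 h3
  have hα : α ≠ 0 := by
    rintro rfl
    simp at h1
  have hδ : δ ≠ 0 := by
    rintro rfl
    simp at h1
  have hB : f * (1 + (α * δ) ^ 2) + g * (δ ^ 2 + α ^ 2) + α * δ ≠ 0 := by
    intro hB
    apply h3
    linear_combination s ^ 2 * hB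
  set B := f * (1 + (α * δ) ^ 2) + g * (δ ^ 2 + α ^ 2) + α * δ with hBdef
  obtain ⟨S, hS⟩ := IsAlgClosed.exists_root
    (Polynomial.C (e * α ^ 2) * Polynomial.X ^ 2 + Polynomial.C B * Polynomial.X
      + Polynomial.C (e * δ ^ 2))
    (by rw [Polynomial.degree_quadratic (mul_ne_zero he (pow_ne_zero _ hα))]; decide)
  simp only [Polynomial.IsRoot, Polynomial.eval_add, Polynomial.eval_mul, Polynomial.eval_C,
    Polynomial.eval_pow, Polynomial.eval_X] at hS
  obtain ⟨x, hx⟩ := IsAlgClosed.exists_pow_nat_eq S (n := 2) (by norm_num)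
  have hx0 : x ≠ 0 := by
    rintro rfl
    rw [zero_pow two_ne_zero] at hx
    rw [← hx] at hS
    simp [he, hδ] at hS
  let v : Fin 4 → k := x • chartVec 0 p α + chartVec j q δ
  have v0 : v 0 = x := by
    simp [v, chartVec, hch.2.1.symm, hch.ne, hch.2.2.2.1.symm]
  have vp : v p = x * α := by
    simp [v, chartVec, hch.2.1, hch.2.2.1, hpq]
  have vj : v j = 1 := by
    simp [v, chartVec, hch.ne.symm, hch.2.2.1.symm, hch.2.2.2.2.1.symm]
  have vq : v q = δ := by
    simp [v, chartVec, hch.2.2.2.1, hch.2.2.2.2.1, hpq.symm]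
  have hvne : v ≠ 0 := fun h => hx0 (by rw [← v0, h]; rfl)
  have hvall : ∀ m, v m ≠ 0 := by
    intro m
    rcases IsChart.exhaust _ _ _ _ _ hch m with rfl | rfl | rfl | rfl
    · rwa [v0]
    · rw [vj]; exact one_ne_zero
    · rw [vp]; exact mul_ne_zero hx0 hα
    · rwa [vq]
  have hFv : eval v (kummerQuartic a b c) = 0 := by
    rw [hF, v0, vp, vj, vq]
    rw [← hx] at hS
    linear_combination hS
  set P : P3 k := Projectivization.mk k v hvne with hPdef
  have hPX : P ∈ zeros (kummerQuartic a b c) :=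
    (mk_mem_zeros_iff (isHomogeneous_kummerQuartic a b c) v hvne).2 hFv
  have hPg : P ∈ goodSet k r := by
    refine ⟨mk_mem_torus hvne hvall, fun h => ?_⟩
    rw [hPdef, mk_mem_zeros_iff (isHomogeneous_pairForm r), eval_pairForm, ← hp, ← hj, ← hq, v0, vp,
      vj, vq] at h
    -- If `pairForm` vanished at P, then αx² = δ (using vⱼ = 1), so the outer terms of the equation
    -- would cancel and leave Bx² = 0.
    apply mul_ne_zero hB (pow_ne_zero 2 hx0)
    rw [← hx] at hS
    linear_combination hS - (e * (x ^ 2 * α + δ)) * h - e * δ ^ 2 * htwo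
  obtain ⟨Q, hQX, hPQ, -, hne⟩ := exists_sends_cremona ha hb hc hPX hPg
  obtain ⟨t, ht, hrep⟩ := exists_mk_rep v hvne
  rw [← hPdef] at hrep
  have hPl : P.rep ∈ (chartLine hch α δ).space := by
    have : P.rep = t⁻¹ • v := by rw [hrep, inv_smul_smul₀ ht]
    rw [this]
    refine Submodule.smul_mem _ _ (add_mem (Submodule.smul_mem _ _ ?_) ?_)
    · exact Submodule.subset_span (by simp)
    · exact Submodule.subset_span (by simp)
  refine ⟨P, hPX, Q, hQX, hPQ, hne, ?_⟩
  obtain ⟨m, hm, -⟩ := exists_line_of_ne hne.symm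
  have hPm : P.submodule ≤ m.space := hm ▸ le_sup_left
  obtain ⟨n, hn, -⟩ := exists_raysThrough_component_eq r hPg.1
  have h1 : chartLine hch α δ ∈ raysThrough (component k (Sum.inl r)) P := by
    refine ⟨hl, ?_⟩
    rw [Projectivization.submodule_eq, Submodule.span_singleton_le_iff_mem]
    exact hPl
  have h2 : m ∈ raysThrough (component k (Sum.inl r)) P := ⟨mem_component_of_sends hPQ hm, hPm⟩
  rw [hn] at h1 h2
  rw [← hm, Set.mem_singleton_iff.1 h1, Set.mem_singleton_iff.1 h2]

/-- Every bitangent involution is one of the Cremona involutions. -/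
lemma exists_sameRationalMap_cremona (ha : a ≠ 0) (hb : b ≠ 0) (hc : c ≠ 0)
    {Ψ : Fin 4 → MvPolynomial (Fin 4) k} (hΨ : IsBitangentInvolution (kummerQuartic a b c) Ψ) :
    ∃ r, SameRationalMap (zeros (kummerQuartic a b c)) Ψ (cremona k r) := by
  obtain ⟨⟨⟨d, hd⟩, U₁, hU₁, hd₁, h₁⟩, ⟨U₂, hU₂, hd₂, h₂⟩, -⟩ := hΨ
  have hirr := isIrreducible_zeros_kummerQuartic ha hb hc
  have hne : ∀ U : Set (P3 k), zeros (kummerQuartic a b c) ⊆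
      closure (zeros (kummerQuartic a b c) ∩ U) → (zeros (kummerQuartic a b c) ∩ U).Nonempty :=
    fun U h => closure_nonempty_iff.1 (hirr.nonempty.mono h)
  have hn₁ : (zeros (kummerQuartic a b c) ∩ (U₁ ∩ torus k)).Nonempty :=
    hirr.isPreirreducible _ _ hU₁ isOpen_torus (hne _ hd₁) (zeros_inter_torus_nonempty ha hb hc)
  have hn₂ : (zeros (kummerQuartic a b c) ∩ (U₁ ∩ torus k ∩ U₂)).Nonempty :=
    hirr.isPreirreducible _ _ (hU₁.inter isOpen_torus) hU₂ hn₁ (hne _ hd₂)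
  -- Closed loci where Ψ is proportional to a given Cremona map. They cover a dense part of the
  -- irreducible surface, so one of them contains it.
  let Z : Fin 3 → Set (P3 k) := fun r =>
    ⋂ (i : Fin 4) (j : Fin 4), zeros (Ψ i * cremona k r j - Ψ j * cremona k r i)
  have hZ : ∀ r, IsClosed (Z r) := fun r => isClosed_iInter fun i => isClosed_iInter fun j =>
    isClosed_zeros (((hd i).mul (isHomogeneous_cremona r j)).sub
      ((hd j).mul (isHomogeneous_cremona r i)))
  have hmemZ : ∀ {r P}, P ∈ Z r ↔ ∀ i j, eval P.rep (Ψ i) * cremonaVec r P.rep j =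
      eval P.rep (Ψ j) * cremonaVec r P.rep i := by
    intro r P
    simp only [Z, Set.mem_iInter, zeros, Set.mem_ofPred_eq, map_sub, map_mul, sub_eq_zero,
      ← eval_cremona]
  -- The bitangent line joining P to its image lies in no β-plane because P is in the torus. On a
  -- ray of the r-th congruence the only other point of the surface is the Cremona image.
  have hcover : zeros (kummerQuartic a b c) ∩ (U₁ ∩ torus k ∩ U₂) ⊆ ⋃ r, Z r := by
    rintro P ⟨hP, ⟨hP1, hPt⟩, hP2⟩
    obtain ⟨Q, hQX, hPQ, -, hQP⟩ := h₁ P ⟨hP, hP1⟩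
    obtain ⟨l, hl, -⟩ := exists_line_of_ne hQP.symm
    have hbit := h₂ P ⟨hP, hP2⟩ Q hPQ l hl
    rw [Bit_kummerQuartic] at hbit
    have hPl : P.rep ∈ l.space := by
      rw [hl]
      exact Submodule.mem_sup_left (rep_mem_submodule P)
    have hQl : Q.rep ∈ l.space := by
      rw [hl]
      exact Submodule.mem_sup_right (rep_mem_submodule Q)
    obtain ⟨r | m, ht⟩ := Set.mem_iUnion.1 hbit
    · have hs := (eq_or_sends_of_mem_component ha hb hc hP hPt hQX ht hPl hQl).resolve_left hQP
      rw [sends_cremona_iff] at hs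
      obtain ⟨s, hs⟩ := mem_submodule_iff.1 hs.2
      obtain ⟨t, ht⟩ := mem_submodule_iff.1 hPQ.2
      refine Set.mem_iUnion.2 ⟨r, hmemZ.2 fun i j => ?_⟩
      have hti := congrFun ht i
      have htj := congrFun ht j
      simp only [Pi.smul_apply, smul_eq_mul] at hti htj
      rw [← hs, ← hti, ← htj, Pi.smul_apply, Pi.smul_apply, smul_eq_mul, smul_eq_mul]
      ring
    · exact (hPt m (mem_coordPlane.1 (ht hPl))).elim
  have hsub : zeros (kummerQuartic a b c) ⊆ ⋃ r, Z r :=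
    (zeros_subset_closure_inter ha hb hc ((hU₁.inter isOpen_torus).inter hU₂) hn₂).trans
      ((isClosed_iUnion_of_finite hZ).closure_subset_iff.2 hcover)
  obtain ⟨r, hr⟩ : ∃ r, zeros (kummerQuartic a b c) ⊆ Z r := by
    have := (isIrreducible_iff_sUnion_isClosed.1 hirr) (Set.finite_range Z).toFinset
      (by simpa using hZ) (by simpa using hsub)
    simpa using this
  refine ⟨r, U₁ ∩ torus k, hU₁.inter isOpen_torus,
    zeros_subset_closure_inter ha hb hc (hU₁.inter isOpen_torus) hn₁, ?_⟩
  rintro P ⟨hP, hP1, hPt⟩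
  obtain ⟨Q, -, hPQ, -, -⟩ := h₁ P ⟨hP, hP1⟩
  refine ⟨Q, hPQ, sends_cremona_iff.2 ⟨cremonaVec_ne_zero r hPt, ?_⟩⟩
  obtain ⟨i, hi⟩ := Function.ne_iff.1 hPQ.1
  have hi' : eval P.rep (Ψ i) ≠ 0 := hi
  have : cremonaVec r P.rep = (cremonaVec r P.rep i / eval P.rep (Ψ i)) •
      fun i => eval P.rep (Ψ i) := by
    ext j
    rw [Pi.smul_apply, smul_eq_mul, div_mul_eq_mul_div, eq_div_iff hi']
    linear_combination hmemZ.1 (hr hP) i j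
  rw [this]
  exact Submodule.smul_mem _ _ hPQ.2

end Involutions

/-! ### Binary forms in characteristic two -/

section BinaryForms

variable {k : Type*} [Field k]

/-- The bracket of two vectors of `k²`, up to sign (in characteristic two, the determinant). -/
def wedge (p q : Fin 2 → k) : k := p 0 * q 1 + q 0 * p 1

/-- The polarization of the odd part of a binary sextic, divided by the bracket. -/
def oddPolar (f : Fin 7 → k) (p q : Fin 2 → k) : k :=
  f 1 * (p 1 * q 1) ^ 2 + f 3 * (p 0 * q 0) * (p 1 * q 1) + f 5 * (p 0 * q 0) ^ 2

/-- The value of a binary sextic. -/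
def sextic (f : Fin 7 → k) (p : Fin 2 → k) : k :=
  f 0 * p 1 ^ 6 + f 1 * p 0 * p 1 ^ 5 + f 2 * p 0 ^ 2 * p 1 ^ 4 + f 3 * p 0 ^ 3 * p 1 ^ 3
    + f 4 * p 0 ^ 4 * p 1 ^ 2 + f 5 * p 0 ^ 5 * p 1 + f 6 * p 0 ^ 6

lemma eval_binaryForm_six (f : Fin 7 → k) (p : Fin 2 → k) :
    eval p (binaryForm 6 f) = sextic f p := by
  simp [binaryForm, sextic, Fin.sum_univ_succ, Fin.succ]
  ring

lemma eval_binaryForm_three (h : Fin 4 → k) (p : Fin 2 → k) :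
    eval p (binaryForm 3 h)
      = h 0 * p 1 ^ 3 + h 1 * p 0 * p 1 ^ 2 + h 2 * p 0 ^ 2 * p 1 + h 3 * p 0 ^ 3 := by
  simp [binaryForm, Fin.sum_univ_succ, Fin.succ]
  ring

lemma eval_pderiv_binaryForm_six [CharP k 2] (f : Fin 7 → k) (p : Fin 2 → k) :
    eval p (pderiv 0 (binaryForm 6 f)) = p 1 * oddPolar f p p ∧
    eval p (pderiv 1 (binaryForm 6 f)) = p 0 * oddPolar f p p := by
  have h2 : (2 : k) = 0 := CharTwo.two_eq_zero
  constructor <;>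
  · simp [binaryForm, oddPolar, Fin.sum_univ_succ, Fin.succ, pderiv_X]
    grind

lemma eval_pderiv_binaryForm_three [CharP k 2] (h : Fin 4 → k) (p : Fin 2 → k) :
    eval p (pderiv 0 (binaryForm 3 h)) = h 1 * p 1 ^ 2 + h 3 * p 0 ^ 2 ∧
    eval p (pderiv 1 (binaryForm 3 h)) = h 0 * p 1 ^ 2 + h 2 * p 0 ^ 2 := by
  have h2 : (2 : k) = 0 := CharTwo.two_eq_zero
  constructor <;>
  · simp [binaryForm, Fin.sum_univ_succ, Fin.succ, pderiv_X]
    grind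

variable [IsAlgClosed k]

/-- A binary quadratic form over an algebraically closed field is a product of linear forms. -/
lemma exists_quadratic_factors (q₀ q₁ q₂ : k) : ∃ r s : Fin 2 → k,
    q₀ = r 1 * s 1 ∧ q₁ = wedge r s ∧ q₂ = r 0 * s 0 := by
  by_cases h : q₂ = 0
  · exact ⟨![0, 1], ![q₁, q₀], by simp, by simp [wedge], by simp [h]⟩
  · obtain ⟨x, hx⟩ := IsAlgClosed.exists_root (Cubic.toPoly ⟨0, q₂, q₁, q₀⟩)
      (by rw [Cubic.degree_of_b_ne_zero rfl h]; decide)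
    simp [Cubic.toPoly, Polynomial.IsRoot] at hx
    refine ⟨![1, -x], ![q₂, q₁ + q₂ * x], ?_, ?_, ?_⟩ <;> simp [wedge]
    linear_combination hx

/-- A binary cubic form over an algebraically closed field is a product of linear forms. -/
lemma exists_cubic_factors (h : Fin 4 → k) : ∃ r₁ r₂ r₃ : Fin 2 → k,
    h 0 = r₁ 0 * r₂ 0 * r₃ 0 ∧
    h 1 = r₁ 0 * r₂ 0 * r₃ 1 + r₁ 0 * r₂ 1 * r₃ 0 + r₁ 1 * r₂ 0 * r₃ 0 ∧
    h 2 = r₁ 0 * r₂ 1 * r₃ 1 + r₁ 1 * r₂ 0 * r₃ 1 + r₁ 1 * r₂ 1 * r₃ 0 ∧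
    h 3 = r₁ 1 * r₂ 1 * r₃ 1 := by
  by_cases h3 : h 3 = 0
  · obtain ⟨r, s, h0, h1, h2⟩ := exists_quadratic_factors (h 2) (h 1) (h 0)
    refine ⟨![1, 0], r, s, ?_, ?_, ?_, ?_⟩ <;> simp [wedge, *] at *
    ring
  · obtain ⟨x, hx⟩ := IsAlgClosed.exists_root (Cubic.toPoly ⟨h 3, h 2, h 1, h 0⟩)
      (by rw [Cubic.degree_of_a_ne_zero h3]; decide)
    simp [Cubic.toPoly, Polynomial.IsRoot] at hx
    obtain ⟨r, s, h0, h1, h2⟩ := exists_quadratic_factors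
      (h 3) (h 2 + h 3 * x) (h 1 + h 2 * x + h 3 * x ^ 2)
    refine ⟨![-x, 1], r, s, ?_, ?_, ?_, ?_⟩ <;> simp [wedge] at *
    · linear_combination hx - x * h2
    · linear_combination h2 - x * h1
    · linear_combination h1 - x * h0
    · linear_combination h0

/-- A monic quadratic equation over an algebraically closed field is soluble. -/
lemma exists_sq_add_mul_eq (u t : k) : ∃ y : k, y ^ 2 + u * y = t := by
  obtain ⟨y, hy⟩ := IsAlgClosed.exists_root (Cubic.toPoly ⟨0, 1, u, -t⟩)
    (by rw [Cubic.degree_of_b_ne_zero rfl one_ne_zero]; decide)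
  simp [Cubic.toPoly, Polynomial.IsRoot] at hy
  exact ⟨y, by linear_combination hy⟩

/-- Rescaling three variables so that the coefficients of a quartic match in pairs. -/
lemma exists_rescaling {s₁ s₂ s₃ B₁ B₂ B₃ : k} (hs₁ : s₁ ≠ 0) (hs₂ : s₂ ≠ 0) (hs₃ : s₃ ≠ 0)
    (hB₁ : B₁ ≠ 0) (hB₂ : B₂ ≠ 0) (hB₃ : B₃ ≠ 0) : ∃ μ₁ μ₂ μ₃ : k, μ₁ ≠ 0 ∧ μ₂ ≠ 0 ∧ μ₃ ≠ 0 ∧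
      s₁ * μ₁ = B₁ * μ₂ * μ₃ ∧ s₂ * μ₂ = B₂ * μ₁ * μ₃ ∧ s₃ * μ₃ = B₃ * μ₁ * μ₂ := by
  -- Multiplying the second and third equations determines μ₁², the first and second μ₃²; the third
  -- equation then gives μ₂.
  obtain ⟨μ₁, h₁⟩ := IsAlgClosed.exists_pow_nat_eq (s₂ * s₃ / (B₂ * B₃)) (n := 2) two_pos
  obtain ⟨μ₃, h₃⟩ := IsAlgClosed.exists_pow_nat_eq (s₁ * s₂ / (B₁ * B₂)) (n := 2) two_pos
  have n₁ : μ₁ ≠ 0 := by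
    have : μ₁ ^ 2 ≠ 0 := by rw [h₁]; simp [*]
    exact pow_ne_zero_iff two_ne_zero |>.mp this
  have n₃ : μ₃ ≠ 0 := by
    have : μ₃ ^ 2 ≠ 0 := by rw [h₃]; simp [*]
    exact pow_ne_zero_iff two_ne_zero |>.mp this
  field_simp at h₁ h₃
  refine ⟨μ₁, s₃ * μ₃ / (B₃ * μ₁), μ₃, n₁, by simp_all, n₃, ?_, ?_, ?_⟩
  · field_simp
    refine mul_left_cancel₀ hB₂ ?_
    linear_combination s₁ * h₁ - s₃ * h₃
  · field_simp
    linear_combination -h₁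
  · field_simp

end BinaryForms

/-! ### Interpolation identities at the roots of the cubic -/

section Identities

variable {k : Type*} [Field k] [CharP k 2] (r₁ r₂ r₃ p q : Fin 2 → k)

-- The linear combination of the mᵢ on the left is the shift in `shiftedCoord`, which is chosen so
-- that only products of two of the mᵢ remain on the right.
set_option maxHeartbeats 4000000 in
lemma oddPolar_interpolation (f : Fin 7 → k) :
    let m₁ := wedge r₁ p * wedge r₁ q
    let m₂ := wedge r₂ p * wedge r₂ q
    let m₃ := wedge r₃ p * wedge r₃ q
    let Δ := wedge r₁ r₂ * wedge r₁ r₃ * wedge r₂ r₃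
    Δ * (wedge p q * (oddPolar f r₂ r₃ * m₁ + oddPolar f r₁ r₃ * m₂ + oddPolar f r₁ r₂ * m₃)
        + Δ * oddPolar f p q) =
      wedge r₂ r₃ ^ 2 * oddPolar f r₁ r₁ * (m₂ * m₃)
        + wedge r₁ r₃ ^ 2 * oddPolar f r₂ r₂ * (m₁ * m₃)
        + wedge r₁ r₂ ^ 2 * oddPolar f r₃ r₃ * (m₁ * m₂) := by
  simp only [wedge, oddPolar]
  grind

end Identities

section Relation

variable {k : Type*} [Field k] [CharP k 2] (r₁ r₂ r₃ p q : Fin 2 → k)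

set_option maxHeartbeats 4000000 in
/-- Interpolation of a binary cubic at the three roots, in polarized form. -/
lemma cubic_interpolation (c₀ c₁ c₂ c₃ : k) :
    let c : (Fin 2 → k) → k := fun p =>
      c₀ * p 1 ^ 3 + c₁ * p 0 * p 1 ^ 2 + c₂ * p 0 ^ 2 * p 1 + c₃ * p 0 ^ 3
    let m₁ := wedge r₁ p * wedge r₁ q
    let m₂ := wedge r₂ p * wedge r₂ q
    let m₃ := wedge r₃ p * wedge r₃ q
    wedge r₁ r₂ * wedge r₁ r₃ * wedge r₂ r₃ * (wedge r₁ p * wedge r₂ p * wedge r₃ p * c q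
        + wedge r₁ q * wedge r₂ q * wedge r₃ q * c p) =
      wedge p q * (c r₁ * wedge r₂ r₃ * (m₂ * m₃) + c r₂ * wedge r₁ r₃ * (m₁ * m₃)
        + c r₃ * wedge r₁ r₂ * (m₁ * m₂)) := by
  simp only [wedge]
  grind

/-- The property of a binary sextic `f` that expresses the polarization of `f`
against the squares of a cubic through its values at the roots of the cubic. -/
def Interpolates (f : Fin 7 → k) : Prop :=
  let m₁ := wedge r₁ p * wedge r₁ q
  let m₂ := wedge r₂ p * wedge r₂ q
  let m₃ := wedge r₃ p * wedge r₃ q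
  let Δ := wedge r₁ r₂ * wedge r₁ r₃ * wedge r₂ r₃
  Δ * (m₁ * m₂ * m₃ * wedge p q * (wedge p q * (oddPolar f r₂ r₃ * m₁ + oddPolar f r₁ r₃ * m₂
      + oddPolar f r₁ r₂ * m₃) + Δ * oddPolar f p q)
    + Δ * ((wedge r₁ p * wedge r₂ p * wedge r₃ p) ^ 2 * sextic f q
      + (wedge r₁ q * wedge r₂ q * wedge r₃ q) ^ 2 * sextic f p)) =
  wedge p q ^ 2 * (sextic f r₁ * wedge r₂ r₃ ^ 2 * (m₂ * m₃) ^ 2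
    + sextic f r₂ * wedge r₁ r₃ ^ 2 * (m₁ * m₃) ^ 2
    + sextic f r₃ * wedge r₁ r₂ ^ 2 * (m₁ * m₂) ^ 2)

/-- An even monomial has no odd part and is the square of a cubic monomial, so the identity is the
square of `cubic_interpolation`. -/
lemma interpolates_single_even (j : Fin 4) :
    Interpolates r₁ r₂ r₃ p q (Pi.single (⟨2 * j, by omega⟩ : Fin 7) 1) := by
  have h := cubic_interpolation r₁ r₂ r₃ p q (if j = 0 then 1 else 0) (if j = 1 then 1 else 0)
    (if j = 2 then 1 else 0) (if j = 3 then 1 else 0)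
  have h' := congrArg (· ^ 2) h
  fin_cases j <;>
    simp [Interpolates, oddPolar, sextic, Fin.ext_iff, CharTwo.add_sq, mul_pow] at h' ⊢ <;>
    linear_combination h'

set_option maxHeartbeats 4000000 in
lemma interpolates_single_one : Interpolates r₁ r₂ r₃ p q (Pi.single 1 1) := by
  simp [Interpolates, oddPolar, sextic, wedge]
  grind

set_option maxHeartbeats 4000000 in
lemma interpolates_single_three : Interpolates r₁ r₂ r₃ p q (Pi.single 3 1) := by
  simp [Interpolates, oddPolar, sextic, wedge]
  grind

set_option maxHeartbeats 4000000 in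
lemma interpolates_single_five : Interpolates r₁ r₂ r₃ p q (Pi.single 5 1) := by
  simp [Interpolates, oddPolar, sextic, wedge]
  grind

/-- Both sides are linear in f, so the seven monomials suffice. -/
lemma interpolates (f : Fin 7 → k) : Interpolates r₁ r₂ r₃ p q f := by
  have h0 := interpolates_single_even r₁ r₂ r₃ p q 0
  have h2 := interpolates_single_even r₁ r₂ r₃ p q 1
  have h4 := interpolates_single_even r₁ r₂ r₃ p q 2
  have h6 := interpolates_single_even r₁ r₂ r₃ p q 3
  have h1 := interpolates_single_one r₁ r₂ r₃ p q
  have h3 := interpolates_single_three r₁ r₂ r₃ p q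
  have h5 := interpolates_single_five r₁ r₂ r₃ p q
  simp [Interpolates, oddPolar, sextic, Fin.ext_iff] at h0 h1 h2 h3 h4 h5 h6 ⊢
  linear_combination f 0 * h0 + f 1 * h1 + f 2 * h2 + f 3 * h3 + f 4 * h4 + f 5 * h5 + f 6 * h6

end Relation

/-! ### The quartic relation between the Kummer coordinates -/

section KummerRelation

variable {k : Type*} [Field k]

lemma wedge_comm (p q : Fin 2 → k) : wedge p q = wedge q p := by
  simp only [wedge]; ring

/-- The linear form on `k⁴` whose value at `[n, σ, π, κ]`, where `n T² + σ T S + π S²` is the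
product of the linear forms vanishing at `p` and `q`, is the product of the brackets of `r` with
`p` and `q`. -/
def rootForm (r : Fin 2 → k) (v : Fin 4 → k) : k :=
  r 0 ^ 2 * v 0 + r 0 * r 1 * v 1 + r 1 ^ 2 * v 2

lemma rootForm_eq {p q : Fin 2 → k} {v : Fin 4 → k} (h0 : v 0 = p 1 * q 1)
    (h1 : v 1 = wedge p q) (h2 : v 2 = p 0 * q 0) (r : Fin 2 → k) :
    rootForm r v = wedge r p * wedge r q := by
  simp only [rootForm, h0, h1, h2, wedge]; ring

/-- The discriminant of the cubic with roots `r₁`, `r₂`, `r₃`, up to a square. -/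
def rootDisc (r₁ r₂ r₃ : Fin 2 → k) : k := wedge r₁ r₂ * wedge r₁ r₃ * wedge r₂ r₃

/-- The last coordinate of the Kummer surface, shifted by a linear form. -/
def shiftedCoord (f : Fin 7 → k) (r₁ r₂ r₃ : Fin 2 → k) (v : Fin 4 → k) : k :=
  v 3 + (oddPolar f r₂ r₃ * rootForm r₁ v + oddPolar f r₁ r₃ * rootForm r₂ v
    + oddPolar f r₁ r₂ * rootForm r₃ v) / rootDisc r₁ r₂ r₃

/-- The coefficient of the Kummer quartic attached to the root `r` of the cubic with
roots `r`, `s`, `t`. -/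
def rootCoeff (f : Fin 7 → k) (r s t : Fin 2 → k) : k :=
  (sextic f r * (wedge r s * wedge r t) ^ 2 + oddPolar f r r ^ 2) / (wedge r s * wedge r t) ^ 4

/-- The Kummer quartic of a curve of genus two, in terms of the roots of the cubic. -/
def kummerValue (f : Fin 7 → k) (r₁ r₂ r₃ : Fin 2 → k) (v : Fin 4 → k) : k :=
  v 1 ^ 2 * shiftedCoord f r₁ r₂ r₃ v ^ 2
    + rootForm r₁ v * rootForm r₂ v * rootForm r₃ v * shiftedCoord f r₁ r₂ r₃ v
    + rootCoeff f r₁ r₂ r₃ * (rootForm r₂ v * rootForm r₃ v) ^ 2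
    + rootCoeff f r₂ r₁ r₃ * (rootForm r₁ v * rootForm r₃ v) ^ 2
    + rootCoeff f r₃ r₁ r₂ * (rootForm r₁ v * rootForm r₂ v) ^ 2

variable [CharP k 2]

/-- Elimination of y and y'. In characteristic two, (uy' + u'y)² = u²t' + u'²t + uu'(uy' + u'y) by
the equations of the curve, and hx expresses the last bracket through x. The hypotheses hT and hI
turn what remains into a combination of the Mᵢ², with M₁, M₂, M₃ the products of two of the mᵢ. -/
lemma quartic_relation {σ u u' y y' t t' x T Δ d₁ d₂ d₃ M₁ M₂ M₃ F₁ F₂ F₃ φ₁ φ₂ φ₃ A₁ A₂ A₃ : k}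
    (hy : y ^ 2 + u * y = t) (hy' : y' ^ 2 + u' * y' = t')
    (hx : Δ * (σ ^ 2 * x) = Δ * (u * y' + u' * y) + σ * T)
    (hT : Δ * T = d₁ ^ 2 * φ₁ * M₁ + d₂ ^ 2 * φ₂ * M₂ + d₃ ^ 2 * φ₃ * M₃)
    (hI : Δ * (u * u' * σ * T + Δ * (u ^ 2 * t' + u' ^ 2 * t)) =
      σ ^ 2 * (F₁ * d₁ ^ 2 * M₁ ^ 2 + F₂ * d₂ ^ 2 * M₂ ^ 2 + F₃ * d₃ ^ 2 * M₃ ^ 2))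
    (hA₁ : Δ ^ 4 * A₁ = F₁ * d₁ ^ 2 * Δ ^ 2 + d₁ ^ 4 * φ₁ ^ 2)
    (hA₂ : Δ ^ 4 * A₂ = F₂ * d₂ ^ 2 * Δ ^ 2 + d₂ ^ 4 * φ₂ ^ 2)
    (hA₃ : Δ ^ 4 * A₃ = F₃ * d₃ ^ 2 * Δ ^ 2 + d₃ ^ 4 * φ₃ ^ 2) :
    Δ ^ 4 * σ ^ 2 * (σ ^ 2 * x ^ 2 + u * u' * x
      + A₁ * M₁ ^ 2 + A₂ * M₂ ^ 2 + A₃ * M₃ ^ 2) = 0 := by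
  have h2 : (2 : k) = 0 := CharTwo.two_eq_zero
  have hx2 : Δ ^ 2 * (σ ^ 4 * x ^ 2) = Δ ^ 2 * (u ^ 2 * y' ^ 2 + u' ^ 2 * y ^ 2)
      + σ ^ 2 * T ^ 2 := by
    have := congrArg (· ^ 2) hx
    simp only [CharTwo.add_sq, mul_pow] at this
    linear_combination this
  have hT2 : Δ ^ 2 * T ^ 2 = d₁ ^ 4 * φ₁ ^ 2 * M₁ ^ 2 + d₂ ^ 4 * φ₂ ^ 2 * M₂ ^ 2
      + d₃ ^ 4 * φ₃ ^ 2 * M₃ ^ 2 := by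
    have := congrArg (· ^ 2) hT
    simp only [CharTwo.add_sq, mul_pow] at this
    linear_combination this
  have hs : Δ ^ 2 * (σ ^ 2 * (σ ^ 2 * x ^ 2 + u * u' * x)) =
      σ ^ 2 * (F₁ * d₁ ^ 2 * M₁ ^ 2 + F₂ * d₂ ^ 2 * M₂ ^ 2 + F₃ * d₃ ^ 2 * M₃ ^ 2)
        + σ ^ 2 * T ^ 2 := by
    subst hy hy'
    linear_combination hx2 + Δ * u * u' * hx + hI
  linear_combination Δ ^ 2 * hs + σ ^ 2 * (hT2 + M₁ ^ 2 * hA₁ + M₂ ^ 2 * hA₂ + M₃ ^ 2 * hA₃)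
    + σ ^ 2 * (Δ ^ 2 * (F₁ * d₁ ^ 2 * M₁ ^ 2 + F₂ * d₂ ^ 2 * M₂ ^ 2 + F₃ * d₃ ^ 2 * M₃ ^ 2)
      + d₁ ^ 4 * φ₁ ^ 2 * M₁ ^ 2 + d₂ ^ 4 * φ₂ ^ 2 * M₂ ^ 2 + d₃ ^ 4 * φ₃ ^ 2 * M₃ ^ 2) * h2

lemma kummerValue_eq_zero (f : Fin 7 → k) {r₁ r₂ r₃ p q : Fin 2 → k} (h₁₂ : wedge r₁ r₂ ≠ 0)
    (h₁₃ : wedge r₁ r₃ ≠ 0) (h₂₃ : wedge r₂ r₃ ≠ 0) (hpq : wedge p q ≠ 0) {y y' : k}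
    (hy : y ^ 2 + wedge r₁ p * wedge r₂ p * wedge r₃ p * y = sextic f p)
    (hy' : y' ^ 2 + wedge r₁ q * wedge r₂ q * wedge r₃ q * y' = sextic f q)
    {v : Fin 4 → k} (h0 : v 0 = p 1 * q 1) (h1 : v 1 = wedge p q) (h2 : v 2 = p 0 * q 0)
    (h3 : wedge p q ^ 2 * v 3 = wedge p q * oddPolar f p q
      + wedge r₁ p * wedge r₂ p * wedge r₃ p * y' + wedge r₁ q * wedge r₂ q * wedge r₃ q * y) :
    kummerValue f r₁ r₂ r₃ v = 0 := by
  have hI := interpolates r₁ r₂ r₃ p q f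
  have hT := oddPolar_interpolation r₁ r₂ r₃ p q f
  have e := rootForm_eq h0 h1 h2
  have hΔ : rootDisc r₁ r₂ r₃ ≠ 0 := by simp [rootDisc, *]
  refine (mul_eq_zero.mp ?_).resolve_left
    (mul_ne_zero (pow_ne_zero 4 hΔ) (pow_ne_zero 2 (h1 ▸ hpq)))
  have key := quartic_relation (x := shiftedCoord f r₁ r₂ r₃ v) (A₁ := rootCoeff f r₁ r₂ r₃)
    (A₂ := rootCoeff f r₂ r₁ r₃) (A₃ := rootCoeff f r₃ r₁ r₂) hy hy' ?_ hT
    ((congrArg _ ?_).trans hI) ?_ ?_ ?_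
  · rw [kummerValue, rootDisc, e r₁, e r₂, e r₃, h1]
    linear_combination key
  · simp only [shiftedCoord, e]
    rw [← rootDisc]
    field_simp
    linear_combination rootDisc r₁ r₂ r₃ * h3
  · ring
  · rw [rootCoeff]
    field_simp
  · rw [rootCoeff, wedge_comm r₂ r₁]
    field_simp
  · rw [rootCoeff, wedge_comm r₃ r₁, wedge_comm r₃ r₂]
    field_simp

end KummerRelation

/-! ### Ordinarity and smoothness in terms of the roots of h -/

section KummerSurface

variable {k : Type*} [Field k]

/-- `r₁`, `r₂`, `r₃` are the roots of the cubic form `h` of the curve, suitably normalized. -/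
structure GenusTwoCurve.HasRoots (C : GenusTwoCurve k) (r₁ r₂ r₃ : Fin 2 → k) : Prop where
  eval_h : ∀ p, eval p (binaryForm 3 C.h) = wedge r₁ p * wedge r₂ p * wedge r₃ p
  h_zero : C.h 0 = r₁ 0 * r₂ 0 * r₃ 0
  h_one : C.h 1 = r₁ 0 * r₂ 0 * r₃ 1 + r₁ 0 * r₂ 1 * r₃ 0 + r₁ 1 * r₂ 0 * r₃ 0
  h_two : C.h 2 = r₁ 0 * r₂ 1 * r₃ 1 + r₁ 1 * r₂ 0 * r₃ 1 + r₁ 1 * r₂ 1 * r₃ 0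
  h_three : C.h 3 = r₁ 1 * r₂ 1 * r₃ 1

lemma GenusTwoCurve.exists_hasRoots [IsAlgClosed k] (C : GenusTwoCurve k) :
    ∃ r₁ r₂ r₃, C.HasRoots r₁ r₂ r₃ := by
  obtain ⟨r₁, r₂, r₃, h0, h1, h2, h3⟩ := exists_cubic_factors C.h
  refine ⟨r₁, r₂, r₃, fun p => ?_, h0, h1, h2, h3⟩
  rw [eval_binaryForm_three, h0, h1, h2, h3]
  simp only [wedge]
  ring

namespace GenusTwoCurve.HasRoots

variable {C : GenusTwoCurve k} {r₁ r₂ r₃ : Fin 2 → k}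

lemma rotate (H : C.HasRoots r₁ r₂ r₃) : C.HasRoots r₂ r₁ r₃ ∧ C.HasRoots r₃ r₁ r₂ := by
  obtain ⟨h, h0, h1, h2, h3⟩ := H
  constructor <;> constructor <;> simp only [h, h0, h1, h2, h3] <;> intros <;> ring

variable [CharP k 2]

/-- The Hasse-Witt determinant h₁h₂ - h₀h₃ is the product of the brackets of the roots. -/
lemma rootDisc_ne_zero (H : C.HasRoots r₁ r₂ r₃) (hC : C.IsOrdinary) :
    rootDisc r₁ r₂ r₃ ≠ 0 := by
  have h2 : (2 : k) = 0 := CharTwo.two_eq_zero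
  have : C.hasseWitt.det = rootDisc r₁ r₂ r₃ := by
    simp only [GenusTwoCurve.hasseWitt, Matrix.det_fin_two_of, H.h_zero, H.h_one, H.h_two,
      H.h_three, rootDisc, wedge]
    grind
  exact this ▸ hC

/-- Let y be a square root of f(r₁). If the coefficient vanished, then y times the brackets of r₁
with r₂ and r₃ would be `oddPolar C.f r₁ r₁`. That makes all partial derivatives vanish at the point
(r₁, y), against smoothness. -/
lemma rootCoeff_ne_zero [IsAlgClosed k] (H : C.HasRoots r₁ r₂ r₃) (h₁₂ : wedge r₁ r₂ ≠ 0)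
    (h₁₃ : wedge r₁ r₃ ≠ 0) : rootCoeff C.f r₁ r₂ r₃ ≠ 0 := by
  have h2 : (2 : k) = 0 := CharTwo.two_eq_zero
  intro h0
  rw [rootCoeff, div_eq_zero_iff, or_iff_left (by simp [*]), CharTwo.add_eq_zero] at h0
  obtain ⟨y, hy⟩ := IsAlgClosed.exists_pow_nat_eq (sextic C.f r₁) (n := 2) two_pos
  have hr : wedge r₁ r₁ = 0 := by
    simp only [wedge]; linear_combination r₁ 0 * r₁ 1 * h2
  have hφ : y * (wedge r₁ r₂ * wedge r₁ r₃) = oddPolar C.f r₁ r₁ := by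
    rw [← hy, ← mul_pow] at h0
    exact CharTwo.sq_injective h0
  refine C.smooth r₁ y ?_ ?_ ⟨?_, ?_⟩
  · rintro rfl
    simp [wedge] at h₁₂
  · rw [H.eval_h, hr, eval_binaryForm_six, ← hy]
    ring
  · rw [H.eval_h, hr, h2]
    ring
  · rw [Fin.forall_fin_two, (eval_pderiv_binaryForm_three _ _).1,
      (eval_pderiv_binaryForm_three _ _).2, (eval_pderiv_binaryForm_six _ _).1,
      (eval_pderiv_binaryForm_six _ _).2, ← hφ, H.h_zero, H.h_one, H.h_two, H.h_three]
    simp only [wedge]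
    constructor <;> grind

end GenusTwoCurve.HasRoots

end KummerSurface

/-! ### Reduction of the Kummer surface to standard form -/

section KummerEquation

variable {k : Type*} [Field k]

/-- A linear change of coordinates is continuous for the Zariski topology. -/
lemma continuous_map (g : (Fin 4 → k) ≃ₗ[k] (Fin 4 → k)) :
    Continuous (Projectivization.map (g : (Fin 4 → k) →ₗ[k] (Fin 4 → k)) g.injective) := by
  refine continuous_generateFrom_iff.mpr ?_
  rintro _ ⟨d, G, hG, rfl⟩
  let L : Fin 4 → MvPolynomial (Fin 4) k := fun i => ∑ j, C (g (Pi.single j 1) i) * X j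
  have hL : ∀ i, (L i).IsHomogeneous 1 := fun i =>
    IsHomogeneous.sum _ _ _ fun j _ => isHomogeneous_C_mul_X _ _
  have hLv : ∀ v, (fun i => eval v (L i)) = g v := by
    intro v
    conv_rhs => rw [← LinearMap.sum_single_apply (fun _ => k) v]
    ext i
    simp only [L, map_sum, map_mul, eval_C, eval_X, Finset.sum_apply]
    refine Finset.sum_congr rfl fun j _ => ?_
    have : Pi.single j (v j) = v j • (Pi.single j 1 : Fin 4 → k) := by
      ext; simp [Pi.single_apply]
    rw [this, map_smul]
    simp [mul_comm]
  have : (Projectivization.map (g : (Fin 4 → k) →ₗ[k] (Fin 4 → k)) g.injective) ⁻¹' (zeros G)ᶜ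
      = (zeros (aeval L G))ᶜ := by
    ext P
    induction P with | h v hv =>
    have hgv : g v ≠ 0 := by simpa using hv
    rw [Set.mem_preimage, Projectivization.map_mk, Set.mem_compl_iff, Set.mem_compl_iff,
      mk_mem_zeros_iff (hG.aeval L hL)]
    erw [mk_mem_zeros_iff hG (g v) hgv]
    rw [eval_aeval, hLv]
  rw [this]
  exact (isClosed_zeros (hG.aeval L hL)).isOpen_compl

/-- It expresses σ = v 1 linearly in the three root forms, so that in characteristic two σ² is a sum
of multiples of their squares. -/
lemma disc_mul_eq [CharP k 2] (r₁ r₂ r₃ : Fin 2 → k) (v : Fin 4 → k) :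
    rootDisc r₁ r₂ r₃ * v 1 = wedge r₂ r₃ ^ 2 * rootForm r₁ v + wedge r₁ r₃ ^ 2 * rootForm r₂ v
      + wedge r₁ r₂ ^ 2 * rootForm r₃ v := by
  simp only [rootDisc, wedge, rootForm]
  grind

/-- The change of coordinates of `ℙ³` that brings the Kummer surface to standard form. -/
def normalizingMap (f : Fin 7 → k) (r₁ r₂ r₃ : Fin 2 → k) (μ₁ μ₂ μ₃ : k) :
    (Fin 4 → k) →ₗ[k] (Fin 4 → k) where
  toFun v := ![shiftedCoord f r₁ r₂ r₃ v, rootForm r₁ v / μ₁, rootForm r₂ v / μ₂,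
    rootForm r₃ v / μ₃]
  map_add' v w := by
    ext i
    fin_cases i <;> simp [shiftedCoord, rootForm] <;> ring
  map_smul' c v := by
    ext i
    fin_cases i <;> simp [shiftedCoord, rootForm] <;> ring

variable [CharP k 2] {f : Fin 7 → k} {r₁ r₂ r₃ : Fin 2 → k} {μ₁ μ₂ μ₃ : k}

lemma normalizingMap_injective (h : rootDisc r₁ r₂ r₃ ≠ 0)
    (h₁ : μ₁ ≠ 0) (h₂ : μ₂ ≠ 0) (h₃ : μ₃ ≠ 0) :
    Function.Injective (normalizingMap f r₁ r₂ r₃ μ₁ μ₂ μ₃) := by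
  rw [← LinearMap.ker_eq_bot, LinearMap.ker_eq_bot']
  intro v hv
  have e0 : shiftedCoord f r₁ r₂ r₃ v = 0 := congrFun hv 0
  have e1 : rootForm r₁ v = 0 := by
    simpa [normalizingMap, h₁] using congrFun hv 1
  have e2 : rootForm r₂ v = 0 := by
    simpa [normalizingMap, h₂] using congrFun hv 2
  have e3 : rootForm r₃ v = 0 := by
    simpa [normalizingMap, h₃] using congrFun hv 3
  have v1 : v 1 = 0 := by
    have := disc_mul_eq r₁ r₂ r₃ v
    simpa [e1, e2, e3, h] using this
  have v3 : v 3 = 0 := by simpa [shiftedCoord, e1, e2, e3] using e0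
  have h₁₂ : wedge r₁ r₂ ≠ 0 := by
    intro h0
    simp [rootDisc, h0] at h
  have v0 : v 0 = 0 := by
    -- With v 1 = 0, the first two root forms give a linear system in v 0 and v 2 whose determinant
    -- is the square of the bracket of r₁ and r₂.
    refine (mul_eq_zero.mp ?_).resolve_left (pow_ne_zero 2 h₁₂)
    simp only [rootForm, v1] at e1 e2
    simp only [wedge]
    grind
  have v2 : v 2 = 0 := by
    refine (mul_eq_zero.mp ?_).resolve_left (pow_ne_zero 2 h₁₂)
    simp only [rootForm, v1] at e1 e2
    simp only [wedge]
    grind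
  ext i
  fin_cases i <;> assumption

/-- In the coordinates zᵢ = mᵢ/μᵢ, the terms x²zᵢ² have coefficient (sᵢμᵢ)², and the term z₂²z₃² has
coefficient (B₁μ₂μ₃)², and similarly for the others. The conditions eᵢ make these agree in pairs;
division by μ₁μ₂μ₃ normalizes the coefficient of the product of the coordinates. -/
lemma mul_eval_normalizingMap (h : rootDisc r₁ r₂ r₃ ≠ 0)
    (h₁ : μ₁ ≠ 0) (h₂ : μ₂ ≠ 0) (h₃ : μ₃ ≠ 0) {s₁ s₂ s₃ B₁ B₂ B₃ : k}
    (hs₁ : s₁ = wedge r₂ r₃ ^ 2 / rootDisc r₁ r₂ r₃)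
    (hs₂ : s₂ = wedge r₁ r₃ ^ 2 / rootDisc r₁ r₂ r₃)
    (hs₃ : s₃ = wedge r₁ r₂ ^ 2 / rootDisc r₁ r₂ r₃)
    (hB₁ : B₁ ^ 2 = rootCoeff f r₁ r₂ r₃) (hB₂ : B₂ ^ 2 = rootCoeff f r₂ r₁ r₃)
    (hB₃ : B₃ ^ 2 = rootCoeff f r₃ r₁ r₂) (e₁ : s₁ * μ₁ = B₁ * μ₂ * μ₃)
    (e₂ : s₂ * μ₂ = B₂ * μ₁ * μ₃) (e₃ : s₃ * μ₃ = B₃ * μ₁ * μ₂) (v : Fin 4 → k) :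
    μ₁ * μ₂ * μ₃ * eval (normalizingMap f r₁ r₂ r₃ μ₁ μ₂ μ₃ v)
      (kummerQuartic ((s₁ * μ₁) ^ 2 / (μ₁ * μ₂ * μ₃)) ((s₂ * μ₂) ^ 2 / (μ₁ * μ₂ * μ₃))
        ((s₃ * μ₃) ^ 2 / (μ₁ * μ₂ * μ₃))) = kummerValue f r₁ r₂ r₃ v := by
  have hv : v 1 = s₁ * rootForm r₁ v + s₂ * rootForm r₂ v + s₃ * rootForm r₃ v := by
    rw [hs₁, hs₂, hs₃]
    field_simp
    linear_combination disc_mul_eq r₁ r₂ r₃ v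
  have hv2 := congrArg (· ^ 2) hv
  simp only [CharTwo.add_sq, mul_pow] at hv2
  have t : ∀ {x y μ μ' m n : k}, μ ≠ 0 → μ' ≠ 0 → x = y * μ * μ' →
      x ^ 2 * ((m / μ) ^ 2 * (n / μ') ^ 2) = y ^ 2 * (m * n) ^ 2 := by
    rintro x y μ μ' m n h h' rfl
    field_simp
  rw [eval_kummerQuartic, kummerValue, hv2, ← hB₁, ← hB₂, ← hB₃]
  simp only [normalizingMap, LinearMap.coe_mk, AddHom.coe_mk, Matrix.cons_val]
  have hM : ∀ {α β γ P Q R W : k}, μ₁ * μ₂ * μ₃ * (α / (μ₁ * μ₂ * μ₃) * P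
      + β / (μ₁ * μ₂ * μ₃) * Q + γ / (μ₁ * μ₂ * μ₃) * R + W)
      = α * P + β * Q + γ * R + μ₁ * μ₂ * μ₃ * W := by
    intros
    field_simp
  rw [hM, mul_add, mul_add, mul_add, t h₂ h₃ e₁, t h₁ h₃ e₂, t h₁ h₂ e₃]
  field_simp
  ring

/-- A point of the quartic with `σ ≠ 0` comes from a pair of points of the curve. -/
lemma exists_kummerCoord_eq [IsAlgClosed k] {C : GenusTwoCurve k} (H : C.HasRoots r₁ r₂ r₃)
    (h₁₂ : wedge r₁ r₂ ≠ 0) (h₁₃ : wedge r₁ r₃ ≠ 0) (h₂₃ : wedge r₂ r₃ ≠ 0) {v : Fin 4 → k}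
    (hv : v 1 ≠ 0) (h0 : kummerValue C.f r₁ r₂ r₃ v = 0) :
    ∃ (p : Fin 2 → k) (y : k) (q : Fin 2 → k) (z : k), C.IsPoint p y ∧ C.IsPoint q z ∧
      wedge p q ≠ 0 ∧ C.kummerCoord p y q z = v := by
  obtain ⟨p, q, e0, e1, e2⟩ := exists_quadratic_factors (v 0) (v 1) (v 2)
  have hpq : wedge p q ≠ 0 := e1 ▸ hv
  have hp : p ≠ 0 := by
    rintro rfl
    simp [wedge] at hpq
  have hq : q ≠ 0 := by
    rintro rfl
    simp [wedge] at hpq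
  obtain ⟨y, hy⟩ := exists_sq_add_mul_eq (wedge r₁ p * wedge r₂ p * wedge r₃ p) (sextic C.f p)
  obtain ⟨z, hz⟩ := exists_sq_add_mul_eq (wedge r₁ q * wedge r₂ q * wedge r₃ q) (sextic C.f q)
  have two : (2 : k) = 0 := CharTwo.two_eq_zero
  suffices ∃ y, y ^ 2 + wedge r₁ p * wedge r₂ p * wedge r₃ p * y = sextic C.f p ∧
      wedge p q ^ 2 * v 3 = wedge p q * oddPolar C.f p q
        + wedge r₁ p * wedge r₂ p * wedge r₃ p * z
        + wedge r₁ q * wedge r₂ q * wedge r₃ q * y by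
    obtain ⟨y, hy, h3⟩ := this
    refine ⟨p, y, q, z, ⟨hp, ?_⟩, ⟨hq, ?_⟩, hpq, ?_⟩
    · rw [H.eval_h, eval_binaryForm_six, hy]
    · rw [H.eval_h, eval_binaryForm_six, hz]
    · ext i
      fin_cases i
      · exact e0.symm
      · exact e1.symm
      · exact e2.symm
      · change (wedge p q * oddPolar C.f p q + eval p (binaryForm 3 C.h) * z
          + eval q (binaryForm 3 C.h) * y) / wedge p q ^ 2 = v 3
        rw [H.eval_h, H.eval_h, ← h3]
        field_simp
  -- The last coordinate obtained from arbitrary points y, z above p and q. It need not be v 3, but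
  -- both are roots of the same quadratic equation.
  set κ := (wedge p q * oddPolar C.f p q + wedge r₁ p * wedge r₂ p * wedge r₃ p * z
    + wedge r₁ q * wedge r₂ q * wedge r₃ q * y) / wedge p q ^ 2 with hκ
  have h3 : wedge p q ^ 2 * κ = wedge p q * oddPolar C.f p q
      + wedge r₁ p * wedge r₂ p * wedge r₃ p * z + wedge r₁ q * wedge r₂ q * wedge r₃ q * y := by
    rw [hκ]
    field_simp
  have hw := kummerValue_eq_zero C.f h₁₂ h₁₃ h₂₃ hpq hy hz (v := ![v 0, v 1, v 2, κ]) e0 e1 e2 h3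
  have hm : ∀ r, rootForm r ![v 0, v 1, v 2, κ] = rootForm r v := fun r => by simp [rootForm]
  have hx : shiftedCoord C.f r₁ r₂ r₃ ![v 0, v 1, v 2, κ]
      = shiftedCoord C.f r₁ r₂ r₃ v + (v 3 + κ) := by
    simp only [shiftedCoord, hm, Matrix.cons_val]
    linear_combination -v 3 * two
  -- Difference of the two quadratic equations. Its second factor corresponds to replacing y by the
  -- conjugate point y + h(p).
  have hprod : (v 3 + κ) * (wedge p q ^ 2 * (v 3 + κ)
      + wedge r₁ p * wedge r₂ p * wedge r₃ p * (wedge r₁ q * wedge r₂ q * wedge r₃ q)) = 0 := by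
    rw [kummerValue] at h0
    simp only [kummerValue, hm, hx, Matrix.cons_val, CharTwo.add_sq] at hw
    simp only [rootForm_eq e0 e1 e2, e1] at hw h0
    linear_combination hw - h0 + wedge p q ^ 2 * v 3 * κ * two
  rcases mul_eq_zero.mp hprod with h | h
  · exact ⟨y, hy, by rw [CharTwo.add_eq_zero.mp h, h3]⟩
  · refine ⟨y + wedge r₁ p * wedge r₂ p * wedge r₃ p, ?_, ?_⟩
    · rw [← hy, CharTwo.add_sq]
      linear_combination (wedge r₁ p * wedge r₂ p * wedge r₃ p) ^ 2 * two
    · linear_combination h - h3 - (wedge p q * oddPolar C.f p q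
        + wedge r₁ p * wedge r₂ p * wedge r₃ p * z + wedge r₁ q * wedge r₂ q * wedge r₃ q * y
        + wedge r₁ p * wedge r₂ p * wedge r₃ p * (wedge r₁ q * wedge r₂ q * wedge r₃ q)) * two

end KummerEquation

/-- The Kummer surface of an ordinary curve of genus two has an equation of the standard form. -/
theorem exists_isKummerEquation {k : Type*} [Field k] [IsAlgClosed k] [CharP k 2]
    (C : GenusTwoCurve k) (hC : C.IsOrdinary) :
    ∃ a b c : k, a ≠ 0 ∧ b ≠ 0 ∧ c ≠ 0 ∧ IsKummerEquation C (kummerQuartic a b c) := by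
  obtain ⟨r₁, r₂, r₃, H⟩ := C.exists_hasRoots
  have hΔ := H.rootDisc_ne_zero hC
  have hw : (wedge r₁ r₂ ≠ 0 ∧ wedge r₁ r₃ ≠ 0) ∧ wedge r₂ r₃ ≠ 0 := by
    simpa [rootDisc] using hΔ
  obtain ⟨⟨h₁₂, h₁₃⟩, h₂₃⟩ := hw
  have hA₁ := H.rootCoeff_ne_zero h₁₂ h₁₃
  have hA₂ := H.rotate.1.rootCoeff_ne_zero (wedge_comm r₁ r₂ ▸ h₁₂) h₂₃
  have hA₃ := H.rotate.2.rootCoeff_ne_zero (wedge_comm r₁ r₃ ▸ h₁₃) (wedge_comm r₂ r₃ ▸ h₂₃)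
  obtain ⟨B₁, hB₁⟩ := IsAlgClosed.exists_pow_nat_eq (rootCoeff C.f r₁ r₂ r₃) (n := 2) two_pos
  obtain ⟨B₂, hB₂⟩ := IsAlgClosed.exists_pow_nat_eq (rootCoeff C.f r₂ r₁ r₃) (n := 2) two_pos
  obtain ⟨B₃, hB₃⟩ := IsAlgClosed.exists_pow_nat_eq (rootCoeff C.f r₃ r₁ r₂) (n := 2) two_pos
  rw [← hB₁, pow_ne_zero_iff two_ne_zero] at hA₁
  rw [← hB₂, pow_ne_zero_iff two_ne_zero] at hA₂
  rw [← hB₃, pow_ne_zero_iff two_ne_zero] at hA₃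
  obtain ⟨s₁, hs₁⟩ : ∃ s, s = wedge r₂ r₃ ^ 2 / rootDisc r₁ r₂ r₃ := ⟨_, rfl⟩
  obtain ⟨s₂, hs₂⟩ : ∃ s, s = wedge r₁ r₃ ^ 2 / rootDisc r₁ r₂ r₃ := ⟨_, rfl⟩
  obtain ⟨s₃, hs₃⟩ : ∃ s, s = wedge r₁ r₂ ^ 2 / rootDisc r₁ r₂ r₃ := ⟨_, rfl⟩
  have n₁ : s₁ ≠ 0 := by simp [*]
  have n₂ : s₂ ≠ 0 := by simp [*]
  have n₃ : s₃ ≠ 0 := by simp [*]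
  obtain ⟨μ₁, μ₂, μ₃, m₁, m₂, m₃, e₁, e₂, e₃⟩ := exists_rescaling n₁ n₂ n₃ hA₁ hA₂ hA₃
  have hval := mul_eval_normalizingMap hΔ m₁ m₂ m₃ hs₁ hs₂ hs₃ hB₁ hB₂ hB₃ e₁ e₂ e₃
  have hM : μ₁ * μ₂ * μ₃ ≠ 0 := by simp [*]
  obtain ⟨a, ha⟩ : ∃ a, a = (s₁ * μ₁) ^ 2 / (μ₁ * μ₂ * μ₃) := ⟨_, rfl⟩
  obtain ⟨b, hb⟩ : ∃ b, b = (s₂ * μ₂) ^ 2 / (μ₁ * μ₂ * μ₃) := ⟨_, rfl⟩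
  obtain ⟨c, hc⟩ : ∃ c, c = (s₃ * μ₃) ^ 2 / (μ₁ * μ₂ * μ₃) := ⟨_, rfl⟩
  rw [← ha, ← hb, ← hc] at hval
  have ha0 : a ≠ 0 := ha ▸ div_ne_zero (pow_ne_zero 2 (mul_ne_zero n₁ m₁)) hM
  have hb0 : b ≠ 0 := hb ▸ div_ne_zero (pow_ne_zero 2 (mul_ne_zero n₂ m₂)) hM
  have hc0 : c ≠ 0 := hc ▸ div_ne_zero (pow_ne_zero 2 (mul_ne_zero n₃ m₃)) hM
  have hF := isHomogeneous_kummerQuartic a b c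
  refine ⟨a, b, c, ha0, hb0, hc0, LinearEquiv.ofInjectiveEndo _
    (normalizingMap_injective (f := C.f) hΔ m₁ m₂ m₃), ?_⟩
  set g := LinearEquiv.ofInjectiveEndo _ (normalizingMap_injective (f := C.f) hΔ m₁ m₂ m₃)
  have hgv : ∀ v, g v = normalizingMap C.f r₁ r₂ r₃ μ₁ μ₂ μ₃ v := fun v => rfl
  have hmem : ∀ v (hv : v ≠ 0), Projectivization.map (g : (Fin 4 → k) →ₗ[k] (Fin 4 → k))
      g.injective (Projectivization.mk k v hv) ∈ zeros (kummerQuartic a b c) ↔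
        kummerValue C.f r₁ r₂ r₃ v = 0 := by
    intro v hv
    refine (mk_mem_zeros_iff hF (g v) (by simpa using hv)).trans ?_
    rw [hgv, ← hval, mul_eq_zero, or_iff_right hM]
  refine le_antisymm (Ideal.span_le.2 ?_) ((Ideal.span_singleton_le_iff_mem _).2
    (Ideal.subset_span ⟨⟨4, hF⟩, ?_⟩))
  · rintro G ⟨⟨d, hG⟩, hsub⟩
    refine Ideal.mem_span_singleton.2 (kummerQuartic_dvd_of_zeros_subset ha0 hb0 hc0 hG ?_)
    -- The linear form that pulls back to v 1. Points with S ≠ 0 come from pairs of points of the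
    -- curve and are dense in the irreducible quartic, so a form vanishing on the Kummer surface
    -- vanishes on the whole quartic.
    let S : MvPolynomial (Fin 4) k := MvPolynomial.C (s₁ * μ₁) * X 1
      + MvPolynomial.C (s₂ * μ₂) * X 2 + MvPolynomial.C (s₃ * μ₃) * X 3
    have hS : S.IsHomogeneous 1 := ((isHomogeneous_C_mul_X _ _).add
      (isHomogeneous_C_mul_X _ _)).add (isHomogeneous_C_mul_X _ _)
    have hS0 : S ≠ 0 := by
      intro h0
      have := congrArg (eval (Pi.single 1 1)) h0
      simp [S, n₁, m₁] at this
    have hSv : ∀ v, eval (g v) S = v 1 := by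
      intro v
      have := disc_mul_eq r₁ r₂ r₃ v
      simp only [hgv, S, normalizingMap, LinearMap.coe_mk, AddHom.coe_mk, map_add, map_mul, eval_C,
        eval_X, Matrix.cons_val, hs₁, hs₂, hs₃]
      field_simp
      linear_combination -this
    have hne := zeros_inter_compl_zeros_nonempty ha0 hb0 hc0 hS
      (not_kummerQuartic_dvd ha0 hb0 hc0 hS0 (hS.totalDegree_le.trans_lt (by norm_num)))
    refine (zeros_subset_closure_inter ha0 hb0 hc0 (isOpen_compl_zeros hS) hne).trans
      ((isClosed_zeros hG).closure_subset_iff.2 ?_)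
    rintro P ⟨hPF, hPS⟩
    refine hsub ?_
    obtain ⟨Q, rfl⟩ : ∃ Q, Projectivization.map (g : (Fin 4 → k) →ₗ[k] (Fin 4 → k))
        g.injective Q = P := by
      induction P using Projectivization.ind with | h w hw =>
      refine ⟨Projectivization.mk k (g.symm w) (by simpa using hw), ?_⟩
      rw [Projectivization.map_mk]
      congr 1
      simp
    refine Set.mem_image_of_mem _ (subset_closure ?_)
    induction Q using Projectivization.ind with | h v hv =>
    have hv1 : v 1 ≠ 0 := by
      rw [← hSv v]
      exact fun h0 => hPS ((mk_mem_zeros_iff hS (g v) (by simpa using hv)).2 h0)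
    obtain ⟨p, y, q, z, hp, hq, hpq, rfl⟩ := exists_kummerCoord_eq H h₁₂ h₁₃ h₂₃ hv1
      ((hmem v hv).1 hPF)
    exact ⟨p, y, q, z, hp, hq, hpq, hv, rfl⟩
  · rw [Set.image_subset_iff]
    refine ((isClosed_zeros hF).preimage (continuous_map g)).closure_subset_iff.2 ?_
    rintro _ ⟨p, y, q, z, ⟨-, hp⟩, ⟨-, hq⟩, hpq, hv, rfl⟩
    change wedge p q ≠ 0 at hpq
    rw [H.eval_h, eval_binaryForm_six] at hp hq
    refine (hmem _ hv).2 (kummerValue_eq_zero C.f h₁₂ h₁₃ h₂₃ hpq hp hq rfl rfl rfl ?_)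
    change wedge p q ^ 2 * ((wedge p q * oddPolar C.f p q + eval p (binaryForm 3 C.h) * z
          + eval q (binaryForm 3 C.h) * y) / wedge p q ^ 2) = _
    rw [H.eval_h, H.eval_h, mul_div_cancel₀ _ (pow_ne_zero 2 hpq)]

end KummerBit

/-! ### The bitangent congruence of an ordinary Kummer quartic -/

open KummerBit in
theorem mainTheorem1 {k : Type*} [Field k] [IsAlgClosed k] [CharP k 2]
    (C : GenusTwoCurve k) (hC : C.IsOrdinary) :
    -- the Kummer quartic surface of `C` has an equation of the standard form
    (∃ a b c : k, a ≠ 0 ∧ b ≠ 0 ∧ c ≠ 0 ∧ IsKummerEquation C (kummerQuartic a b c)) ∧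
    -- and in all coordinates in which it has such an equation:
    ∀ a b c : k, a ≠ 0 → b ≠ 0 → c ≠ 0 → IsKummerEquation C (kummerQuartic a b c) →
      -- `Bit(X)` is a congruence of bidegree `(3, 7)` with exactly seven irreducible components,
      HasBidegree (Bit (kummerQuartic a b c)) 3 7 ∧
      (componentsOf (Bit (kummerQuartic a b c))).ncard = 7 ∧
      componentsOf (Bit (kummerQuartic a b c)) =
        Set.range (skewCongruence k) ∪ {S | ∃ i, S = betaPlane (coordPlane k i)} ∧
      -- three of bidegree `(1, 1)` and four of bidegree `(0, 1)`;
      (∀ i, HasBidegree (skewCongruence k i) 1 1) ∧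
      (∀ i, HasBidegree (betaPlane (coordPlane k i)) 0 1) ∧
      -- the former correspond to the three bitangent involutions of `X`,
      (∃ Φ : Fin 3 → Fin 4 → MvPolynomial (Fin 4) k,
        (∀ i, IsBitangentInvolution (kummerQuartic a b c) (Φ i) ∧
          orbitCongruence (zeros (kummerQuartic a b c)) (Φ i) = skewCongruence k i) ∧
        ∀ Ψ : Fin 4 → MvPolynomial (Fin 4) k, IsBitangentInvolution (kummerQuartic a b c) Ψ →
          ∃ i, SameRationalMap (zeros (kummerQuartic a b c)) Ψ (Φ i)) ∧
      -- and the latter to the four tropes of `X`.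
      (∀ E : Submodule k (Fin 4 → k),
        IsTropePlane (kummerQuartic a b c) E ↔ ∃ i, E = coordPlane k i) := by
  refine ⟨exists_isKummerEquation C hC, fun a b c ha hb hc _ => ?_⟩
  have hcomp : componentsOf (Bit (kummerQuartic a b c)) = Set.range (component k) := by
    rw [Bit_kummerQuartic, componentsOf_iUnion_component]
  refine ⟨?_, ?_, ?_, hasBidegree_skewCongruence, hasBidegree_betaPlane, ⟨cremona k, fun r =>
    ⟨isBitangentInvolution_cremona ha hb hc r, orbitCongruence_cremona ha hb hc r⟩,
    fun Ψ => exists_sameRationalMap_cremona ha hb hc⟩, isTropePlane_iff ha hb hc⟩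
  · rw [Bit_kummerQuartic]
    exact hasBidegree_iUnion_component
  · rw [hcomp, ← Set.image_univ, Set.ncard_image_of_injective _ component_injective,
      Set.ncard_univ]
    simp
  · rw [hcomp]
    ext S
    simp [component, eq_comm]
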